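/- **Setting.** Monoids are commutative with a zero; modules over a monoid $A$ are pointed sets with a compatible $A$-action. $\mathbb P^2$ is the monoid scheme of the fan with rays $u_0=(-1,-1),u_1=(1,0),u_2=(0,1)$, covered by $X_{\sigma_i}=\mathrm{MSpec}\,S_{\sigma_i}$, with $S_{\sigma_0}=\langle x_1,x_2\rangle$, $S_{\sigma_1}=\langle x_1^{-1},x_1^{-1}x_2\rangle$, $S_{\sigma_2}=\langle x_1x_2^{-1},x_2^{-1}\rangle$; put $X_0=1$, $X_1=x_1$, $X_2=x_2$, so that $S_{\sigma_i}$ is generated by the two monomials $X_j/X_i$, $j\ne i$. Indices are read mod 3, and $l_{i,i+1}$ is the line joining the closed points $p_i,p_{i+1}$ of $X_{\sigma_i},X_{\sigma_{i+1}}$. A *coherent $T$-sheaf* is a coherent sheaf whose stalks are of type $\alpha$ ($ax=ay$ implies $x=y$ or $ax=ay=0$) and whose modules over the $X_{\sigma_i}$ admit a grading by the nonzero elements of $S_{\sigma_i}$. A sheaf is *indecomposable* if it is nonzero and is not a direct sum (wedge) of two nonzero sheaves. A *skew shape* in $S_{\sigma_i}$ is a subset $\mathcal S$ of $S_{\sigma_i}\setminus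 0$ convex for divisibility; it is *connected* if it is nonempty and connected as a poset. $M_{\mathcal S}=\mathcal S\sqcup\{0\}$ is the module on which monomials act by multiplication, products outside $\mathcal S$ being $0$. The *type* of a connected skew shape is the pair $(a,b)$, $0\le a,b\le\infty$, where $a$ (resp. $b$) is the number of boxes of $\mathcal S$ in a strip of width one transversal to $l_{i-1,i}$ (resp. $l_{i,i+1}$) as the strip moves out to infinity. If $\mathcal S\subset S_{\sigma_i}$ and $\mathcal S'\subset S_{\sigma_{i+1}}$ have equal finite nonzero types along $l_{i,i+1}$, then for each $n\in\mathbb Z$ there is a unique isomorphism of the restrictions of $\widetilde M_{\mathcal S},\widetilde M_{\mathcal S'}$ to $X_{\sigma_i}\cap X_{\sigma_{i+1}}$ under which $g=(X_{i+1}/X_i)^{-n}h$, where $g,h$ are the generators of the restrictions of $M_{\mathcal S},M_{\mathcal S'}$ to $l_{i,i+1}$ modulo torsion; it is called the gluing of degree $n$. **The list.** 1. *Point sheaves* $\mathfrak T_{\mathcal S,i}$: $\mathcal S\subset S_{\sigma_i}$ is a connected skew shape of type $(0,0)$ (equivalently, finite), $M_i=M_{\mathcal S}$ and $M_j=0$ for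 $j\neq i$. 2. *Helices* $\mathfrak H[i,j,q,n_r,\mathcal S_{k,r}]$: a sequence of connected skew shapes $\mathcal S_{i,1},\mathcal S_{i+1,2},\dots,\mathcal S_{j,q}$ of finite types, $\mathcal S_{k,r}\subset S_{\sigma_k}$, consecutive ones having equal nonzero types along their common line, the first one having type $(0,a)$ with $a>0$ and the last one type $(b,0)$ with $b>0$ (so $q\ge 2$), glued consecutively by the gluings of degrees $n_1,\dots,n_{q-1}\in\mathbb Z$. 3. *Cycles* $\mathfrak C[i,j,q,n_r,\mathcal S_{k,r}]$: the same with $q\geq 1$, $j\equiv i-1 \bmod 3$ (so $3\mid q$), all types of all shapes finite and nonzero, the types of $\mathcal S_{j,q}$ and $\mathcal S_{i,1}$ along $l_{i-1,i}$ also being equal, and an additional gluing of $\mathcal S_{j,q}$ to $\mathcal S_{i,1}$ of degree $n_q\in\mathbb Z$. 4. *Torsion-free rank-one sheaves* $\mathfrak{TF}[\mathcal S_i,m]$: $\mathcal S_i\subset S_{\sigma_i}$ ($i=0,1,2$) are connected skew shapes of type $(\infty,\infty)$ and $m\in\mathbb Z$; if $g_i$ denotes the generator of the minimal completion of $\mathcal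 S_i$ to the shape of a free module, the $\widetilde M_{\mathcal S_i}$ are glued by $g_0=x_1^{-m}g_1$, $g_1=(x_1^{-1}x_2)^{-m}g_2$, $g_0=x_2^{-m}g_2$. **Proposition.** A sheaf on $\mathbb P^2$ is an indecomposable coherent $T$-sheaf if and only if it is isomorphic to a sheaf in this list; in particular every indecomposable coherent $T$-sheaf is isomorphic to one of $\mathfrak T_{\mathcal S,i}$, $\mathfrak H[i,j,q,n_r,\mathcal S_{k,r}]$, $\mathfrak C[i,j,q,n_r,\mathcal S_{k,r}]$, $\mathfrak{TF}[\mathcal S_i,m]$. Consequently, for every field $k$ of characteristic zero, let $\mathfrak n^T_{\mathbb P^2}$ be the Hall Lie algebra, that is, the space of primitive elements for $\Delta(f)([X],[Y])=f([X\oplus Y])$ and unit $\delta_{[0]}$ in the space of finitely supported $k$-valued functions on the isomorphism classes of coherent $T$-sheaves. Then the delta functions $\delta_{[\mathcal F]}$ of the isomorphism classes of the sheaves in the list form a $k$-basis of $\mathfrak n^T_{\mathbb P^2}$. -/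

import Mathlib

/-! # Coherent T-sheaves on the monoid scheme P^2 and their classification data

Monoids are commutative monoids with zero, `A`-modules are pointed sets (`Zero M`) with an action
of `A` (`MulActionWithZero A M`). -/

open Filter

universe u v

namespace MonoidP2

/-! ## The fan of P^2 and its monoids -/

/-- The ray generators `u₀ = (-1,-1)`, `u₁ = (1,0)`, `u₂ = (0,1)` of the fan of `P^2`. The maximal
cone `σ_i` is spanned by the two rays other than `u_i`. -/
def ray : Fin 3 → ℤ × ℤ := ![(-1, -1), (1, 0), (0, 1)]

/-- The pairing between the character lattice `ℤ²` (`(a, b)` is the monomial `x₁^a x₂^b`) and the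
lattice containing the fan. -/
def pairing (m w : ℤ × ℤ) : ℤ := m.1 * w.1 + m.2 * w.2

/-- The lattice points of the dual of the cone spanned by the rays `u_j`, `j ∈ R`. -/
def dualCone (R : Finset (Fin 3)) : AddSubmonoid (ℤ × ℤ) where
  carrier := {m | ∀ j ∈ R, 0 ≤ pairing m (ray j)}
  zero_mem' := by intro j _; simp [pairing]
  add_mem' := by
    intro a b ha hb j hj
    have h1 := ha j hj
    have h2 := hb j hj
    simp only [pairing, Prod.fst_add, Prod.snd_add] at *
    nlinarith

/-- The monoid `S_σ` (with zero adjoined) of the cone `σ` spanned by the rays `u_j`, `j ∈ R`;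
`MSpec S_σ` is the corresponding open subscheme of `P^2`. -/
abbrev ConeMonoid (R : Finset (Fin 3)) : Type := WithZero (Multiplicative (dualCone R))

/-- The monomial with exponent vector `a`, as an element of `S_σ`. -/
def mono {R : Finset (Fin 3)} (a : ℤ × ℤ) (ha : a ∈ dualCone R) : ConeMonoid R :=
  ((Multiplicative.ofAdd (⟨a, ha⟩ : dualCone R) : Multiplicative (dualCone R)) : ConeMonoid R)

/-- The rays of the maximal cone `σ_i`. Thus `S_{σ_0} = ⟨x₁, x₂⟩`,
`S_{σ_1} = ⟨x₁⁻¹, x₁⁻¹ x₂⟩`, `S_{σ_2} = ⟨x₁ x₂⁻¹, x₂⁻¹⟩`. -/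
def chart (i : Fin 3) : Finset (Fin 3) := {i}ᶜ

/-- The ray of the cone `σ_i ∩ σ_{i+1}`, indices being read mod 3; its monoid is that of
`X_{σ_i} ∩ X_{σ_{i+1}}`, the open set around the generic point of the line `l_{i,i+1}`. -/
def edge (i : Fin 3) : Finset (Fin 3) := {i, i + 1}ᶜ

/-- Exponents `a` of monomials in the monoid of `R` that become invertible in the monoid of `R'`. -/
def inverted (R R' : Finset (Fin 3)) : Set (ℤ × ℤ) := {a | a ∈ dualCone R ∧ -a ∈ dualCone R'}

/-! ## Modules -/

section Modules

variable (R : Finset (Fin 3)) (M : Type u) [Zero M] [MulActionWithZero (ConeMonoid R) M]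

/-- Finitely generated modules. -/
def ModFG : Prop := ∃ g : Finset M, ∀ m : M, ∃ a : ConeMonoid R, ∃ x ∈ g, m = a • x

/-- Type-α modules. -/
def ModAlpha : Prop :=
  ∀ (a : ConeMonoid R) (x y : M), a • x = a • y → x = y ∨ (a • x = 0 ∧ a • y = 0)

/-- Modules that admit a grading by the monomials of `S_σ` (`S_σ` being graded by itself). A
decomposition of a pointed set into pieces is a degree function on its nonzero elements (the value
of `deg` at `0` plays no role). -/
def ModGradable : Prop :=
  ∃ deg : M → dualCone R, ∀ (a : ℤ × ℤ) (ha : a ∈ dualCone R) (x : M),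
    mono a ha • x ≠ 0 → deg (mono a ha • x) = ⟨a, ha⟩ + deg x

end Modules

/-- `f : M → N` exhibits the module `N` over the monoid of `R'` as the localization of the module
`M` over the monoid of `R`, at the monomials of the latter that are invertible in the former
(for `R' ⊆ R`). -/
structure IsLocMap (R R' : Finset (Fin 3)) {M : Type u} {N : Type v} [Zero M] [Zero N]
    [MulActionWithZero (ConeMonoid R) M] [MulActionWithZero (ConeMonoid R') N]
    (f : M → N) : Prop where
  map_zero : f 0 = 0
  map_smul : ∀ (a : ℤ × ℤ) (ha : a ∈ dualCone R) (ha' : a ∈ dualCone R') (m : M),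
    f (mono a ha • m) = mono a ha' • f m
  surj : ∀ n : N, ∃ a ∈ inverted R R', ∃ (ha' : a ∈ dualCone R') (m : M), mono a ha' • n = f m
  inj : ∀ m m' : M, f m = f m' →
    ∃ a ∈ inverted R R', ∃ ha : a ∈ dualCone R, mono a ha • m = mono a ha • m'

/-- The direct sum (wedge) of two modules: the union of the two axes in the product. -/
def Wedge (M : Type u) (N : Type v) [Zero M] [Zero N] : Type max u v :=
  {p : M × N // p.1 = 0 ∨ p.2 = 0}

section Wedge

variable {A : Type*} [MonoidWithZero A] {M : Type u} {N : Type v} [Zero M] [Zero N]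

instance : Zero (Wedge M N) := ⟨⟨(0, 0), Or.inl rfl⟩⟩

instance [MulActionWithZero A M] [MulActionWithZero A N] : MulActionWithZero A (Wedge M N) where
  smul a p := ⟨(a • p.1.1, a • p.1.2), by
    rcases p.2 with h | h
    · left; simp [h]
    · right; simp [h]⟩
  one_smul p := Subtype.ext (Prod.ext (one_smul A _) (one_smul A _))
  mul_smul a b p := Subtype.ext (Prod.ext (mul_smul a b _) (mul_smul a b _))
  smul_zero a := Subtype.ext (Prod.ext (smul_zero a) (smul_zero a))
  zero_smul p := Subtype.ext (Prod.ext (zero_smul A _) (zero_smul A _))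

/-- The map induced on wedges by two pointed maps. -/
def wedgeMap {M' : Type u} {N' : Type v} [Zero M'] [Zero N'] (f : M → M') (g : N → N')
    (hf : f 0 = 0) (hg : g 0 = 0) (p : Wedge M N) : Wedge M' N' :=
  ⟨(f p.1.1, g p.1.2), by
    rcases p.2 with h | h
    · left; simp [h, hf]
    · right; simp [h, hg]⟩

end Wedge

theorem inverted_add {R R' : Finset (Fin 3)} {a b : ℤ × ℤ} (ha : a ∈ inverted R R')
    (hb : b ∈ inverted R R') : a + b ∈ inverted R R' :=
  ⟨add_mem ha.1 hb.1, by rw [neg_add]; exact add_mem ha.2 hb.2⟩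

theorem mono_add_smul {R : Finset (Fin 3)} {M : Type u} [Zero M]
    [MulActionWithZero (ConeMonoid R) M] {a b : ℤ × ℤ} (ha : a ∈ dualCone R)
    (hb : b ∈ dualCone R) (hab : a + b ∈ dualCone R) (m : M) :
    mono (a + b) hab • m = mono a ha • mono b hb • m := by
  rw [← mul_smul]; rfl

theorem zero_mem_inverted (R R' : Finset (Fin 3)) : (0 : ℤ × ℤ) ∈ inverted R R' :=
  ⟨zero_mem _, by rw [neg_zero]; exact zero_mem _⟩

theorem mono_zero_smul {R : Finset (Fin 3)} {M : Type u} [Zero M]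
    [MulActionWithZero (ConeMonoid R) M] (h : (0 : ℤ × ℤ) ∈ dualCone R) (m : M) :
    mono 0 h • m = m := one_smul (ConeMonoid R) m

theorem IsLocMap.wedge {R R' : Finset (Fin 3)} {M M' : Type u} {N N' : Type u}
    [Zero M] [Zero N] [Zero M'] [Zero N']
    [MulActionWithZero (ConeMonoid R) M] [MulActionWithZero (ConeMonoid R) N]
    [MulActionWithZero (ConeMonoid R') M'] [MulActionWithZero (ConeMonoid R') N']
    {f : M → M'} {g : N → N'} (hf : IsLocMap R R' f) (hg : IsLocMap R R' g) :
    IsLocMap R R' (wedgeMap f g hf.map_zero hg.map_zero) where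
  map_zero := Subtype.ext (Prod.ext hf.map_zero hg.map_zero)
  map_smul a ha ha' m := Subtype.ext (Prod.ext (hf.map_smul a ha ha' _) (hg.map_smul a ha ha' _))
  surj n := by
    obtain ⟨⟨x, y⟩, h⟩ := n
    rcases h with h | h <;> simp only at h <;> subst h
    · obtain ⟨a, ha, ha', m, hm⟩ := hg.surj y
      refine ⟨a, ha, ha', ⟨(0, m), Or.inl rfl⟩, Subtype.ext (Prod.ext ?_ hm)⟩
      exact (smul_zero _).trans hf.map_zero.symm
    · obtain ⟨a, ha, ha', m, hm⟩ := hf.surj x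
      refine ⟨a, ha, ha', ⟨(m, 0), Or.inr rfl⟩, Subtype.ext (Prod.ext hm ?_)⟩
      exact (smul_zero _).trans hg.map_zero.symm
  inj m m' h := by
    have h1 := hf.inj m.1.1 m'.1.1 (congrArg (fun z => z.1.1) h)
    have h2 := hg.inj m.1.2 m'.1.2 (congrArg (fun z => z.1.2) h)
    obtain ⟨a, ha, ha1, e1⟩ := h1
    obtain ⟨b, hb, hb1, e2⟩ := h2
    refine ⟨a + b, inverted_add ha hb, add_mem ha1 hb1, Subtype.ext (Prod.ext ?_ ?_)⟩
    · change mono (a + b) _ • m.1.1 = mono (a + b) _ • m'.1.1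
      have hba : b + a ∈ dualCone R := add_mem hb1 ha1
      have e : ∀ z : M, mono (a + b) (add_mem ha1 hb1) • z = mono (b + a) hba • z := by
        intro z; congr 2; exact add_comm a b
      rw [e, e, mono_add_smul hb1 ha1, mono_add_smul hb1 ha1, e1]
    · change mono (a + b) _ • m.1.2 = mono (a + b) _ • m'.1.2
      rw [mono_add_smul ha1 hb1, mono_add_smul ha1 hb1, e2]

/-! ## Quasicoherent sheaves on P^2 -/

/-- A quasicoherent sheaf on the monoid scheme `P^2`, given on the three affine patches
`X_{σ_i}` and glued on their intersections. `M i`, `E i`, `G` are the modules of sections over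
`X_{σ_i}`, over `X_{σ_i} ∩ X_{σ_{i+1}}`, and over the triple intersection; these open sets are
the smallest neighbourhoods of the seven points of `P^2`, so these modules with their restriction
maps are the whole sheaf. Quasicoherence says that the restriction maps are localizations. The
gluing isomorphism over `X_{σ_i} ∩ X_{σ_{i+1}}` is the one between the localizations of `M i` and
of `M (i + 1)` that identifies both with `E i`, and the cocycle condition is the compatibility of
the restrictions to the triple intersection. -/
structure Sheaf where
  M : Fin 3 → Type u
  E : Fin 3 → Type u
  G : Type u
  [zeroM : ∀ i, Zero (M i)]
  [zeroE : ∀ i, Zero (E i)]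
  [zeroG : Zero G]
  [actM : ∀ i, MulActionWithZero (ConeMonoid (chart i)) (M i)]
  [actE : ∀ i, MulActionWithZero (ConeMonoid (edge i)) (E i)]
  [actG : MulActionWithZero (ConeMonoid ∅) G]
  resL : ∀ i, M i → E i
  resR : ∀ i, M (i + 1) → E i
  resG : ∀ i, E i → G
  locL : ∀ i, IsLocMap (chart i) (edge i) (resL i)
  locR : ∀ i, IsLocMap (chart (i + 1)) (edge i) (resR i)
  locG : ∀ i, IsLocMap (edge i) ∅ (resG i)
  compat : ∀ (i : Fin 3) (m : M (i + 1)), resG i (resR i m) = resG (i + 1) (resL (i + 1) m)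

attribute [instance] Sheaf.zeroM Sheaf.zeroE Sheaf.zeroG Sheaf.actM Sheaf.actE Sheaf.actG

namespace Sheaf

/-- Isomorphism of sheaves. -/
def Iso (F : Sheaf.{u}) (F' : Sheaf.{v}) : Prop :=
  ∃ (f : ∀ i, F.M i ≃ F'.M i) (e : ∀ i, F.E i ≃ F'.E i) (g : F.G ≃ F'.G),
    (∀ i (a : ConeMonoid (chart i)) (m : F.M i), f i (a • m) = a • f i m) ∧
    (∀ i (a : ConeMonoid (edge i)) (m : F.E i), e i (a • m) = a • e i m) ∧
    (∀ (a : ConeMonoid ∅) (m : F.G), g (a • m) = a • g m) ∧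
    (∀ i (m : F.M i), e i (F.resL i m) = F'.resL i (f i m)) ∧
    (∀ i (m : F.M (i + 1)), e i (F.resR i m) = F'.resR i (f (i + 1) m)) ∧
    (∀ i (m : F.E i), g (F.resG i m) = F'.resG i (e i m))

theorem Iso.refl (F : Sheaf.{u}) : F.Iso F :=
  ⟨fun _ => Equiv.refl _, fun _ => Equiv.refl _, Equiv.refl _, by simp, by simp, by simp,
    by simp, by simp, by simp⟩

theorem Iso.symm {F : Sheaf.{u}} {F' : Sheaf.{v}} (h : F.Iso F') : F'.Iso F := by
  obtain ⟨f, e, g, h1, h2, h3, h4, h5, h6⟩ := h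
  refine ⟨fun i => (f i).symm, fun i => (e i).symm, g.symm, ?_, ?_, ?_, ?_, ?_, ?_⟩
  · intro i a m; rw [Equiv.symm_apply_eq, h1, Equiv.apply_symm_apply]
  · intro i a m; rw [Equiv.symm_apply_eq, h2, Equiv.apply_symm_apply]
  · intro a m; rw [Equiv.symm_apply_eq, h3, Equiv.apply_symm_apply]
  · intro i m; rw [Equiv.symm_apply_eq, h4, Equiv.apply_symm_apply]
  · intro i m; rw [Equiv.symm_apply_eq, h5, Equiv.apply_symm_apply]
  · intro i m; rw [Equiv.symm_apply_eq, h6, Equiv.apply_symm_apply]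

universe w in
theorem Iso.trans {F : Sheaf.{u}} {F' : Sheaf.{v}} {F'' : Sheaf.{w}} (h : F.Iso F')
    (h' : F'.Iso F'') : F.Iso F'' := by
  obtain ⟨f, e, g, h1, h2, h3, h4, h5, h6⟩ := h
  obtain ⟨f', e', g', k1, k2, k3, k4, k5, k6⟩ := h'
  exact ⟨fun i => (f i).trans (f' i), fun i => (e i).trans (e' i), g.trans g',
    by simp [h1, k1], by simp [h2, k2], by simp [h3, k3], by simp [h4, k4], by simp [h5, k5],
    by simp [h6, k6]⟩

/-- The zero sheaf. -/
def IsZero (F : Sheaf.{u}) : Prop :=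
  (∀ i (m : F.M i), m = 0) ∧ (∀ i (m : F.E i), m = 0) ∧ ∀ m : F.G, m = 0

/-- The direct sum of two sheaves. -/
def sum (F F' : Sheaf.{u}) : Sheaf.{u} where
  M i := Wedge (F.M i) (F'.M i)
  E i := Wedge (F.E i) (F'.E i)
  G := Wedge F.G F'.G
  resL i := wedgeMap (F.resL i) (F'.resL i) (F.locL i).map_zero (F'.locL i).map_zero
  resR i := wedgeMap (F.resR i) (F'.resR i) (F.locR i).map_zero (F'.locR i).map_zero
  resG i := wedgeMap (F.resG i) (F'.resG i) (F.locG i).map_zero (F'.locG i).map_zero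
  locL i := (F.locL i).wedge (F'.locL i)
  locR i := (F.locR i).wedge (F'.locR i)
  locG i := (F.locG i).wedge (F'.locG i)
  compat i _ := Subtype.ext (Prod.ext (F.compat i _) (F'.compat i _))

/-- Nonzero and not a direct sum of two nonzero sheaves. -/
def Indecomposable (F : Sheaf.{u}) : Prop :=
  ¬ F.IsZero ∧ ∀ A B : Sheaf.{u}, F.Iso (A.sum B) → A.IsZero ∨ B.IsZero

/-- Coherent T-sheaves: all stalks are of type α, and the modules over the maximal cones are
finitely generated and admit a grading. -/
def IsTSheaf (F : Sheaf.{u}) : Prop :=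
  (∀ i, ModAlpha (chart i) (F.M i)) ∧ (∀ i, ModAlpha (edge i) (F.E i)) ∧ ModAlpha ∅ F.G ∧
    (∀ i, ModFG (chart i) (F.M i)) ∧ ∀ i, ModGradable (chart i) (F.M i)

end Sheaf

/-! ## Skew shapes -/

/-- Convexity for the order `p ≤ q ↔ q - p ∈ dualCone R` (`p` divides `q`). -/
def IsConvex (R : Finset (Fin 3)) (T : Set (ℤ × ℤ)) : Prop :=
  ∀ p q r, p ∈ T → r ∈ T → q - p ∈ dualCone R → r - q ∈ dualCone R → q ∈ T

/-- Skew shapes in the chart `i`: convex sets of nonzero elements of `S_{σ_i}`. -/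
def IsSkewShape (i : Fin 3) (T : Set (ℤ × ℤ)) : Prop :=
  T ⊆ dualCone (chart i) ∧ IsConvex (chart i) T

/-- Connectedness of `T` as a poset: it is nonempty and any two elements are joined by a chain of
elements of `T` in which neighbours are comparable. -/
def IsConn (i : Fin 3) (T : Set (ℤ × ℤ)) : Prop :=
  T.Nonempty ∧ ∀ p ∈ T, ∀ q ∈ T,
    Relation.EqvGen (fun a b => a ∈ T ∧ b ∈ T ∧ b - a ∈ dualCone (chart i)) p q

/-- The asymptotics of a shape `T` in a chart `i`, along the line through `p_i` and `p_j`, is `n`: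
the strip of width one transversal to that line meets `T` in `n` boxes once it is far enough out. -/
def HasAsymp (T : Set (ℤ × ℤ)) (j : Fin 3) (n : ℕ∞) : Prop :=
  ∀ᶠ N : ℕ in atTop, {p | p ∈ T ∧ pairing p (ray j) = N}.encard = n

/-- The exponent vectors of `X₀/X₀ = 1`, `X₁/X₀ = x₁`, `X₂/X₀ = x₂`. -/
def coordVec : Fin 3 → ℤ × ℤ := ![(0, 0), (1, 0), (0, 1)]

/-- The exponent vector of `X_j/X_i`. For `j ≠ i` these two monomials are the generators of
`S_{σ_i}`; the one with index `j` is the coordinate along the line through `p_i` and `p_j`. -/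
def mon (i j : Fin 3) : ℤ × ℤ := coordVec j - coordVec i

/-- A connected skew shape of type `(a, b)` in the chart `i`, the asymptotics along the lines
`l_{i-1,i}` and `l_{i,i+1}` being `a` and `b`. -/
structure IsConnShape (i : Fin 3) (T : Set (ℤ × ℤ)) (a b : ℕ∞) : Prop where
  skew : IsSkewShape i T
  conn : IsConn i T
  asympIn : HasAsymp T (i + 2) a
  asympOut : HasAsymp T (i + 1) b

/-- `{i, j, k} = {0, 1, 2}`, and `T` is a shape in the chart `i`. The condition on `g` says that the
ray `g, g + d, g + 2d, …`, with `d` the exponent of the coordinate along the line `l_{i,j}`, is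
contained in `T`, no element of it being a multiple of the other coordinate in `M_T`. -/
def OnBottom (i j k : Fin 3) (T : Set (ℤ × ℤ)) (g : ℤ × ℤ) : Prop :=
  ∀ t : ℕ, g + t • mon i j ∈ T ∧ g + t • mon i j - mon i k ∉ T

/-- `g` is the generator of the restriction to the line `l_{i,j}`, taken modulo torsion, of the
module `M_T`. -/
def IsEdgeGen (i j k : Fin 3) (T : Set (ℤ × ℤ)) (g : ℤ × ℤ) : Prop :=
  OnBottom i j k T g ∧ ¬ OnBottom i j k T (g - mon i j)

/-! ## Modules of shapes -/

/-- A family of convex shapes in the lattice, for the order of the monoid of `R`. -/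
structure ShapeFamily (R : Finset (Fin 3)) where
  ι : Type
  T : ι → Set (ℤ × ℤ)
  convex : ∀ v, IsConvex R (T v)

namespace ShapeFamily

variable {R R' R'' : Finset (Fin 3)}

/-- The module `⨁_v M_{T_v}`: its nonzero elements are the boxes `p` of the shapes `T_v`. -/
inductive Mod (F : ShapeFamily R) : Type
  | zero : Mod F
  | elt (v : F.ι) (p : ℤ × ℤ) (h : p ∈ F.T v) : Mod F

instance (F : ShapeFamily R) : Zero F.Mod := ⟨Mod.zero⟩

open Classical in
/-- The box `p` of `T_v`, which is zero when `p` does not belong to `T_v`. -/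
noncomputable def box (F : ShapeFamily R) (v : F.ι) (p : ℤ × ℤ) : F.Mod :=
  if h : p ∈ F.T v then Mod.elt v p h else Mod.zero

theorem box_of_not_mem (F : ShapeFamily R) {v : F.ι} {p : ℤ × ℤ} (h : p ∉ F.T v) :
    F.box v p = 0 := dif_neg h

theorem box_ne_zero (F : ShapeFamily R) {v : F.ι} {p : ℤ × ℤ} (h : p ∈ F.T v) :
    F.box v p ≠ 0 := by
  unfold box; rw [dif_pos h]; exact nofun

theorem box_inj (F : ShapeFamily R) {v w : F.ι} {p q : ℤ × ℤ} (h : p ∈ F.T v)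
    (e : F.box v p = F.box w q) : v = w ∧ p = q := by
  by_cases h' : q ∈ F.T w
  · unfold box at e
    rw [dif_pos h, dif_pos h'] at e
    injection e with e1 e2
    exact ⟨e1, e2⟩
  · rw [box_of_not_mem F h'] at e
    exact absurd e (box_ne_zero F h)

theorem cases_box (F : ShapeFamily R) (x : F.Mod) : x = 0 ∨ ∃ v p, p ∈ F.T v ∧ x = F.box v p := by
  rcases x with _ | ⟨v, p, h⟩
  · left; rfl
  · right; exact ⟨v, p, h, by unfold box; rw [dif_pos h]⟩

/-- Monomials act by translation, boxes that leave the shape becoming zero. -/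
noncomputable def act (F : ShapeFamily R) (a : ℤ × ℤ) : F.Mod → F.Mod
  | .zero => .zero
  | .elt v p _ => F.box v (p + a)

theorem act_box (F : ShapeFamily R) {v : F.ι} {p : ℤ × ℤ} (h : p ∈ F.T v) (a : ℤ × ℤ) :
    F.act a (F.box v p) = F.box v (p + a) := by
  rw [box, dif_pos h]; rfl

theorem act_zero (F : ShapeFamily R) (a : ℤ × ℤ) : F.act a 0 = 0 := rfl

theorem act_add (F : ShapeFamily R) {a b : ℤ × ℤ} (ha : a ∈ dualCone R) (hb : b ∈ dualCone R)
    (x : F.Mod) : F.act (a + b) x = F.act a (F.act b x) := by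
  rcases F.cases_box x with rfl | ⟨v, p, h, rfl⟩
  · rfl
  · rw [act_box F h, act_box F h]
    by_cases h' : p + b ∈ F.T v
    · rw [act_box F h']; congr 1; abel
    · rw [box_of_not_mem F h', act_zero, box_of_not_mem]
      intro h''
      refine h' (F.convex v p (p + b) _ h h'' ?_ ?_)
      · rwa [add_sub_cancel_left]
      · have : p + (a + b) - (p + b) = a := by abel
        rwa [this]

noncomputable instance (F : ShapeFamily R) : MulActionWithZero (ConeMonoid R) F.Mod where
  smul a x := WithZero.recZeroCoe (motive := fun _ => F.Mod) 0
    (fun m => F.act (Multiplicative.toAdd m : dualCone R) x) a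
  one_smul x := by
    change F.act 0 x = x
    rcases F.cases_box x with rfl | ⟨v, p, h, rfl⟩
    · rfl
    · rw [act_box F h, add_zero]
  mul_smul a b x := by
    cases a using WithZero.recZeroCoe with
    | zero => rw [zero_mul]; rfl
    | coe a =>
      cases b using WithZero.recZeroCoe with
      | zero => rw [mul_zero]; rfl
      | coe b => exact act_add F (Multiplicative.toAdd a).2 (Multiplicative.toAdd b).2 x
  smul_zero a := by
    cases a using WithZero.recZeroCoe with
    | zero => rfl
    | coe a => rfl
  zero_smul x := rfl

theorem mono_smul (F : ShapeFamily R) {a : ℤ × ℤ} (ha : a ∈ dualCone R) (x : F.Mod) :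
    mono a ha • x = F.act a x := rfl

end ShapeFamily

/-- The shape of the localization of `M_T`: the lattice points which enter `T` for good when they are
multiplied by monomials that become invertible. -/
def localize (R R' : Finset (Fin 3)) (T : Set (ℤ × ℤ)) : Set (ℤ × ℤ) :=
  {p | ∃ a ∈ inverted R R', ∀ b ∈ inverted R R', p + a + b ∈ T}

theorem dualCone_mono {R R' : Finset (Fin 3)} (h : R' ⊆ R) {a : ℤ × ℤ} (ha : a ∈ dualCone R) :
    a ∈ dualCone R' := fun j hj => ha j (h hj)

theorem mem_localize_iff {R R' : Finset (Fin 3)} {T : Set (ℤ × ℤ)} (hT : IsConvex R T)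
    {p : ℤ × ℤ} (hp : p ∈ T) : p ∈ localize R R' T ↔ ∀ b ∈ inverted R R', p + b ∈ T := by
  constructor
  · rintro ⟨a, ha, h⟩ b hb
    refine hT p (p + b) (p + a + b) hp (h b hb) ?_ ?_
    · rw [add_sub_cancel_left]; exact hb.1
    · have : p + a + b - (p + b) = a := by abel
      rw [this]; exact ha.1
  · intro h
    exact ⟨0, zero_mem_inverted R R', fun b hb => by rw [add_zero]; exact h b hb⟩

theorem add_mem_localize {R R' : Finset (Fin 3)} {T : Set (ℤ × ℤ)}
    (hT : IsConvex R T)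
    {p a : ℤ × ℤ} (hp : p ∈ T) (ha : a ∈ dualCone R) (h : p + a ∈ localize R R' T) :
    p + a ∈ T ∧ p ∈ localize R R' T := by
  obtain ⟨c, hc, h⟩ := h
  constructor
  · refine hT p (p + a) (p + a + c + 0) hp (h 0 (zero_mem_inverted R R')) ?_ ?_
    · rwa [add_sub_cancel_left]
    · have : p + a + c + 0 - (p + a) = c := by abel
      rw [this]; exact hc.1
  · rw [mem_localize_iff hT hp]
    intro b hb
    refine hT p (p + b) _ hp (h b hb) ?_ ?_
    · rw [add_sub_cancel_left]; exact hb.1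
    · have : p + a + c + b - (p + b) = a + c := by abel
      rw [this]; exact add_mem ha hc.1

namespace ShapeFamily

variable {R R' : Finset (Fin 3)}

/-- The map of shape modules that sends the component `v` to the component `f v`, translated by
`c v`, or to zero. -/
noncomputable def mapMod (F : ShapeFamily R) (F' : ShapeFamily R') (f : F.ι → Option F'.ι)
    (c : F.ι → ℤ × ℤ) : F.Mod → F'.Mod
  | .zero => .zero
  | .elt v p _ => match f v with
    | none => .zero
    | some w => F'.box w (p + c v)

theorem mapMod_zero (F : ShapeFamily R) (F' : ShapeFamily R') (f : F.ι → Option F'.ι)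
    (c : F.ι → ℤ × ℤ) : mapMod F F' f c 0 = 0 := rfl

theorem mapMod_none (F : ShapeFamily R) (F' : ShapeFamily R') (f : F.ι → Option F'.ι)
    (c : F.ι → ℤ × ℤ) {v : F.ι} {p : ℤ × ℤ} (hv : f v = none) :
    mapMod F F' f c (F.box v p) = 0 := by
  by_cases h : p ∈ F.T v
  · rw [box, dif_pos h]; simp only [mapMod, hv]; rfl
  · rw [box_of_not_mem F h]; rfl

theorem mapMod_some (F : ShapeFamily R) (F' : ShapeFamily R') (f : F.ι → Option F'.ι)
    (c : F.ι → ℤ × ℤ) {v : F.ι} {p : ℤ × ℤ} (h : p ∈ F.T v) {w : F'.ι} (hv : f v = some w) :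
    mapMod F F' f c (F.box v p) = F'.box w (p + c v) := by
  rw [box, dif_pos h]; simp only [mapMod, hv]

/-- If the target shapes are the translates of the localized source shapes, then the map is a
localization. -/
theorem mapMod_isLocMap (hR : R' ⊆ R) (F : ShapeFamily R) (F' : ShapeFamily R')
    (f : F.ι → Option F'.ι) (c : F.ι → ℤ × ℤ)
    (h1 : ∀ v w, f v = some w → ∀ p, p ∈ localize R R' (F.T v) ↔ p + c v ∈ F'.T w)
    (h2 : ∀ v, f v = none → ∀ p, p ∉ localize R R' (F.T v))
    (h3 : ∀ w p, p ∈ F'.T w → ∃ v, f v = some w)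
    (h4 : ∀ v v' w, f v = some w → f v' = some w → v = v') :
    IsLocMap R R' (mapMod F F' f c) where
  map_zero := rfl
  map_smul a ha ha' m := by
    rw [mono_smul, mono_smul]
    rcases F.cases_box m with rfl | ⟨v, p, h, rfl⟩
    · rfl
    rw [act_box F h]
    rcases hv : f v with _ | w
    · rw [mapMod_none F F' f c hv, mapMod_none F F' f c hv]; rfl
    rw [mapMod_some F F' f c h hv]
    by_cases hl : p + a ∈ localize R R' (F.T v)
    · obtain ⟨k1, k2⟩ := add_mem_localize (F.convex v) h ha hl
      rw [mapMod_some F F' f c k1 hv, act_box F' ((h1 v w hv p).1 k2)]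
      congr 1; abel
    · have hl' : p + c v + a ∉ F'.T w := by
        intro hh
        apply hl
        rw [h1 v w hv]
        convert hh using 1
        abel
      have e1 : F'.act a (F'.box w (p + c v)) = 0 := by
        by_cases hq : p + c v ∈ F'.T w
        · rw [act_box F' hq, box_of_not_mem F' hl']
        · rw [box_of_not_mem F' hq]; rfl
      rw [e1]
      by_cases hq : p + a ∈ F.T v
      · rw [mapMod_some F F' f c hq hv, box_of_not_mem]
        intro hh; exact hl ((h1 v w hv _).2 hh)
      · rw [box_of_not_mem F hq]; rfl
  surj n := by
    rcases F'.cases_box n with rfl | ⟨w, q, h, rfl⟩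
    · refine ⟨0, zero_mem_inverted _ _, zero_mem _, 0, ?_⟩
      rw [mono_smul]; rfl
    obtain ⟨v, hv⟩ := h3 w q h
    have hq : q - c v ∈ localize R R' (F.T v) := by
      rw [h1 v w hv, sub_add_cancel]; exact h
    obtain ⟨a, ha, hab⟩ := hq
    have hm := hab 0 (zero_mem_inverted _ _)
    rw [add_zero] at hm
    refine ⟨a, ha, dualCone_mono hR ha.1, F.box v (q - c v + a), ?_⟩
    rw [mono_smul, act_box F' h, mapMod_some F F' f c hm hv]
    congr 1; abel
  inj m m' e := by
    have key : ∀ m : F.Mod, mapMod F F' f c m = 0 →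
        ∃ a ∈ inverted R R', F.act a m = 0 := by
      intro m hm
      rcases F.cases_box m with rfl | ⟨v, p, h, rfl⟩
      · exact ⟨0, zero_mem_inverted _ _, rfl⟩
      have hp : p ∉ localize R R' (F.T v) := by
        rcases hv : f v with _ | w
        · exact h2 v hv p
        · rw [mapMod_some F F' f c h hv] at hm
          rw [h1 v w hv]
          intro hh; exact box_ne_zero F' hh hm
      rw [mem_localize_iff (F.convex v) h] at hp
      push Not at hp
      obtain ⟨b, hb, hp⟩ := hp
      exact ⟨b, hb, by rw [act_box F h, box_of_not_mem F hp]⟩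
    have key2 : mapMod F F' f c m = 0 → mapMod F F' f c m' = 0 →
        ∃ a ∈ inverted R R', ∃ ha : a ∈ dualCone R, mono a ha • m = mono a ha • m' := by
      intro z z'
      obtain ⟨a, ha, e1⟩ := key m z
      obtain ⟨b, hb, e2⟩ := key m' z'
      refine ⟨a + b, inverted_add ha hb, (inverted_add ha hb).1, ?_⟩
      rw [mono_smul, mono_smul]
      rw [act_add F ha.1 hb.1 m', e2, add_comm, act_add F hb.1 ha.1 m, e1]
      rfl
    by_cases z : mapMod F F' f c m = 0
    · exact key2 z (e ▸ z)
    have z' : mapMod F F' f c m' ≠ 0 := e ▸ z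
    refine ⟨0, zero_mem_inverted _ _, zero_mem _, ?_⟩
    congr 1
    have key3 : ∀ m : F.Mod, mapMod F F' f c m ≠ 0 → ∃ v p w, p ∈ F.T v ∧ m = F.box v p ∧
        f v = some w ∧ p + c v ∈ F'.T w := by
      intro m hm
      rcases F.cases_box m with rfl | ⟨v, p, h, rfl⟩
      · exact absurd rfl hm
      rcases hv : f v with _ | w
      · exact absurd (mapMod_none F F' f c hv) hm
      · refine ⟨v, p, w, h, rfl, hv, ?_⟩
        by_contra hq
        apply hm
        rw [mapMod_some F F' f c h hv, box_of_not_mem F' hq]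
    obtain ⟨v, p, w, hp, rfl, hv, hw⟩ := key3 m z
    obtain ⟨v', p', w', hp', rfl, hv', hw'⟩ := key3 m' z'
    rw [mapMod_some F F' f c hp hv, mapMod_some F F' f c hp' hv'] at e
    obtain ⟨rfl, e2⟩ := box_inj F' hw e
    obtain rfl := h4 v v' w hv hv'
    rw [add_right_cancel e2]

end ShapeFamily

/-! ## Asymptotic strips of shapes -/

theorem pairing_add (a b w : ℤ × ℤ) : pairing (a + b) w = pairing a w + pairing b w := by
  simp only [pairing, Prod.fst_add, Prod.snd_add]; ring

theorem pairing_sub (a b w : ℤ × ℤ) : pairing (a - b) w = pairing a w - pairing b w := by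
  simp only [pairing, Prod.fst_sub, Prod.snd_sub]; ring

theorem pairing_neg (a w : ℤ × ℤ) : pairing (-a) w = - pairing a w := by
  simp only [pairing, Prod.fst_neg, Prod.snd_neg]; ring

theorem pairing_zsmul (n : ℤ) (a w : ℤ × ℤ) : pairing (n • a) w = n * pairing a w := by
  simp only [pairing, Prod.smul_fst, Prod.smul_snd, smul_eq_mul]; ring

theorem pairing_nsmul (n : ℕ) (a w : ℤ × ℤ) : pairing (n • a) w = n * pairing a w := by
  rw [← natCast_zsmul, pairing_zsmul]

theorem pairing_mon_right : ∀ i j : Fin 3, i ≠ j → pairing (mon i j) (ray j) = 1 := by decide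

theorem pairing_mon_left : ∀ i j : Fin 3, i ≠ j → pairing (mon i j) (ray i) = -1 := by decide

theorem pairing_mon_other : ∀ i j k : Fin 3, k ≠ i → k ≠ j → pairing (mon i j) (ray k) = 0 := by
  decide

theorem pairing_ext : ∀ {j k : Fin 3}, j ≠ k → ∀ {p q : ℤ × ℤ},
    pairing p (ray j) = pairing q (ray j) → pairing p (ray k) = pairing q (ray k) → p = q := by
  intro j k hjk p q h1 h2
  obtain ⟨a, b⟩ := p
  obtain ⟨c, d⟩ := q
  fin_cases j <;> fin_cases k <;> simp [pairing, ray] at * <;> omega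

theorem chart_eq : ∀ i : Fin 3, chart i = {i + 1, i + 2} := by decide

theorem chart_eq' : ∀ i : Fin 3, chart i = {i + 2, i + 1} := by decide

theorem edge_eq : ∀ i : Fin 3, edge i = {i + 2} := by decide

theorem edge_eq' : ∀ i : Fin 3, edge (i + 2) = {i + 1} := by decide

theorem edge_sub : ∀ i : Fin 3, edge i ⊆ chart i := by decide

theorem edge_sub' : ∀ i : Fin 3, edge i ⊆ chart (i + 1) := by decide

theorem ne_one : ∀ i : Fin 3, i ≠ i + 1 := by decide

theorem ne_two : ∀ i : Fin 3, i ≠ i + 2 := by decide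

theorem one_ne_two : ∀ i : Fin 3, i + 1 ≠ i + 2 := by decide

theorem one_add_one : ∀ i : Fin 3, i + 1 + 1 = i + 2 := by decide

theorem one_add_two : ∀ i : Fin 3, i + 1 + 2 = i := by decide

theorem mem_dualCone_pair {j k : Fin 3} {a : ℤ × ℤ} :
    a ∈ dualCone {j, k} ↔ 0 ≤ pairing a (ray j) ∧ 0 ≤ pairing a (ray k) := by
  change (∀ l ∈ ({j, k} : Finset (Fin 3)), 0 ≤ pairing a (ray l)) ↔ _
  simp

theorem mem_dualCone_single {k : Fin 3} {a : ℤ × ℤ} :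
    a ∈ dualCone {k} ↔ 0 ≤ pairing a (ray k) := by
  change (∀ l ∈ ({k} : Finset (Fin 3)), 0 ≤ pairing a (ray l)) ↔ _
  simp

theorem mem_dualCone_empty {a : ℤ × ℤ} : a ∈ dualCone ∅ := by
  change ∀ l ∈ (∅ : Finset (Fin 3)), 0 ≤ pairing a (ray l)
  simp

theorem mem_inverted_pair {j k : Fin 3} {a : ℤ × ℤ} :
    a ∈ inverted {j, k} {k} ↔ 0 ≤ pairing a (ray j) ∧ pairing a (ray k) = 0 := by
  unfold inverted
  rw [Set.mem_ofPred_eq, mem_dualCone_pair, mem_dualCone_single, pairing_neg]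
  constructor
  · rintro ⟨⟨h1, h2⟩, h3⟩; exact ⟨h1, by omega⟩
  · rintro ⟨h1, h2⟩; exact ⟨⟨h1, by omega⟩, by omega⟩

theorem mem_inverted_empty {k : Fin 3} {a : ℤ × ℤ} :
    a ∈ inverted {k} ∅ ↔ 0 ≤ pairing a (ray k) := by
  unfold inverted
  rw [Set.mem_ofPred_eq, mem_dualCone_single]
  exact ⟨fun h => h.1, fun h => ⟨h, mem_dualCone_empty⟩⟩

section Strip

variable {j k : Fin 3} {T : Set (ℤ × ℤ)}

/-- The localization of a shape without infinite rows along a line is empty. -/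
theorem localize_of_asymp_zero {i : Fin 3} (hi : i ≠ j) (hik : k ≠ i) (hjk : k ≠ j)
    (h : HasAsymp T j 0) (p : ℤ × ℤ) : p ∉ localize {j, k} {k} T := by
  rintro ⟨a, ha, hp⟩
  obtain ⟨N₀, hN⟩ := eventually_atTop.1 h
  obtain ⟨t, ht⟩ : ∃ t : ℕ, (N₀ : ℤ) ≤ pairing (p + a) (ray j) + t :=
    ⟨(N₀ - pairing (p + a) (ray j)).toNat, by omega⟩
  obtain ⟨N, hN'⟩ : ∃ N : ℕ, (N : ℤ) = pairing (p + a) (ray j) + t :=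
    ⟨(pairing (p + a) (ray j) + t).toNat, by omega⟩
  have e := hN N (by omega)
  rw [Set.encard_eq_zero] at e
  have hb : t • mon i j ∈ inverted {j, k} {k} := by
    rw [mem_inverted_pair, pairing_nsmul, pairing_nsmul, pairing_mon_right i j hi,
      pairing_mon_other i j k hik hjk]
    constructor <;> simp
  have : p + a + t • mon i j ∈ (∅ : Set (ℤ × ℤ)) := by
    rw [← e]
    refine ⟨hp _ hb, ?_⟩
    rw [pairing_add, pairing_nsmul, pairing_mon_right i j hi, hN']; ring
  exact this

/-- The localization of a shape of asymptotics `n < ∞` along a line is a strip of `n` rows. -/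
theorem mem_localize_strip {i : Fin 3} (hij : i ≠ j) (hik : i ≠ k) (hjk : j ≠ k)
    (hT : IsConvex {j, k} T) {n : ℕ} (h : HasAsymp T j n) {g : ℤ × ℤ}
    (hg : OnBottom i j k T g) (p : ℤ × ℤ) :
    p ∈ localize {j, k} {k} T ↔
      pairing g (ray k) ≤ pairing p (ray k) ∧ pairing p (ray k) < pairing g (ray k) + n := by
  have djj := pairing_mon_right i j hij
  have djk := pairing_mon_other i j k hik.symm hjk.symm
  have ekk := pairing_mon_right i k hik
  have ekj := pairing_mon_other i k j hij.symm hjk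
  obtain ⟨N₀, hN⟩ := eventually_atTop.1 h
  set y := pairing g (ray k) with hy
  -- the point with given coordinates
  have hpt : ∀ x b : ℤ, ∃ q, pairing q (ray j) = x ∧ pairing q (ray k) = b := by
    intro x b
    refine ⟨x • mon i j + b • mon i k, ?_, ?_⟩
    · rw [pairing_add, pairing_zsmul, pairing_zsmul, djj, ekj]; ring
    · rw [pairing_add, pairing_zsmul, pairing_zsmul, djk, ekk]; ring
  choose P hPx hPy using hpt
  have hconv : ∀ x b b' c, P x b ∈ T → P x c ∈ T → b ≤ b' → b' ≤ c → P x b' ∈ T := by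
    intro x b b' c h1 h2 h3 h4
    refine hT _ _ _ h1 h2 ?_ ?_ <;>
    · rw [mem_dualCone_pair, pairing_sub, pairing_sub, hPx, hPx, hPy, hPy]
      constructor <;> omega
  have hcol : ∀ N : ℕ, N₀ ≤ N → pairing g (ray j) ≤ N → ∀ b, P N b ∈ T ↔ y ≤ b ∧ b < y + n := by
    intro N h1 h2
    obtain ⟨t, ht⟩ : ∃ t : ℕ, (t : ℤ) = N - pairing g (ray j) :=
      ⟨(N - pairing g (ray j)).toNat, by omega⟩
    have g1 : P N y ∈ T := by
      have : P N y = g + t • mon i j := by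
        apply pairing_ext hjk
        · rw [hPx, pairing_add, pairing_nsmul, djj]; omega
        · rw [hPy, pairing_add, pairing_nsmul, djk]; omega
      rw [this]; exact (hg t).1
    have g2 : P N (y - 1) ∉ T := by
      have : P N (y - 1) = g + t • mon i j - mon i k := by
        apply pairing_ext hjk
        · rw [hPx, pairing_sub, pairing_add, pairing_nsmul, djj, ekj]; omega
        · rw [hPy, pairing_sub, pairing_add, pairing_nsmul, djk, ekk]; omega
      rw [this]; exact (hg t).2
    have low : ∀ b, P N b ∈ T → y ≤ b := by
      intro b hb
      by_contra hlt
      exact g2 (hconv N b (y - 1) y hb g1 (by omega) (by omega))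
    have inj : Function.Injective (P N) := by
      intro b c hbc
      have := congrArg (fun q => pairing q (ray k)) hbc
      simpa only [hPy] using this
    have card : {b | P N b ∈ T}.encard = n := by
      rw [← hN N h1, ← inj.encard_image]
      congr 1
      ext q
      constructor
      · rintro ⟨b, hb, rfl⟩; exact ⟨hb, hPx _ _⟩
      · rintro ⟨hq, hqx⟩
        have : P N (pairing q (ray k)) = q := by
          apply pairing_ext hjk
          · rw [hPx, hqx]
          · rw [hPy]
        exact ⟨pairing q (ray k), by rw [Set.mem_ofPred_eq, this]; exact hq, this⟩
    have up : ∀ b, P N b ∈ T → b < y + n := by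
      intro b hb
      by_contra hlt
      have hsub : Set.Icc y (y + n) ⊆ {b | P N b ∈ T} := by
        intro c hc
        exact hconv N y c b g1 hb hc.1 (by have := hc.2; omega)
      have := Set.encard_le_encard hsub
      rw [card, ← Finset.coe_Icc, Set.encard_coe_eq_coe_finsetCard, Int.card_Icc] at this
      have h3 : (y + n + 1 - y).toNat = n + 1 := by omega
      rw [h3] at this
      have h4 : n + 1 ≤ n := by exact_mod_cast this
      omega
    have heq : {b | P N b ∈ T} = Set.Ico y (y + n) := by
      have hsub : {b | P N b ∈ T} ⊆ Set.Ico y (y + n) := fun b hb => ⟨low b hb, up b hb⟩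
      apply Set.Finite.eq_of_subset_of_encard_le ((Set.finite_Ico _ _).subset hsub) hsub
      · rw [card, ← Finset.coe_Ico, Set.encard_coe_eq_coe_finsetCard, Int.card_Ico]
        have h3 : (y + n - y).toNat = n := by omega
        rw [h3]
    intro b
    have := Set.ext_iff.1 heq b
    simpa using this
  constructor
  · rintro ⟨a, ha, hp⟩
    rw [mem_inverted_pair] at ha
    set x := pairing (p + a) (ray j) with hx
    obtain ⟨t, ht⟩ : ∃ t : ℕ, max (N₀ : ℤ) (max 0 (pairing g (ray j))) ≤ x + t :=
      ⟨(max (N₀ : ℤ) (max 0 (pairing g (ray j))) - x).toNat, by omega⟩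
    obtain ⟨N, hN'⟩ : ∃ N : ℕ, (N : ℤ) = x + t := ⟨(x + t).toNat, by omega⟩
    have hb : t • mon i j ∈ inverted {j, k} {k} := by
      rw [mem_inverted_pair, pairing_nsmul, pairing_nsmul, djj, djk]
      constructor <;> simp
    have hmem := hp _ hb
    have : p + a + t • mon i j = P N (pairing p (ray k)) := by
      apply pairing_ext hjk
      · rw [hPx, pairing_add, pairing_nsmul, djj, hN']; ring
      · rw [hPy, pairing_add, pairing_nsmul, djk, pairing_add, ha.2]; ring
    rw [this] at hmem
    exact (hcol N (by omega) (by omega) _).1 hmem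
  · intro hp
    obtain ⟨t, ht⟩ : ∃ t : ℕ, max (N₀ : ℤ) (max 0 (pairing g (ray j))) ≤ pairing p (ray j) + t :=
      ⟨(max (N₀ : ℤ) (max 0 (pairing g (ray j))) - pairing p (ray j)).toNat, by omega⟩
    refine ⟨t • mon i j, ?_, ?_⟩
    · rw [mem_inverted_pair, pairing_nsmul, pairing_nsmul, djj, djk]
      constructor <;> simp
    · intro b hb
      rw [mem_inverted_pair] at hb
      obtain ⟨N, hN'⟩ : ∃ N : ℕ, (N : ℤ) = pairing p (ray j) + t + pairing b (ray j) :=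
        ⟨(pairing p (ray j) + t + pairing b (ray j)).toNat, by omega⟩
      have : p + t • mon i j + b = P N (pairing p (ray k)) := by
        apply pairing_ext hjk
        · rw [hPx, pairing_add, pairing_add, pairing_nsmul, djj, hN']; ring
        · rw [hPy, pairing_add, pairing_add, pairing_nsmul, djk, hb.2]; ring
      rw [this]
      exact (hcol N (by omega) (by omega) _).2 hp

end Strip

/-- The localization of a convex shape is convex. -/
theorem localize_convex {j k i : Fin 3} (hij : i ≠ j) (hik : i ≠ k) (hjk : j ≠ k)
    {T : Set (ℤ × ℤ)} (hT : IsConvex {j, k} T) : IsConvex {k} (localize {j, k} {k} T) := by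
  have key : ∀ m : ℤ × ℤ, m ∈ dualCone {k} → ∃ s ∈ inverted {j, k} {k}, m + s ∈ dualCone {j, k} := by
    intro m hm
    rw [mem_dualCone_single] at hm
    refine ⟨(-pairing m (ray j)).toNat • mon i j, ?_, ?_⟩
    · rw [mem_inverted_pair, pairing_nsmul, pairing_nsmul, pairing_mon_right i j hij,
        pairing_mon_other i j k hik.symm hjk.symm]
      constructor <;> simp
    · rw [mem_dualCone_pair, pairing_add, pairing_add, pairing_nsmul, pairing_nsmul,
        pairing_mon_right i j hij, pairing_mon_other i j k hik.symm hjk.symm]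
      constructor <;> omega
  rintro p q r ⟨a, ha, hp⟩ ⟨c, hc, hr⟩ h1 h2
  obtain ⟨s, hs, hs'⟩ := key _ h1
  obtain ⟨s', hs1, hs2⟩ := key _ h2
  refine ⟨a + s, inverted_add ha hs, fun b hb => ?_⟩
  refine hT (p + a + b) _ (r + c + (s' + (a + s) + b)) (hp b hb)
    (hr _ (inverted_add (inverted_add hs1 (inverted_add ha hs)) hb)) ?_ ?_
  · have : q + (a + s) + b - (p + a + b) = q - p + s := by abel
    rwa [this]
  · have : r + c + (s' + (a + s) + b) - (q + (a + s) + b) = r - q + s' + c := by abel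
    rw [this]; exact add_mem hs2 hc.1

/-! ## Sheaves glued from shapes along the triangle of lines -/

/-- The localization of a shape of the chart `i` along the line `l_{i,i+1}`. -/
def outEnd (i : Fin 3) (T : Set (ℤ × ℤ)) : Set (ℤ × ℤ) := localize (chart i) (edge i) T

/-- The localization of a shape of the chart `i` along the line `l_{i-1,i}`. -/
def inEnd (i : Fin 3) (T : Set (ℤ × ℤ)) : Set (ℤ × ℤ) := localize (chart i) (edge (i + 2)) T

/-- Shapes `S v` in the charts `node v`, with gluings of the localization of `S w` to that of
`S v`, `v = prev w`, over `X_{σ_i} ∩ X_{σ_{i+1}}` (`i = node v`, `i + 1 = node w`): the box `p` of the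
former is identified with the box `p + shift w` of the latter. Ends that are not glued are empty,
and all localizations to the triple intersection vanish. -/
structure Gluing where
  V : Type
  node : V → Fin 3
  S : V → Set (ℤ × ℤ)
  convex : ∀ v, IsConvex (chart (node v)) (S v)
  prev : V → Option V
  shift : V → ℤ × ℤ
  prev_node : ∀ v w, prev w = some v → node w = node v + 1
  glue : ∀ v w, prev w = some v →
    ∀ p, p ∈ inEnd (node w) (S w) ↔ p + shift w ∈ outEnd (node v) (S v)
  no_prev : ∀ w, prev w = none → ∀ p, p ∉ inEnd (node w) (S w)
  no_next : ∀ v p, p ∈ outEnd (node v) (S v) → ∃ w, prev w = some v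
  prev_inj : ∀ v w w', prev w = some v → prev w' = some v → w = w'
  torsion : ∀ v p, p ∉ localize (edge (node v)) ∅ (outEnd (node v) (S v))

namespace Gluing

/-- The module over `X_{σ_i}` is the direct sum of the `M_{S v}` with `node v = i`. -/
def famM (D : Gluing) (i : Fin 3) : ShapeFamily (chart i) where
  ι := D.V
  T v := {p | D.node v = i ∧ p ∈ D.S v}
  convex v := by
    rintro p q r ⟨rfl, hp⟩ ⟨_, hr⟩ h1 h2
    exact ⟨rfl, D.convex v p q r hp hr h1 h2⟩

/-- The module over `X_{σ_i} ∩ X_{σ_{i+1}}`. -/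
def famE (D : Gluing) (i : Fin 3) : ShapeFamily (edge i) where
  ι := D.V
  T v := {p | D.node v = i ∧ p ∈ outEnd (D.node v) (D.S v)}
  convex v := by
    rintro p q r ⟨rfl, hp⟩ ⟨_, hr⟩ h1 h2
    refine ⟨rfl, ?_⟩
    have h := D.convex v
    unfold outEnd at *
    revert h hp hr h1 h2
    generalize D.node v = i
    rw [chart_eq, edge_eq]
    intro hp hr h1 h2 h
    exact localize_convex (ne_one i) (ne_two i) (one_ne_two i) h p q r hp hr h1 h2

/-- The module over the triple intersection is zero. -/
def famG : ShapeFamily ∅ where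
  ι := Empty
  T v := v.elim
  convex v := v.elim

theorem mem_localize_and {R R' : Finset (Fin 3)} {T : Set (ℤ × ℤ)} {P : Prop} {p : ℤ × ℤ} :
    p ∈ localize R R' {q | P ∧ q ∈ T} ↔ P ∧ p ∈ localize R R' T := by
  constructor
  · rintro ⟨a, ha, h⟩
    exact ⟨(h 0 (zero_mem_inverted _ _)).1, a, ha, fun b hb => (h b hb).2⟩
  · rintro ⟨hP, a, ha, h⟩
    exact ⟨a, ha, fun b hb => ⟨hP, h b hb⟩⟩

/-- The glued sheaf. -/
noncomputable def sheaf (D : Gluing) : Sheaf.{0} where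
  M i := (D.famM i).Mod
  E i := (D.famE i).Mod
  G := famG.Mod
  resL i := (D.famM i).mapMod (D.famE i) some 0
  resR i := (D.famM (i + 1)).mapMod (D.famE i) D.prev D.shift
  resG i := (D.famE i).mapMod famG (fun _ => none) 0
  locL i := by
    apply ShapeFamily.mapMod_isLocMap (edge_sub i)
    · rintro v w h p
      obtain rfl := Option.some.inj h
      change p ∈ localize _ _ {q | D.node v = i ∧ q ∈ D.S v} ↔
        p + 0 ∈ {q | D.node v = i ∧ q ∈ outEnd (D.node v) (D.S v)}
      rw [mem_localize_and, add_zero]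
      constructor
      · rintro ⟨e, h⟩; exact ⟨e, by rw [outEnd, e]; exact h⟩
      · rintro ⟨e, h⟩; rw [outEnd, e] at h; exact ⟨e, h⟩
    · intro v h; cases h
    · intro w p _; exact ⟨w, rfl⟩
    · intro v v' w h h'
      rw [Option.some.inj h, Option.some.inj h']
  locR i := by
    have hi := one_add_two i
    apply ShapeFamily.mapMod_isLocMap (edge_sub' i)
    · rintro w v h p
      have hn := D.prev_node v w h
      change p ∈ localize _ _ {q | D.node w = i + 1 ∧ q ∈ D.S w} ↔
        p + D.shift w ∈ {q | D.node v = i ∧ q ∈ outEnd (D.node v) (D.S v)}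
      have hg := D.glue v w h p
      rw [mem_localize_and, Set.mem_ofPred_eq, ← hg, inEnd]
      constructor
      · rintro ⟨e, h⟩
        rw [e, hi]
        exact ⟨add_right_cancel (hn.symm.trans e), h⟩
      · rintro ⟨e, h⟩
        have hn' : D.node w = i + 1 := by rw [hn, e]
        refine ⟨hn', ?_⟩
        rwa [hn', hi] at h
    · intro w h p hp
      change p ∈ localize _ _ {q | D.node w = i + 1 ∧ q ∈ D.S w} at hp
      rw [mem_localize_and] at hp
      apply D.no_prev w h p
      rw [inEnd, hp.1, hi]; exact hp.2
    · intro v p hp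
      exact D.no_next v p hp.2
    · intro w w' v h h'
      exact D.prev_inj v w w' h h'
  locG i := by
    apply ShapeFamily.mapMod_isLocMap (Finset.empty_subset _)
    · intro v w h; cases h
    · intro v _ p hp
      change p ∈ localize _ _ {q | D.node v = i ∧ q ∈ outEnd (D.node v) (D.S v)} at hp
      rw [mem_localize_and] at hp
      obtain ⟨e, hp⟩ := hp
      rw [← e] at hp
      exact D.torsion v p hp
    · intro w; exact w.elim
    · intro v v' w; exact w.elim
  compat i m := by
    have : ∀ x y : famG.Mod, x = y := by
      rintro (_ | ⟨v, _, _⟩) (_ | ⟨w, _, _⟩)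
      · rfl
      · exact w.elim
      · exact v.elim
      · exact v.elim
    exact this _ _

end Gluing

theorem IsConnShape.not_mem_inEnd {i : Fin 3} {T : Set (ℤ × ℤ)} {b : ℕ∞}
    (h : IsConnShape i T 0 b) (p : ℤ × ℤ) : p ∉ inEnd i T := by
  rw [inEnd, chart_eq', edge_eq']
  exact localize_of_asymp_zero (ne_two i) (ne_one i).symm (one_ne_two i) h.asympIn p

theorem IsConnShape.not_mem_outEnd {i : Fin 3} {T : Set (ℤ × ℤ)} {a : ℕ∞}
    (h : IsConnShape i T a 0) (p : ℤ × ℤ) : p ∉ outEnd i T := by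
  rw [outEnd, chart_eq, edge_eq]
  exact localize_of_asymp_zero (ne_one i) (ne_two i).symm (one_ne_two i).symm h.asympOut p

theorem IsConnShape.mem_inEnd {i : Fin 3} {T : Set (ℤ × ℤ)} {a : ℕ} {b : ℕ∞}
    (h : IsConnShape i T a b) {g : ℤ × ℤ} (hg : IsEdgeGen i (i + 2) (i + 1) T g) (p : ℤ × ℤ) :
    p ∈ inEnd i T ↔ pairing g (ray (i + 1)) ≤ pairing p (ray (i + 1)) ∧
      pairing p (ray (i + 1)) < pairing g (ray (i + 1)) + a := by
  rw [inEnd, chart_eq', edge_eq']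
  have hc := h.skew.2
  rw [chart_eq'] at hc
  exact mem_localize_strip (ne_two i) (ne_one i) (one_ne_two i).symm hc h.asympIn hg.1 p

theorem IsConnShape.mem_outEnd {i : Fin 3} {T : Set (ℤ × ℤ)} {a : ℕ∞} {b : ℕ}
    (h : IsConnShape i T a b) {g : ℤ × ℤ} (hg : IsEdgeGen i (i + 1) (i + 2) T g) (p : ℤ × ℤ) :
    p ∈ outEnd i T ↔ pairing g (ray (i + 2)) ≤ pairing p (ray (i + 2)) ∧
      pairing p (ray (i + 2)) < pairing g (ray (i + 2)) + b := by
  rw [outEnd, chart_eq, edge_eq]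
  have hc := h.skew.2
  rw [chart_eq] at hc
  exact mem_localize_strip (ne_one i) (ne_two i) (one_ne_two i) hc h.asympOut hg.1 p

theorem IsConnShape.torsion {i : Fin 3} {T : Set (ℤ × ℤ)} {a : ℕ∞} {b : ℕ}
    (h : IsConnShape i T a b) {g : ℤ × ℤ} (hg : IsEdgeGen i (i + 1) (i + 2) T g) (p : ℤ × ℤ) :
    p ∉ localize (edge i) ∅ (outEnd i T) := by
  rintro ⟨c, -, hp⟩
  have hm := h.mem_outEnd hg
  have h0 := pairing_mon_right i (i + 2) (ne_two i)
  have h1 := hp ((pairing g (ray (i + 2)) + b - pairing (p + c) (ray (i + 2))).toNat •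
    mon i (i + 2)) (by
      rw [edge_eq, mem_inverted_empty, pairing_nsmul, h0]; simp)
  rw [hm, pairing_add, pairing_nsmul, h0] at h1
  omega

theorem localize_empty_of {R R' : Finset (Fin 3)} {T : Set (ℤ × ℤ)} (h : ∀ p, p ∉ T) (p : ℤ × ℤ) :
    p ∉ localize R R' T := by
  rintro ⟨a, -, hp⟩
  exact h _ (hp 0 (zero_mem_inverted _ _))

/-- The gluing isomorphism of degree `n` between two shapes with matching asymptotics. If `g`, `h`
are the generators of the restrictions to the line `l_{i,i+1}`, it is given by
`g = x⁻ⁿ h`, where `x = X_{i+1}/X_i` is the coordinate of the line on the chart `i`. The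
box `p` of the second shape is identified with the box `p + glueShift i g h n` of the first. -/
def glueShift (i : Fin 3) (g h : ℤ × ℤ) (n : ℤ) : ℤ × ℤ := g - h + n • mon i (i + 1)

theorem glue_iff {i i' : Fin 3} (hi : i' = i + 1) {T T' : Set (ℤ × ℤ)} {a : ℕ∞} {b : ℕ} {b' : ℕ}
    {c : ℕ∞} (h : IsConnShape i T a b) (h' : IsConnShape i' T' b' c) (hb : b = b') {g g' : ℤ × ℤ}
    (hg : IsEdgeGen i (i + 1) (i + 2) T g) (hg' : IsEdgeGen i' (i' + 2) (i' + 1) T' g')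
    (n : ℤ) (p : ℤ × ℤ) : p ∈ inEnd i' T' ↔ p + glueShift i g g' n ∈ outEnd i T := by
  subst hi hb
  rw [h'.mem_inEnd hg', h.mem_outEnd hg]
  have e2 := pairing_mon_other i (i + 1) (i + 2) (ne_two i).symm (one_ne_two i).symm
  rw [one_add_one, glueShift, pairing_add, pairing_add, pairing_sub, pairing_zsmul, e2]
  constructor <;> rintro ⟨h1, h2⟩ <;> constructor <;> omega

/-! ### Point sheaves -/

/-- A connected skew shape of type `(0, 0)` in the chart `i`. -/
structure PointData where
  i : Fin 3
  S : Set (ℤ × ℤ)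
  isShape : IsConnShape i S 0 0

/-- The point sheaf `𝔗_{S,i}`, with module `M_S` over `X_{σ_i}` and zero over the other charts. -/
noncomputable def PointData.sheaf (D : PointData) : Sheaf.{0} :=
  Gluing.sheaf
    { V := Unit
      node := fun _ => D.i
      S := fun _ => D.S
      convex := fun _ => D.isShape.skew.2
      prev := fun _ => none
      shift := fun _ => 0
      prev_node := by intro v w h; cases h
      glue := by intro v w h; cases h
      no_prev := fun _ _ p => D.isShape.not_mem_inEnd p
      no_next := fun _ p hp => absurd hp (D.isShape.not_mem_outEnd p)
      prev_inj := by intro v w w' h; cases h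
      torsion := fun _ p => localize_empty_of D.isShape.not_mem_outEnd p }

/-! ### Helices -/

/-- The chart `i + r` mod 3. -/
def nodeAt (i : Fin 3) (r : ℕ) : Fin 3 := i + Fin.ofNat 3 r

theorem nodeAt_succ (i : Fin 3) (r : ℕ) : nodeAt i (r + 1) = nodeAt i r + 1 := by
  unfold nodeAt
  rw [add_assoc]
  congr 1
  ext
  simp [Fin.val_add, Fin.ofNat]

/-- The data of a helix: a sequence of `q = N + 1` connected skew shapes `S 0, …, S N` in
the charts `i, i + 1, …` mod 3, of finite types `(tIn r, tOut r)`, consecutive ones having matching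
nonzero types along their common line, the first one having type `(0, a)` and the last one type
`(b, 0)`, together with the degrees `deg r` of the gluings. The fields `g`, `h` are the
generators of the restrictions to the lines with respect to which degrees are measured; they
are determined by the shapes. -/
structure HelixData where
  i : Fin 3
  N : ℕ
  S : Fin (N + 1) → Set (ℤ × ℤ)
  tIn : Fin (N + 1) → ℕ
  tOut : Fin (N + 1) → ℕ
  deg : Fin N → ℤ
  pos : 0 < N
  isShape : ∀ r : Fin (N + 1), IsConnShape (nodeAt i r) (S r) (tIn r) (tOut r)
  first : tIn 0 = 0
  last : tOut (Fin.last N) = 0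
  nonzero : ∀ r : Fin N, 0 < tOut r.castSucc
  matching : ∀ r : Fin N, tOut r.castSucc = tIn r.succ
  g : Fin N → ℤ × ℤ
  h : Fin N → ℤ × ℤ
  isGen_g : ∀ r : Fin N, IsEdgeGen (nodeAt i r.castSucc) (nodeAt i r.castSucc + 1)
    (nodeAt i r.castSucc + 2) (S r.castSucc) (g r)
  isGen_h : ∀ r : Fin N, IsEdgeGen (nodeAt i r.succ) (nodeAt i r.succ + 2)
    (nodeAt i r.succ + 1) (S r.succ) (h r)

/-- The helix. -/
noncomputable def HelixData.sheaf (D : HelixData) : Sheaf.{0} :=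
  Gluing.sheaf
    { V := Fin (D.N + 1)
      node := fun r => nodeAt D.i r
      S := D.S
      convex := fun r => (D.isShape r).skew.2
      prev := Fin.cases none (fun r => some r.castSucc)
      shift := Fin.cases 0 (fun r => glueShift (nodeAt D.i r.castSucc) (D.g r) (D.h r) (D.deg r))
      prev_node := by
        intro v w h
        cases w using Fin.cases with
        | zero => cases h
        | succ r =>
          change some r.castSucc = some v at h
          obtain rfl := Option.some.inj h
          exact nodeAt_succ D.i r
      glue := by
        intro v w h
        cases w using Fin.cases with
        | zero => cases h
        | succ r =>
          change some r.castSucc = some v at h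
          obtain rfl := Option.some.inj h
          exact glue_iff (nodeAt_succ D.i r) (D.isShape r.castSucc) (D.isShape r.succ)
            (D.matching r) (D.isGen_g r) (D.isGen_h r) (D.deg r)
      no_prev := by
        intro w h
        cases w using Fin.cases with
        | zero =>
          have := D.isShape 0
          rw [D.first] at this
          exact this.not_mem_inEnd
        | succ r => cases h
      no_next := by
        intro v p hp
        cases v using Fin.lastCases with
        | last =>
          have := D.isShape (Fin.last D.N)
          rw [D.last] at this
          exact absurd hp (this.not_mem_outEnd p)
        | cast r => exact ⟨r.succ, rfl⟩
      prev_inj := by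
        intro v w w' h h'
        cases w using Fin.cases with
        | zero => cases h
        | succ r =>
          cases w' using Fin.cases with
          | zero => cases h'
          | succ r' =>
            change some r.castSucc = some v at h
            change some r'.castSucc = some v at h'
            have := (Option.some.inj h).trans (Option.some.inj h').symm
            rw [Fin.castSucc_injective _ this]
      torsion := by
        intro v
        cases v using Fin.lastCases with
        | last =>
          have := D.isShape (Fin.last D.N)
          rw [D.last] at this
          exact localize_empty_of this.not_mem_outEnd
        | cast r => exact (D.isShape _).torsion (D.isGen_g r) }

/-! ### Cycles -/

/-- The data of a cycle: a cyclic sequence of `q = N + 1` connected skew shapes, `q` being a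
multiple of `3`, with matching nonzero finite types along the common lines of consecutive shapes
(the last one being followed by the first), and the degrees of the `q` gluings, `deg r` being
that of `S r` with `S (r + 1)`. -/
structure CycleData where
  i : Fin 3
  N : ℕ
  dvd : 3 ∣ N + 1
  S : Fin (N + 1) → Set (ℤ × ℤ)
  tIn : Fin (N + 1) → ℕ
  tOut : Fin (N + 1) → ℕ
  deg : Fin (N + 1) → ℤ
  isShape : ∀ r : Fin (N + 1), IsConnShape (nodeAt i r) (S r) (tIn r) (tOut r)
  nonzero : ∀ r, 0 < tOut r
  matching : ∀ r, tOut r = tIn (r + 1)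
  g : Fin (N + 1) → ℤ × ℤ
  h : Fin (N + 1) → ℤ × ℤ
  isGen_g : ∀ r : Fin (N + 1), IsEdgeGen (nodeAt i r) (nodeAt i r + 1) (nodeAt i r + 2) (S r) (g r)
  isGen_h : ∀ r : Fin (N + 1), IsEdgeGen (nodeAt i r) (nodeAt i r + 2) (nodeAt i r + 1) (S r) (h r)

theorem nodeAt_cyc {N : ℕ} (hN : 3 ∣ N + 1) (i : Fin 3) (r : Fin (N + 1)) :
    nodeAt i r = nodeAt i (r - 1 : Fin (N + 1)) + 1 := by
  rw [← nodeAt_succ]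
  obtain ⟨s, rfl⟩ : ∃ s, r = s + 1 := ⟨r - 1, by rw [sub_add_cancel]⟩
  rw [add_sub_cancel_right]
  unfold nodeAt
  congr 1
  ext
  simp only [Fin.ofNat]
  rw [Fin.val_add, Nat.mod_mod_of_dvd _ hN, Nat.add_mod, Nat.add_mod (s : ℕ) 1]
  congr 2
  rw [Fin.val_one', Nat.mod_mod_of_dvd _ hN]

/-- The cycle. -/
noncomputable def CycleData.sheaf (D : CycleData) : Sheaf.{0} :=
  Gluing.sheaf
    { V := Fin (D.N + 1)
      node := fun r => nodeAt D.i r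
      S := D.S
      convex := fun r => (D.isShape r).skew.2
      prev := fun w => some (w - 1)
      shift := fun w =>
        glueShift (nodeAt D.i (w - 1 : Fin (D.N + 1))) (D.g (w - 1)) (D.h w) (D.deg (w - 1))
      prev_node := by
        intro v w h
        obtain rfl := Option.some.inj h
        exact nodeAt_cyc D.dvd _ _
      glue := by
        intro v w h
        obtain rfl := Option.some.inj h
        refine glue_iff (nodeAt_cyc D.dvd _ _) (D.isShape _) (D.isShape _)
            ?_ (D.isGen_g _) (D.isGen_h _) (D.deg _)
        rw [D.matching, sub_add_cancel]
      no_prev := by intro w h; cases h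
      no_next := fun v _ _ => ⟨v + 1, by rw [add_sub_cancel_right]⟩
      prev_inj := by
        intro v w w' h h'
        exact sub_left_injective ((Option.some.inj h).trans (Option.some.inj h').symm)
      torsion := fun v => (D.isShape v).torsion (D.isGen_g v) }

/-! ### Torsion-free sheaves -/

/-- `g` is the corner (the generator) of the minimal completion of `T` to a translate of
`S_{σ_i} ∖ 0`, i.e. to the shape of a free module. -/
structure IsCorner (i : Fin 3) (T : Set (ℤ × ℤ)) (g : ℤ × ℤ) : Prop where
  le : ∀ p ∈ T, p - g ∈ dualCone (chart i)
  touch : ∀ j ∈ chart i, ∃ p ∈ T, pairing p (ray j) = pairing g (ray j)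

/-- Three connected skew shapes of type `(∞, ∞)`, one in each chart, and an integer. The
field `g` consists of the corners of the completed shapes, which are determined by the shapes. -/
structure TFData where
  S : Fin 3 → Set (ℤ × ℤ)
  m : ℤ
  isShape : ∀ i, IsConnShape i (S i) ⊤ ⊤
  g : Fin 3 → ℤ × ℤ
  isCorner : ∀ i, IsCorner i (S i) (g i)

namespace TFData

/-- The shape `S i`, translated so that its completion has its corner at `(X_i/X_0)^m`. After the
three translations the gluing isomorphisms are identities: they identify
`g_0 = x₁^{-m} g_1`, `g_1 = (x₁⁻¹ x₂)^{-m} g_2`, `g_0 = x₂^{-m} g_2`. -/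
def placed (D : TFData) (i : Fin 3) : Set (ℤ × ℤ) :=
  {p | p - D.m • coordVec i + D.g i ∈ D.S i}

/-- The shape of the structure sheaf over `X_{σ_i} ∩ X_{σ_{i+1}}`, translated accordingly. -/
def halfPlane (D : TFData) (i : Fin 3) : Set (ℤ × ℤ) :=
  {p | pairing (D.m • coordVec i) (ray (i + 2)) ≤ pairing p (ray (i + 2))}

theorem upper (D : TFData) (i : Fin 3) {p a : ℤ × ℤ} (hp : p ∈ D.S i)
    (ha : a ∈ dualCone (chart i)) : p + a ∈ D.S i := by
  have hs := D.isShape i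
  obtain ⟨N₀, hN⟩ := eventually_atTop.1 hs.asympOut
  set x := pairing (p + a) (ray (i + 1)) with hx
  set y := pairing (p + a) (ray (i + 2)) with hy
  obtain ⟨N, h1, h2⟩ : ∃ N : ℕ, N₀ ≤ N ∧ x ≤ N := ⟨max N₀ x.toNat, by omega, by omega⟩
  have hinf := hN N h1
  rw [Set.encard_eq_top_iff] at hinf
  have hne := one_ne_two i
  have : ∃ q ∈ D.S i, pairing q (ray (i + 1)) = N ∧ y ≤ pairing q (ray (i + 2)) := by
    by_contra hcon
    push Not at hcon
    apply hinf
    have hinj : Set.InjOn (fun q => pairing q (ray (i + 2)))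
        {p | p ∈ D.S i ∧ pairing p (ray (i + 1)) = N} := by
      intro q hq q' hq' e
      exact pairing_ext hne (hq.2.trans hq'.2.symm) e
    refine Set.Finite.of_finite_image (Set.Finite.subset (Set.finite_Icc 0 y) ?_) hinj
    rintro _ ⟨q, hq, rfl⟩
    refine ⟨?_, (hcon q hq.1 hq.2).le⟩
    have := hs.skew.1 hq.1
    rw [SetLike.mem_coe, chart_eq, mem_dualCone_pair] at this
    exact this.2
  obtain ⟨q, hq, h3, h4⟩ := this
  refine hs.skew.2 p (p + a) q hp hq ?_ ?_
  · rwa [add_sub_cancel_left]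
  · rw [chart_eq, mem_dualCone_pair, pairing_sub, pairing_sub]
    constructor <;> omega

theorem placed_upper (D : TFData) (i : Fin 3) {p a : ℤ × ℤ} (hp : p ∈ D.placed i)
    (ha : a ∈ dualCone (chart i)) : p + a ∈ D.placed i := by
  have := D.upper i hp ha
  have e : p - D.m • coordVec i + D.g i + a = p + a - D.m • coordVec i + D.g i := by abel
  rwa [e] at this

theorem localize_placed (D : TFData) {i j k : Fin 3} (hij : i ≠ j) (hik : i ≠ k) (hjk : j ≠ k)
    (p : ℤ × ℤ) : p ∈ localize (chart i) {k} (D.placed i) ↔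
      pairing (D.m • coordVec i) (ray k) ≤ pairing p (ray k) := by
  have hc : chart i = {j, k} := by revert i j k; decide
  have hcor := D.isCorner i
  rw [hc]
  constructor
  · rintro ⟨a, ha, h⟩
    have h0 := hcor.le _ (h 0 (zero_mem_inverted _ _))
    rw [mem_inverted_pair] at ha
    rw [hc, mem_dualCone_pair] at h0
    have h1 := h0.2
    simp only [pairing_sub, pairing_add, ha.2, add_zero] at h1
    omega
  · intro h
    obtain ⟨q, hq, hq'⟩ := hcor.touch k (by rw [hc]; simp)
    set s := D.m • coordVec i with hs
    have hd := pairing_mon_right i j hij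
    have hd' := pairing_mon_other i j k hik.symm hjk.symm
    refine ⟨(pairing q (ray j) - pairing (p - s + D.g i) (ray j)).toNat • mon i j, ?_, ?_⟩
    · rw [mem_inverted_pair, pairing_nsmul, pairing_nsmul, hd, hd']
      constructor <;> simp
    · intro b hb
      rw [mem_inverted_pair] at hb
      have key := D.upper i hq (a := p + (pairing q (ray j) -
        pairing (p - s + D.g i) (ray j)).toNat • mon i j + b - s + D.g i - q) (by
          rw [hc, mem_dualCone_pair]
          simp only [pairing_sub, pairing_add, pairing_nsmul, hd, hd', hb.2]
          constructor <;> omega)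
      rw [add_sub_cancel] at key
      exact key

theorem placed_convex (D : TFData) (i : Fin 3) : IsConvex (chart i) (D.placed i) := by
  intro p q r hp _ h1 _
  have := D.placed_upper i hp h1
  rwa [add_sub_cancel] at this

theorem halfPlane_convex (D : TFData) (i : Fin 3) : IsConvex (edge i) (D.halfPlane i) := by
  intro p q r hp _ h1 _
  rw [edge_eq, mem_dualCone_single, pairing_sub] at h1
  unfold halfPlane at *
  rw [Set.mem_ofPred_eq] at *
  omega

/-- The family consisting of one shape. -/
abbrev single {R : Finset (Fin 3)} (T : Set (ℤ × ℤ)) (h : IsConvex R T) : ShapeFamily R where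
  ι := Unit
  T _ := T
  convex _ := h

/-- The map from the module of `T` to the module of `T'` that fixes the boxes. -/
noncomputable def incl {R R' : Finset (Fin 3)} {T T' : Set (ℤ × ℤ)} (h : IsConvex R T)
    (h' : IsConvex R' T') : (single T h).Mod → (single T' h').Mod :=
  ShapeFamily.mapMod (single T h) (single T' h') (fun _ => some ()) 0

theorem incl_box {R R' : Finset (Fin 3)} {T T' : Set (ℤ × ℤ)} (h : IsConvex R T)
    (h' : IsConvex R' T') {p : ℤ × ℤ} (hp : p ∈ T) :
    incl h h' ((single T h).box () p) = (single T' h').box () p := by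
  have := ShapeFamily.mapMod_some (single T h) (single T' h') (fun _ => some ()) 0 (v := ())
    (w := ()) hp rfl
  rwa [Pi.zero_apply, add_zero] at this

theorem incl_isLocMap {R R' : Finset (Fin 3)} (hR : R' ⊆ R) {T T' : Set (ℤ × ℤ)}
    (h : IsConvex R T) (h' : IsConvex R' T') (e : ∀ p, p ∈ localize R R' T ↔ p ∈ T') :
    IsLocMap R R' (incl h h') := by
  apply ShapeFamily.mapMod_isLocMap hR
  · intro v w hv p
    rw [Pi.zero_apply, add_zero]; exact e p
  · intro v hv; cases hv
  · intro w p _; exact ⟨(), rfl⟩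
  · intro v v' w _ _; rfl

theorem univ_convex : IsConvex ∅ (Set.univ : Set (ℤ × ℤ)) := fun _ _ _ _ _ _ _ => trivial

theorem coordVec_edge : ∀ i : Fin 3, pairing (coordVec (i + 1)) (ray (i + 2)) =
    pairing (coordVec i) (ray (i + 2)) := by decide

/-- The torsion-free sheaf `𝔗𝔉[S_i, m]`. -/
noncomputable def sheaf (D : TFData) : Sheaf.{0} where
  M i := (single (D.placed i) (D.placed_convex i)).Mod
  E i := (single (D.halfPlane i) (D.halfPlane_convex i)).Mod
  G := (single Set.univ univ_convex).Mod
  resL i := incl (D.placed_convex i) (D.halfPlane_convex i)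
  resR i := incl (D.placed_convex (i + 1)) (D.halfPlane_convex i)
  resG i := incl (D.halfPlane_convex i) univ_convex
  locL i := by
    refine incl_isLocMap (edge_sub i) _ _ (fun p => ?_)
    rw [edge_eq]
    exact D.localize_placed (ne_one i) (ne_two i) (one_ne_two i) p
  locR i := by
    refine incl_isLocMap (edge_sub' i) _ _ (fun p => ?_)
    rw [edge_eq, D.localize_placed (ne_one i).symm (one_ne_two i) (ne_two i) p, halfPlane,
      Set.mem_ofPred_eq, pairing_zsmul, pairing_zsmul, coordVec_edge]
  locG i := by
    refine incl_isLocMap (Finset.empty_subset _) _ _ (fun p => iff_of_true ?_ trivial)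
    have hm := pairing_mon_right i (i + 2) (ne_two i)
    rw [edge_eq]
    refine ⟨(pairing (D.m • coordVec i) (ray (i + 2)) - pairing p (ray (i + 2))).toNat •
      mon i (i + 2), ?_, ?_⟩
    · rw [mem_inverted_empty, pairing_nsmul, hm]; simp
    · intro b hb
      rw [mem_inverted_empty] at hb
      rw [halfPlane, Set.mem_ofPred_eq, pairing_add, pairing_add, pairing_nsmul, hm]
      omega
  compat i m := by
    rcases ShapeFamily.cases_box _ m with rfl | ⟨⟨⟩, p, h, rfl⟩
    · rfl
    have hloc : ∀ k, i + 1 ≠ k → pairing (D.m • coordVec (i + 1)) (ray k) ≤ pairing p (ray k) := by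
      intro k hk
      have := (D.isCorner (i + 1)).le _ h k (by simp [chart, hk.symm])
      simp only [pairing_sub, pairing_add] at this
      omega
    have h1 : p ∈ D.halfPlane i := by
      have h1 := hloc (i + 2) (one_ne_two i)
      rwa [pairing_zsmul, coordVec_edge, ← pairing_zsmul] at h1
    have h2 : p ∈ D.halfPlane (i + 1) := hloc _ (ne_two (i + 1))
    rw [incl_box _ _ h, incl_box _ _ h, incl_box _ _ h1, incl_box _ _ h2]

end TFData

/-! ## The list of indecomposables and the Hall Lie algebra -/

/-- The sheaf is isomorphic to a point sheaf, a helix, a cycle, or a torsion-free sheaf as above. -/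
def Sheaf.IsListed (F : Sheaf.{u}) : Prop :=
  (∃ D : PointData, F.Iso D.sheaf) ∨ (∃ D : HelixData, F.Iso D.sheaf) ∨
    (∃ D : CycleData, F.Iso D.sheaf) ∨ ∃ D : TFData, F.Iso D.sheaf

/-- Coherent T-sheaves on `P^2`. -/
def TSheaf : Type 1 := {F : Sheaf.{0} // F.IsTSheaf}

instance TSheaf.setoid : Setoid TSheaf where
  r F F' := F.1.Iso F'.1
  iseqv := ⟨fun F => Sheaf.Iso.refl F.1, fun h => h.symm, fun h h' => h.trans h'⟩

/-- Isomorphism classes of coherent T-sheaves. -/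
def IsoClass : Type 1 := Quotient TSheaf.setoid

/-- The isomorphism class of a coherent T-sheaf. -/
def TSheaf.cls (F : TSheaf) : IsoClass := Quotient.mk _ F

open Classical in
/-- The value at `F` of the unit `δ_{[0]}` of the Hall algebra. -/
noncomputable def hallOne (k : Type v) [Field k] (F : TSheaf) : k := if F.1.IsZero then 1 else 0

/-- The Hall Lie algebra of coherent T-sheaves on `P^2`, as a vector space: the primitive elements of
the Hall algebra, which consists of the finitely supported functions `f` on isomorphism classes and
has the comultiplication `Δ(f)([X], [Y]) = f([X ⊕ Y])`; `f` is primitive if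
`Δ(f) = f ⊗ 1 + 1 ⊗ f`. -/
noncomputable def hallLie (k : Type v) [Field k] : Submodule k (IsoClass →₀ k) where
  carrier := {f | ∀ X Y Z : TSheaf, Z.1.Iso (X.1.sum Y.1) →
    f Z.cls = f X.cls * hallOne k Y + hallOne k X * f Y.cls}
  zero_mem' := by intro X Y Z _; simp
  add_mem' := by
    intro f f' hf hf' X Y Z h
    simp only [Finsupp.add_apply]
    rw [hf X Y Z h, hf' X Y Z h]; ring
  smul_mem' := by
    intro c f hf X Y Z h
    simp only [Finsupp.smul_apply, smul_eq_mul]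
    rw [hf X Y Z h]; ring

/-- The classes of the listed sheaves. -/
def listed : Set IsoClass := {c | ∃ F : TSheaf, F.1.IsListed ∧ c = F.cls}

end MonoidP2

/-! Indecomposability is first turned into connectedness. A predicate on sections that is stable
under monomials and compatible with the gluings splits a sheaf into the part where it holds and the
part where it fails, and every direct sum decomposition comes from such a predicate
(`Indecomposable.connected`, `Connected.indecomposable`). It remains to describe the connected
coherent T-sheaves.

On a chart, type α makes the two coordinates commuting partial injections, and the grading gives
them bidegrees (1,0) and (0,1). A zigzag of multiplications could a priori return to the same degree
at a different element. It cannot (`Grid.Conn.eq_of_degrees`): whenever a product of the two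
coordinates acts nontrivially, both intermediate elements are nonzero, so every zigzag straightens
into a monotone path. Hence a component embeds into the lattice by its degrees, its image is a
connected skew shape, and the module is the wedge of finitely many modules of shapes.

Over the intersection of two charts the monoid has a single ray, so divisibility of exponents is
total and "having a common nonzero multiple" is transitive (`Rel.trans`). Therefore a shape meets at
most one shape across each of its two lines, and the identification is a translation: the links form
a partial injection on the finite set of components. The localization of a shape along a line is
empty, or a strip, or contains a half-plane; this profile determines the type, so linked shapes have
equal types (`IsConnShape.type_eq`). Since one asymptotics of a shape is infinite exactly when the
other is, a connected sheaf has only finite types or only infinite ones.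

If the types are finite, a connected finite set with a partial injection is a chain or a cycle
(`exists_chain`), which gives point sheaves, helices and cycles. Each link advances the chart by
one, so the length of a cycle is divisible by 3. The part of a gluing translation transversal to the
line is forced by the bottoms of the strips, and the part along the line is the degree.

If the types are infinite, monomials kill nothing and all charts embed into the sections over the
triple intersection. By connectedness the images lie in one orbit of the lattice, on which it acts
freely. So each chart carries one shape, every section has a position in the lattice, and the
corners of neighbouring charts are level with respect to their common line. Three such corners form
a translate of m times the standard triangle, and m is the remaining invariant.

Conversely, boxes of a connected shape are joined by divisibility and the shapes by the gluings, so
listed sheaves are connected; finite generation is Dickson's lemma. Finally, a finitely supported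
function is primitive exactly when it vanishes on the zero sheaf and on decomposable sheaves, that
is, outside the listed classes. -/

namespace MonoidP2

/-! ## Zigzags in a bigraded set with two commuting partial injections -/

/-- A pointed set with two commuting partially defined injections `f`, `g` (with value `0` where
undefined), bigraded so that `f` has degree `(1, 0)` and `g` has degree `(0, 1)`. -/
structure Grid (M : Type*) [Zero M] where
  f : M → M
  g : M → M
  u : M → ℤ
  v : M → ℤ
  f_zero : f 0 = 0
  g_zero : g 0 = 0
  comm : ∀ x, f (g x) = g (f x)
  f_inj : ∀ x y, f x = f y → f x ≠ 0 → x = y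
  g_inj : ∀ x y, g x = g y → g x ≠ 0 → x = y
  u_f : ∀ x, f x ≠ 0 → u (f x) = u x + 1
  v_f : ∀ x, f x ≠ 0 → v (f x) = v x
  u_g : ∀ x, g x ≠ 0 → u (g x) = u x
  v_g : ∀ x, g x ≠ 0 → v (g x) = v x + 1

namespace Grid

variable {M : Type*} [Zero M] (D : Grid M)

/-- The roles of the two injections are exchanged. -/
def swap : Grid M where
  f := D.g
  g := D.f
  u := D.v
  v := D.u
  f_zero := D.g_zero
  g_zero := D.f_zero
  comm x := (D.comm x).symm
  f_inj := D.g_inj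
  g_inj := D.f_inj
  u_f := D.v_g
  v_f := D.u_g
  u_g := D.v_f
  v_g := D.u_f

/-- Nonzero elements one of which is the image of the other. -/
def Adj (x y : M) : Prop :=
  x ≠ 0 ∧ y ≠ 0 ∧ (y = D.f x ∨ y = D.g x ∨ x = D.f y ∨ x = D.g y)

/-- Nonzero elements joined by a zigzag. -/
def Conn : M → M → Prop := Relation.ReflTransGen D.Adj

/-- A single step along `f`, or backwards along `g`. -/
def SEStep (x y : M) : Prop := x ≠ 0 ∧ y ≠ 0 ∧ (y = D.f x ∨ x = D.g y)

/-- Zigzags running forward along `f` and backward along `g`. -/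
def SE : M → M → Prop := Relation.ReflTransGen D.SEStep

/-- `y` is a nonzero multiple of `x`. -/
def Le (x y : M) : Prop := y ≠ 0 ∧ ∃ s t : ℕ, y = D.f^[s] (D.g^[t] x)

theorem iterate_comm (s t : ℕ) (x : M) : D.f^[s] (D.g^[t] x) = D.g^[t] (D.f^[s] x) :=
  (Function.Commute.iterate_iterate (f := D.f) (g := D.g) D.comm s t) x

theorem f_ne {x : M} (h : D.f x ≠ 0) : x ≠ 0 := by
  rintro rfl; exact h D.f_zero

theorem g_ne {x : M} (h : D.g x ≠ 0) : x ≠ 0 := D.swap.f_ne h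

theorem adj_symm {x y : M} (h : D.Adj x y) : D.Adj y x := by
  obtain ⟨h1, h2, h3⟩ := h
  exact ⟨h2, h1, by tauto⟩

theorem conn_symm {x y : M} (h : D.Conn x y) : D.Conn y x := by
  induction h with
  | refl => exact .refl
  | tail _ h ih => exact .head (D.adj_symm h) ih

theorem iterate_f_zero (s : ℕ) : D.f^[s] 0 = 0 := Function.iterate_fixed D.f_zero s

theorem iterate_g_zero (s : ℕ) : D.g^[s] 0 = 0 := Function.iterate_fixed D.g_zero s

/-- A step forward along `f` or backward along `g`, read in reverse, is a step of the same kind with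
the two injections exchanged. This is what halves the case analysis below. -/
theorem swap_se {x y : M} : D.swap.SE x y ↔ D.SE y x := by
  have : D.swap.SEStep = Function.swap D.SEStep := by
    ext a b
    unfold SEStep swap Function.swap
    tauto
  unfold SE
  rw [this, Relation.reflTransGen_swap]

theorem swap_le {x y : M} : D.swap.Le x y ↔ D.Le x y := by
  unfold Le
  refine and_congr_right fun _ => ?_
  constructor <;> rintro ⟨s, t, h⟩
  · exact ⟨t, s, h.trans (D.swap.iterate_comm s t x)⟩
  · exact ⟨t, s, h.trans (D.iterate_comm s t x)⟩

theorem le_refl {x : M} (h : x ≠ 0) : D.Le x x := ⟨h, 0, 0, rfl⟩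

theorem Le.tail_f {D : Grid M} {x y : M} (h : D.Le x y) (h0 : D.f y ≠ 0) : D.Le x (D.f y) := by
  obtain ⟨h, s, t, rfl⟩ := h
  exact ⟨h0, s + 1, t, (Function.iterate_succ_apply' _ _ _).symm⟩

theorem Le.tail_g {D : Grid M} {x y : M} (h : D.Le x y) (h0 : D.g y ≠ 0) : D.Le x (D.g y) :=
  D.swap_le.1 ((D.swap_le.2 h).tail_f h0)

theorem Le.head_f {D : Grid M} {x y : M} (h : D.Le (D.f x) y) : D.Le x y := by
  obtain ⟨h, s, t, rfl⟩ := h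
  refine ⟨h, s + 1, t, ?_⟩
  rw [D.iterate_comm, D.iterate_comm, Function.iterate_succ_apply]

theorem Le.head_g {D : Grid M} {x y : M} (h : D.Le (D.g x) y) : D.Le x y :=
  D.swap_le.1 ((D.swap_le.2 h).head_f (D := D.swap))

/-- The new `g`-step slides back along the path: past a forward `f`-step by commutativity, which
also shows that the element it reaches is nonzero, until it cancels a backward `g`-step. If it
slides all the way to `x`, only `f`-steps were passed and the end is a multiple of `x`. -/
theorem SE.append_g {D : Grid M} {x y : M} (h : D.SE x y) (h0 : D.g y ≠ 0) :
    D.SE x (D.g y) ∨ D.Le x (D.g y) := by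
  induction h with
  | refl => exact .inr ((D.le_refl (D.g_ne h0)).tail_g h0)
  | @tail w y h1 h2 ih =>
    obtain ⟨hw, hy, rfl | rfl⟩ := h2
    · rw [← D.comm] at h0 ⊢
      rcases ih (D.f_ne h0) with ih | ih
      · exact .inl (.tail ih ⟨D.f_ne h0, h0, .inl rfl⟩)
      · exact .inr (ih.tail_f h0)
    · exact .inl h1

/-- The backward `f`-step cancels a final forward `f`-step by injectivity and slides past a backward
`g`-step by commutativity. If nothing cancels it, it arrives at `x` and exhibits `x` as a multiple
of `y'`. -/
theorem SE.append_f_back {D : Grid M} {x y' : M} (h : D.SE x (D.f y')) (h0 : D.f y' ≠ 0) :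
    D.SE x y' ∨ D.Le y' x := by
  generalize hy : D.f y' = y at h h0
  induction h generalizing y' with
  | refl => subst hy; exact .inr ((D.le_refl (D.f_ne h0)).tail_f h0)
  | @tail w y h1 h2 ih =>
    obtain ⟨hw, hy', rfl | rfl⟩ := h2
    · obtain rfl := D.f_inj _ _ hy (hy ▸ h0)
      exact .inl h1
    · subst hy
      rw [← D.comm] at hw
      rcases ih (D.comm y') (by rwa [← D.comm]) with ih | ih
      · exact .inl (.tail ih ⟨D.f_ne hw, D.f_ne hy', .inr rfl⟩)
      · exact .inr ih.head_g

theorem se_iterate_g {x : M} (t : ℕ) (h : D.g^[t] x ≠ 0) : D.SE (D.g^[t] x) x := by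
  induction t generalizing x with
  | zero => exact .refl
  | succ t ih =>
    rw [Function.iterate_succ_apply] at h ⊢
    have h' : D.g x ≠ 0 := by
      intro e; rw [e, D.iterate_g_zero] at h; exact h rfl
    exact .tail (ih h) ⟨h', D.g_ne h', .inr rfl⟩

/-- If the monotone path uses `f` at all, one `f` is removed by injectivity. Otherwise it is a pure
`g`-column, which read downwards after the step from `y'` to `f y'` is a zigzag of the other kind.
-/
theorem Le.append_f_back {D : Grid M} {x y' : M} (h : D.Le x (D.f y')) :
    D.Le x y' ∨ D.SE y' x := by
  obtain ⟨h0, s, t, e⟩ := h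
  cases s with
  | zero =>
    right
    have : D.SE (D.f y') x := by
      rw [e]; exact D.se_iterate_g t (by rw [e] at h0; exact h0)
    exact .head ⟨D.f_ne h0, h0, .inl rfl⟩ this
  | succ s =>
    left
    rw [Function.iterate_succ_apply'] at e
    exact ⟨D.f_ne h0, s, t, D.f_inj _ _ e h0⟩

theorem Le.f_left {D : Grid M} {x y : M} (h : D.Le y x) (h0 : D.f y ≠ 0) :
    D.Le (D.f y) x ∨ D.SE x (D.f y) := by
  obtain ⟨hx, s, t, rfl⟩ := h
  cases s with
  | zero =>
    right
    exact .tail (D.se_iterate_g t hx) ⟨D.f_ne h0, h0, .inl rfl⟩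
  | succ s =>
    left
    refine ⟨hx, s, t, ?_⟩
    rw [D.iterate_comm, Function.iterate_succ_apply, D.iterate_comm]

/-- The four ways in which two elements joined by a zigzag can lie relative to each other. -/
def Quad (x y : M) : Prop := D.Le x y ∨ D.Le y x ∨ D.SE x y ∨ D.SE y x

theorem swap_quad {x y : M} : D.swap.Quad x y ↔ D.Quad x y := by
  unfold Quad
  rw [swap_le, swap_le, swap_se, swap_se]
  tauto

theorem Quad.tail_f {D : Grid M} {x y : M} (h : D.Quad x y) (h0 : D.f y ≠ 0) :
    D.Quad x (D.f y) := by
  rcases h with h | h | h | h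
  · exact .inl (h.tail_f h0)
  · rcases h.f_left h0 with h | h
    · exact .inr (.inl h)
    · exact .inr (.inr (.inl h))
  · exact .inr (.inr (.inl (.tail h ⟨D.f_ne h0, h0, .inl rfl⟩)))
  · rcases SE.append_g (D := D.swap) (D.swap_se.2 h) h0 with h | h
    · exact .inr (.inr (.inr (D.swap_se.1 h)))
    · exact .inl (D.swap_le.1 h)

theorem Quad.f_back {D : Grid M} {x y : M} (h : D.Quad x (D.f y)) (h0 : D.f y ≠ 0) :
    D.Quad x y := by
  rcases h with h | h | h | h
  · rcases h.append_f_back with h | h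
    · exact .inl h
    · exact .inr (.inr (.inr h))
  · exact .inr (.inl h.head_f)
  · rcases h.append_f_back h0 with h | h
    · exact .inr (.inr (.inl h))
    · exact .inr (.inl h)
  · exact .inr (.inr (.inr (.head ⟨D.f_ne h0, h0, .inl rfl⟩ h)))

/-- A zigzag is prolonged one arrow at a time, and each prolongation can be straightened again into
one of the four kinds of paths. Arrows along `g` reduce to arrows along `f` by exchanging the two
injections. -/
theorem Conn.quad {D : Grid M} {x y : M} (h : D.Conn x y) (hx : x ≠ 0) : D.Quad x y := by
  induction h with
  | refl => exact .inl (D.le_refl hx)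
  | tail _ h ih =>
    obtain ⟨h1, h2, rfl | rfl | rfl | rfl⟩ := h
    · exact ih.tail_f h2
    · exact D.swap_quad.1 ((D.swap_quad.2 ih).tail_f h2)
    · exact ih.f_back h1
    · exact D.swap_quad.1 ((D.swap_quad.2 ih).f_back h1)

theorem Le.degrees {D : Grid M} {x y : M} {s t : ℕ} (h : y = D.f^[s] (D.g^[t] x)) (h0 : y ≠ 0) :
    D.u y = D.u x + s ∧ D.v y = D.v x + t := by
  have hg : ∀ t (z : M), D.g^[t] z ≠ 0 → D.u (D.g^[t] z) = D.u z ∧ D.v (D.g^[t] z) = D.v z + t := by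
    intro t z hz
    induction t with
    | zero => simp
    | succ t ih =>
      rw [Function.iterate_succ_apply'] at hz ⊢
      obtain ⟨h1, h2⟩ := ih (D.g_ne hz)
      rw [D.u_g _ hz, D.v_g _ hz, h1, h2]
      push_cast
      exact ⟨rfl, by ring⟩
  have hf : ∀ t (z : M), D.f^[t] z ≠ 0 → D.u (D.f^[t] z) = D.u z + t ∧ D.v (D.f^[t] z) = D.v z := by
    intro t z hz
    induction t with
    | zero => simp
    | succ t ih =>
      rw [Function.iterate_succ_apply'] at hz ⊢
      obtain ⟨h1, h2⟩ := ih (D.f_ne hz)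
      rw [D.u_f _ hz, D.v_f _ hz, h1, h2]
      push_cast
      exact ⟨by ring, rfl⟩
  subst h
  obtain ⟨h1, h2⟩ := hf s _ h0
  have : D.g^[t] x ≠ 0 := by
    intro e; rw [e, D.iterate_f_zero] at h0; exact h0 rfl
  obtain ⟨h3, h4⟩ := hg t _ this
  omega

/-- Along such a path the first degree never drops and the second never grows; each backward
`g`-step lowers the second strictly, so equal second degrees leave only `f`-steps. -/
theorem SE.degrees {D : Grid M} {x y : M} (h : D.SE x y) :
    D.u x ≤ D.u y ∧ D.v y ≤ D.v x ∧ (D.v x = D.v y → ∃ s, y = D.f^[s] x) := by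
  induction h with
  | refl => exact ⟨le_rfl, le_rfl, fun _ => ⟨0, rfl⟩⟩
  | tail _ h ih =>
    obtain ⟨i1, i2, i3⟩ := ih
    obtain ⟨h1, h2, rfl | rfl⟩ := h
    · rw [D.u_f _ h2, D.v_f _ h2]
      refine ⟨by omega, i2, fun e => ?_⟩
      obtain ⟨s, rfl⟩ := i3 e
      exact ⟨s + 1, (Function.iterate_succ_apply' _ _ _).symm⟩
    · rw [D.u_g _ h1] at i1
      rw [D.v_g _ h1] at i2
      exact ⟨i1, by omega, fun e => by omega⟩

/-- Of two elements joined by a zigzag, the one of larger degree is a multiple of the other one. -/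
theorem Conn.eq_of_degrees {D : Grid M} {x y : M} (h : D.Conn x y) (hx : x ≠ 0) (hy : y ≠ 0)
    {s t : ℕ} (hu : D.u y = D.u x + s) (hv : D.v y = D.v x + t) : y = D.f^[s] (D.g^[t] x) := by
  have key : ∀ {s' t' : ℕ}, y = D.f^[s'] (D.g^[t'] x) → y = D.f^[s] (D.g^[t] x) := by
    intro s' t' e
    obtain ⟨h1, h2⟩ := Le.degrees e hy
    obtain rfl : s' = s := by omega
    obtain rfl : t' = t := by omega
    exact e
  rcases h.quad hx with ⟨-, s', t', h⟩ | ⟨-, s', t', h⟩ | h | h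
  · exact key h
  · obtain ⟨h1, h2⟩ := Le.degrees h hx
    obtain rfl : s' = 0 := by omega
    obtain rfl : t' = 0 := by omega
    exact key (s' := 0) (t' := 0) h.symm
  -- The path cannot raise the second degree, while `hv` says that it does not drop; so the two are
  -- equal and the path is a row. The last case is the mirror image, a column.
  · obtain ⟨h1, h2, h3⟩ := h.degrees
    obtain ⟨s', h⟩ := h3 (by omega)
    exact key (t' := 0) h
  · obtain ⟨h1, h2, h3⟩ := (D.swap_se.2 h).degrees
    obtain ⟨t', h⟩ := h3 (by change D.u x = D.u y; change D.u y ≤ D.u x at h2; omega)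
    exact key (s' := 0) h

end Grid

/-! ## The action of monomials -/

section Action

variable {R R' : Finset (Fin 3)} {M : Type*} [Zero M] [MulActionWithZero (ConeMonoid R) M]
  {M' : Type*} [Zero M'] [MulActionWithZero (ConeMonoid R') M']

open Classical in
/-- The action of the monomial with exponent `a`, extended by zero to all exponents. -/
noncomputable def mact (R : Finset (Fin 3)) {M : Type*} [Zero M]
    [MulActionWithZero (ConeMonoid R) M] (a : ℤ × ℤ) (x : M) : M :=
  if h : a ∈ dualCone R then mono a h • x else 0

theorem mact_of_mem {a : ℤ × ℤ} (h : a ∈ dualCone R) (x : M) : mact R a x = mono a h • x :=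
  dif_pos h

theorem mact_zero_right (a : ℤ × ℤ) : mact R a (0 : M) = 0 := by
  unfold mact; split_ifs
  · exact smul_zero _
  · rfl

theorem zero_mact (x : M) : mact R 0 x = x := by
  rw [mact_of_mem (zero_mem _), mono_zero_smul]

theorem mact_add {a b : ℤ × ℤ} (ha : a ∈ dualCone R) (hb : b ∈ dualCone R) (x : M) :
    mact R (a + b) x = mact R a (mact R b x) := by
  rw [mact_of_mem (add_mem ha hb), mact_of_mem ha, mact_of_mem hb, mono_add_smul ha hb]

theorem mact_comm {a b : ℤ × ℤ} (ha : a ∈ dualCone R) (hb : b ∈ dualCone R) (x : M) :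
    mact R a (mact R b x) = mact R b (mact R a x) := by
  rw [← mact_add ha hb, add_comm, mact_add hb ha]

theorem ne_of_mact_ne {a : ℤ × ℤ} {x : M} (h : mact R a x ≠ 0) : x ≠ 0 := by
  rintro rfl; exact h (mact_zero_right a)

theorem coneMonoid_cases (c : ConeMonoid R) : c = 0 ∨ ∃ a, ∃ ha : a ∈ dualCone R, c = mono a ha := by
  cases c using WithZero.recZeroCoe with
  | zero => exact .inl rfl
  | coe m => exact .inr ⟨(Multiplicative.toAdd m : dualCone R), (Multiplicative.toAdd m).2, rfl⟩

theorem smul_eq_mact (c : ConeMonoid R) : (∀ x : M, c • x = 0) ∨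
    ∃ a ∈ dualCone R, ∀ x : M, c • x = mact R a x := by
  rcases coneMonoid_cases c with rfl | ⟨a, ha, rfl⟩
  · exact .inl fun x => zero_smul _ x
  · exact .inr ⟨a, ha, fun x => (mact_of_mem ha x).symm⟩

theorem ModAlpha.cancel (h : ModAlpha R M) {a : ℤ × ℤ} {x y : M} (e : mact R a x = mact R a y)
    (h0 : mact R a x ≠ 0) : x = y := by
  by_cases ha : a ∈ dualCone R
  · rw [mact_of_mem ha] at e h0
    rw [mact_of_mem ha] at e
    exact (h _ _ _ e).resolve_right fun h => h0 h.1
  · exact absurd (dif_neg ha) h0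

theorem modAlpha_of_mact (h : ∀ a ∈ dualCone R, ∀ x y : M, mact R a x = mact R a y →
    mact R a x ≠ 0 → x = y) : ModAlpha R M := by
  intro c x y e
  rcases smul_eq_mact (M := M) c with hc | ⟨a, ha, hc⟩
  · exact .inr ⟨hc x, hc y⟩
  · by_cases h0 : c • x = 0
    · exact .inr ⟨h0, e ▸ h0⟩
    · rw [hc] at h0
      rw [hc, hc] at e
      exact .inl (h a ha x y e h0)

end Action

/-! ## Localization -/

/-- The monoid of `R'` is the localization of that of `R`. -/
structure IsLocPair (R R' : Finset (Fin 3)) : Prop where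
  sub : R' ⊆ R
  clear : ∀ c ∈ dualCone R', ∃ t ∈ inverted R R', c + t ∈ dualCone R

theorem isLocPair_pair {i j k : Fin 3} (hij : i ≠ j) (hik : i ≠ k) (hjk : j ≠ k) :
    IsLocPair {j, k} {k} := by
  refine ⟨by simp, fun m hm => ?_⟩
  rw [mem_dualCone_single] at hm
  -- The monomial `mon i j` pairs to 1 with `ray j` and to 0 with `ray k`, so this power restores
  -- the one inequality that is dropped in the localization and leaves the other one unchanged.
  refine ⟨(-pairing m (ray j)).toNat • mon i j, ?_, ?_⟩
  · rw [mem_inverted_pair, pairing_nsmul, pairing_nsmul, pairing_mon_right i j hij,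
      pairing_mon_other i j k hik.symm hjk.symm]
    constructor <;> simp
  · rw [mem_dualCone_pair, pairing_add, pairing_add, pairing_nsmul, pairing_nsmul,
      pairing_mon_right i j hij, pairing_mon_other i j k hik.symm hjk.symm]
    constructor <;> omega

theorem isLocPair_out (i : Fin 3) : IsLocPair (chart i) (edge i) := by
  rw [chart_eq, edge_eq]; exact isLocPair_pair (ne_one i) (ne_two i) (one_ne_two i)

theorem isLocPair_in (i : Fin 3) : IsLocPair (chart (i + 1)) (edge i) := by
  rw [chart_eq', edge_eq, one_add_one, one_add_two]
  exact isLocPair_pair (ne_one i).symm (one_ne_two i) (ne_two i)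

theorem isLocPair_empty (i : Fin 3) : IsLocPair (edge i) ∅ := by
  rw [edge_eq]
  refine ⟨by simp, fun m _ => ?_⟩
  have hm := pairing_mon_right i (i + 2) (ne_two i)
  refine ⟨(-pairing m (ray (i + 2))).toNat • mon i (i + 2), ?_, ?_⟩
  · rw [mem_inverted_empty, pairing_nsmul, hm]; simp
  · rw [mem_dualCone_single, pairing_add, pairing_nsmul, hm]; omega

section Loc

variable {R R' : Finset (Fin 3)} {M : Type*} [Zero M] [MulActionWithZero (ConeMonoid R) M]
  {M' : Type*} [Zero M'] [MulActionWithZero (ConeMonoid R') M'] {f : M → M'}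

theorem IsLocPair.mem (hR : IsLocPair R R') {a : ℤ × ℤ} (h : a ∈ inverted R R') :
    a ∈ dualCone R' := dualCone_mono hR.sub h.1

theorem IsLocPair.neg_mact (hR : IsLocPair R R') {a : ℤ × ℤ} (h : a ∈ inverted R R') (x : M') :
    mact R' (-a) (mact R' a x) = x := by
  rw [← mact_add h.2 (hR.mem h), neg_add_cancel, zero_mact]

theorem IsLocPair.mact_neg (hR : IsLocPair R R') {a : ℤ × ℤ} (h : a ∈ inverted R R') (x : M') :
    mact R' a (mact R' (-a) x) = x := by
  rw [← mact_add (hR.mem h) h.2, add_neg_cancel, zero_mact]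

theorem IsLocPair.mact_inj (hR : IsLocPair R R') {a : ℤ × ℤ} (h : a ∈ inverted R R') {x y : M'}
    (e : mact R' a x = mact R' a y) : x = y := by
  rw [← hR.neg_mact h x, e, hR.neg_mact h]

theorem IsLocPair.mact_eq_zero (hR : IsLocPair R R') {a : ℤ × ℤ} (h : a ∈ inverted R R') {x : M'} :
    mact R' a x = 0 ↔ x = 0 := by
  constructor
  · intro e; exact hR.mact_inj h (e.trans (mact_zero_right a).symm)
  · rintro rfl; exact mact_zero_right a

theorem IsLocPair.mact_regroup (hR : IsLocPair R R') {a t c : ℤ × ℤ} (ha : a ∈ inverted R R')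
    (ht : t ∈ inverted R R') (hc : c ∈ dualCone R') (x : M') :
    mact R' (a + t) (mact R' c x) = mact R' (c + t) (mact R' a x) := by
  rw [← mact_add (hR.mem (inverted_add ha ht)) hc,
    ← mact_add (add_mem hc (hR.mem ht)) (hR.mem ha)]
  congr 1; abel

theorem IsLocMap.map_mact (hf : IsLocMap R R' f) (hR : IsLocPair R R') {a : ℤ × ℤ}
    (ha : a ∈ dualCone R) (x : M) : f (mact R a x) = mact R' a (f x) := by
  rw [mact_of_mem ha, mact_of_mem (dualCone_mono hR.sub ha),
    hf.map_smul a ha (dualCone_mono hR.sub ha)]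

theorem IsLocMap.exists_eq (hf : IsLocMap R R' f) (n : M') :
    ∃ a ∈ inverted R R', ∃ m, mact R' a n = f m := by
  obtain ⟨a, ha, ha', m, h⟩ := hf.surj n
  exact ⟨a, ha, m, by rw [mact_of_mem ha', h]⟩

theorem IsLocMap.exists_of_eq (hf : IsLocMap R R' f) {m m' : M} (h : f m = f m') :
    ∃ a ∈ inverted R R', mact R a m = mact R a m' := by
  obtain ⟨a, ha, ha', h⟩ := hf.inj m m' h
  exact ⟨a, ha, by rw [mact_of_mem ha', mact_of_mem ha', h]⟩

theorem IsLocMap.eq_zero_iff (hf : IsLocMap R R' f) (hR : IsLocPair R R') {m : M} :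
    f m = 0 ↔ ∃ a ∈ inverted R R', mact R a m = 0 := by
  constructor
  · intro h
    obtain ⟨a, ha, e⟩ := hf.exists_of_eq (h.trans hf.map_zero.symm)
    exact ⟨a, ha, e.trans (mact_zero_right a)⟩
  · rintro ⟨a, ha, e⟩
    rw [← hR.mact_eq_zero ha, ← hf.map_mact hR ha.1, e, hf.map_zero]

theorem IsLocMap.ne_zero (hf : IsLocMap R R' f) {m : M} (h : f m ≠ 0) : m ≠ 0 := by
  rintro rfl; exact h hf.map_zero

theorem IsLocMap.eq_zero_of_forall (hf : IsLocMap R R' f) (hR : IsLocPair R R')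
    (h : ∀ m : M, m = 0) (n : M') : n = 0 := by
  obtain ⟨a, ha, m, e⟩ := hf.exists_eq n
  rwa [h m, hf.map_zero, hR.mact_eq_zero ha] at e

/-- If `f m` and `f m'` have a common nonzero multiple in the localization, then `m` and `m'` have
one, with the same difference of exponents. -/
theorem IsLocMap.lift_eq (hf : IsLocMap R R' f) (hR : IsLocPair R R') {c d : ℤ × ℤ}
    (hc : c ∈ dualCone R') (hd : d ∈ dualCone R') {m m' : M}
    (e : mact R' c (f m) = mact R' d (f m')) (h0 : mact R' c (f m) ≠ 0) :
    ∃ t, c + t ∈ dualCone R ∧ d + t ∈ dualCone R ∧ mact R (c + t) m = mact R (d + t) m' ∧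
      mact R (c + t) m ≠ 0 := by
  obtain ⟨s, hs, h1⟩ := hR.clear c hc
  obtain ⟨t, ht, h2⟩ := hR.clear d hd
  -- The same denominator `s + t` is used for `c` and for `d`, so their difference is not affected;
  -- `r` below is added to both for the same reason, since equality after `f` holds in `M` only up
  -- to an inverted monomial.
  have hst := inverted_add hs ht
  have k1 : c + (s + t) ∈ dualCone R := by rw [← add_assoc]; exact add_mem h1 ht.1
  have k2 : d + (s + t) ∈ dualCone R := by
    rw [add_comm s, ← add_assoc]; exact add_mem h2 hs.1
  have e' : f (mact R (c + (s + t)) m) = f (mact R (d + (s + t)) m') := by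
    rw [hf.map_mact hR k1, hf.map_mact hR k2, add_comm c, add_comm d, mact_add (hR.mem hst) hc,
      mact_add (hR.mem hst) hd, e]
  have h0' : f (mact R (c + (s + t)) m) ≠ 0 := by
    rw [hf.map_mact hR k1, add_comm c, mact_add (hR.mem hst) hc]
    rwa [Ne, hR.mact_eq_zero hst]
  obtain ⟨r, hr, e''⟩ := hf.exists_of_eq e'
  have k3 : c + (r + (s + t)) ∈ dualCone R := by
    rw [add_left_comm]; exact add_mem hr.1 k1
  have k4 : d + (r + (s + t)) ∈ dualCone R := by
    rw [add_left_comm]; exact add_mem hr.1 k2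
  refine ⟨r + (s + t), k3, k4, ?_, ?_⟩
  · rw [add_left_comm c, add_left_comm d, mact_add hr.1 k1, mact_add hr.1 k2, e'']
  · rw [add_left_comm c, mact_add hr.1 k1]
    intro h
    exact h0' ((hf.eq_zero_iff hR).2 ⟨r, hr, h⟩)

variable {N : Type*} [Zero N] [MulActionWithZero (ConeMonoid R) N]
  {N' : Type*} [Zero N'] [MulActionWithZero (ConeMonoid R') N'] {g : N → N'}

/-- Functoriality of localization. -/
theorem IsLocMap.exists_map (hf : IsLocMap R R' f) (hg : IsLocMap R R' g) (hR : IsLocPair R R')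
    (h : M → N) (hh : ∀ a ∈ dualCone R, ∀ x, h (mact R a x) = mact R a (h x)) :
    ∃ h' : M' → N', ∀ y z, ∀ a ∈ inverted R R', ∀ m, mact R' a y = f m →
      mact R' a z = g (h m) → h' y = z := by
  -- Well-definedness by cross-multiplication: if `y` is both the fraction of `m` by `a` and that of
  -- `n` by `b`, then the fractions of `h m` by `a` and of `h n` by `b` agree.
  have uniq : ∀ {y : M'} {z z' : N'} {a b : ℤ × ℤ} {m n : M}, a ∈ inverted R R' →
      b ∈ inverted R R' → mact R' a y = f m → mact R' b y = f n → mact R' a z = g (h m) →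
      mact R' b z' = g (h n) → z = z' := by
    intro y z z' a b m n ha hb e1 e2 e3 e4
    have : f (mact R b m) = f (mact R a n) := by
      rw [hf.map_mact hR hb.1, hf.map_mact hR ha.1, ← e1, ← e2, mact_comm (hR.mem hb) (hR.mem ha)]
    obtain ⟨c, hc, e⟩ := hf.exists_of_eq this
    have e5 := congrArg g (congrArg h e)
    rw [hh c hc.1, hh c hc.1, hh b hb.1, hh a ha.1, hg.map_mact hR hc.1, hg.map_mact hR hc.1] at e5
    have e6 := hR.mact_inj hc e5
    rw [hg.map_mact hR hb.1, hg.map_mact hR ha.1, ← e3, ← e4, mact_comm (hR.mem hb) (hR.mem ha)]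
      at e6
    exact hR.mact_inj hb (hR.mact_inj ha e6)
  choose a ha m hm using hf.exists_eq
  refine ⟨fun y => mact R' (-a y) (g (h (m y))), fun y z b hb n e1 e2 => ?_⟩
  exact uniq (ha y) hb (hm y) e1 (hR.mact_neg (ha y) _) e2

/-- An isomorphism of modules extends to the localizations. -/
theorem IsLocMap.exists_equiv (hf : IsLocMap R R' f) (hg : IsLocMap R R' g) (hR : IsLocPair R R')
    (h : M ≃ N) (hh : ∀ a ∈ dualCone R, ∀ x, h (mact R a x) = mact R a (h x)) :
    ∃ h' : M' ≃ N', (∀ c ∈ dualCone R', ∀ y, h' (mact R' c y) = mact R' c (h' y)) ∧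
      ∀ m, h' (f m) = g (h m) := by
  have hh' : ∀ a ∈ dualCone R, ∀ x, h.symm (mact R a x) = mact R a (h.symm x) := by
    intro a ha x
    rw [Equiv.symm_apply_eq, hh a ha, Equiv.apply_symm_apply]
  obtain ⟨k, hk⟩ := hf.exists_map hg hR h hh
  obtain ⟨l, hl⟩ := hg.exists_map hf hR h.symm hh'
  have fwd : ∀ y, ∃ a ∈ inverted R R', ∃ m, mact R' a y = f m ∧ mact R' a (k y) = g (h m) := by
    intro y
    obtain ⟨a, ha, m, e⟩ := hf.exists_eq y
    refine ⟨a, ha, m, e, ?_⟩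
    rw [hk y (mact R' (-a) (g (h m))) a ha m e (hR.mact_neg ha _), hR.mact_neg ha]
  have bwd : ∀ y, ∃ a ∈ inverted R R', ∃ m, mact R' a y = g m ∧ mact R' a (l y) = f (h.symm m) := by
    intro y
    obtain ⟨a, ha, m, e⟩ := hg.exists_eq y
    refine ⟨a, ha, m, e, ?_⟩
    rw [hl y (mact R' (-a) (f (h.symm m))) a ha m e (hR.mact_neg ha _), hR.mact_neg ha]
  refine ⟨⟨k, l, fun y => ?_, fun y => ?_⟩, fun c hc y => ?_, fun m => ?_⟩
  · obtain ⟨a, ha, m, e1, e2⟩ := fwd y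
    exact hl _ _ a ha _ e2 (by rw [Equiv.symm_apply_apply]; exact e1)
  · obtain ⟨a, ha, m, e1, e2⟩ := bwd y
    exact hk _ _ a ha _ e2 (by rw [Equiv.apply_symm_apply]; exact e1)
  · obtain ⟨a, ha, m, e1, e2⟩ := fwd y
    obtain ⟨t, ht, h1⟩ := hR.clear c hc
    refine hk _ _ (a + t) (inverted_add ha ht) (mact R (c + t) m) ?_ ?_
    · rw [hf.map_mact hR h1, ← e1, hR.mact_regroup ha ht hc]
    · rw [hh _ h1, hg.map_mact hR h1, ← e2, hR.mact_regroup ha ht hc]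
      rfl
  · exact hk _ _ 0 (zero_mem_inverted _ _) m (zero_mact _) (zero_mact _)

/-- The extension of a predicate to the localization. -/
def locExt (R R' : Finset (Fin 3)) {M M' : Type*} [Zero M'] [MulActionWithZero (ConeMonoid R') M']
    (f : M → M') (A : M → Prop) (y : M') : Prop :=
  ∃ a ∈ inverted R R', ∃ m, mact R' a y = f m ∧ A m

/-- Predicates on nonzero elements that are invariant under the action. -/
def ActInvariant (R : Finset (Fin 3)) {M : Type*} [Zero M] [MulActionWithZero (ConeMonoid R) M]
    (A : M → Prop) : Prop :=
  ∀ a ∈ dualCone R, ∀ x, mact R a x ≠ 0 → (A (mact R a x) ↔ A x)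

/-- Two numerators of the same nonzero fraction have a common nonzero multiple already in `M` by
`lift_eq`, and an invariant predicate agrees on them. So the extension does not depend on the chosen
fraction. -/
theorem locExt_iff (hf : IsLocMap R R' f) (hR : IsLocPair R R') {A : M → Prop}
    (hA : ActInvariant R A) {a : ℤ × ℤ} (ha : a ∈ inverted R R') {y : M'} {m : M}
    (e : mact R' a y = f m) (h0 : y ≠ 0) : locExt R R' f A y ↔ A m := by
  constructor
  · rintro ⟨b, hb, n, e', hn⟩
    have h1 : mact R' b (f m) = mact R' a (f n) := by
      rw [← e, ← e', mact_comm (hR.mem hb) (hR.mem ha)]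
    have h2 : mact R' b (f m) ≠ 0 := by
      rwa [Ne, hR.mact_eq_zero hb, ← e, hR.mact_eq_zero ha]
    obtain ⟨t, k1, k2, k3, k4⟩ := hf.lift_eq hR (hR.mem hb) (hR.mem ha) h1 h2
    rw [← hA _ k1 m k4, k3]
    rw [k3] at k4
    rwa [hA _ k2 n k4]
  · intro hm; exact ⟨a, ha, m, e, hm⟩

theorem locExt_map (hf : IsLocMap R R' f) (hR : IsLocPair R R') {A : M → Prop}
    (hA : ActInvariant R A) {m : M} (h0 : f m ≠ 0) : locExt R R' f A (f m) ↔ A m :=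
  locExt_iff hf hR hA (zero_mem_inverted _ _) (zero_mact _) h0

theorem locExt_invariant (hf : IsLocMap R R' f) (hR : IsLocPair R R') {A : M → Prop}
    (hA : ActInvariant R A) : ActInvariant R' (locExt R R' f A) := by
  intro c hc y h0
  obtain ⟨a, ha, m, e⟩ := hf.exists_eq y
  obtain ⟨t, ht, h1⟩ := hR.clear c hc
  have hat := inverted_add ha ht
  have e1 : mact R' (a + t) (mact R' c y) = f (mact R (c + t) m) := by
    rw [hf.map_mact hR h1, ← e, hR.mact_regroup ha ht hc]
  rw [locExt_iff hf hR hA hat e1 h0, locExt_iff hf hR hA ha e (ne_of_mact_ne h0), hA _ h1]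
  apply hf.ne_zero
  rwa [← e1, Ne, hR.mact_eq_zero hat]

end Loc

/-! ## Submodules cut out by invariant predicates -/

/-- The nonzero elements satisfying `A`, together with zero. -/
def Cut {M : Type u} [Zero M] (A : M → Prop) : Type u := {m : M // m = 0 ∨ A m}

/-- The element of the submodule given by an element of the module. -/
def Cut.mk {M : Type u} [Zero M] {A : M → Prop} (x : M) (h : x = 0 ∨ A x) : Cut A := ⟨x, h⟩

section Cut

variable {R R' : Finset (Fin 3)} {M : Type u} [Zero M] {N : Type u} [Zero N]

instance (A : M → Prop) : Zero (Cut A) := ⟨⟨0, .inl rfl⟩⟩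

theorem actInvariant_smul [MulActionWithZero (ConeMonoid R) M] {A : M → Prop}
    (hA : ActInvariant R A) (c : ConeMonoid R) {x : M} (h : c • x ≠ 0) : A (c • x) ↔ A x := by
  rcases smul_eq_mact (M := M) c with hc | ⟨a, ha, hc⟩
  · exact absurd (hc x) h
  · rw [hc] at h ⊢; exact hA a ha x h

/-- The action on a submodule cut out by an invariant predicate. -/
@[reducible] def cutAction [MulActionWithZero (ConeMonoid R) M] {A : M → Prop}
    (hA : ActInvariant R A) : MulActionWithZero (ConeMonoid R) (Cut A) where
  smul c p := ⟨c • p.1, by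
    by_cases h : c • p.1 = 0
    · exact .inl h
    · refine .inr ((actInvariant_smul hA c h).2 (p.2.resolve_left ?_))
      intro e; rw [e, smul_zero] at h; exact h rfl⟩
  one_smul p := Subtype.ext (one_smul _ _)
  mul_smul a b p := Subtype.ext (mul_smul a b _)
  smul_zero a := Subtype.ext (smul_zero a)
  zero_smul p := Subtype.ext (zero_smul _ _)

/-- The map of submodules induced by a pointed map compatible with the predicates. -/
def cutMap {A : M → Prop} {B : N → Prop} (f : M → N) (h0 : f 0 = 0)
    (h : ∀ x, f x ≠ 0 → (B (f x) ↔ A x)) (p : Cut A) : Cut B :=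
  ⟨f p.1, by
    by_cases e : f p.1 = 0
    · exact .inl e
    · refine .inr ((h _ e).2 (p.2.resolve_left ?_))
      intro e'; rw [e', h0] at e; exact e rfl⟩

theorem cutMap_isLocMap [MulActionWithZero (ConeMonoid R) M] [MulActionWithZero (ConeMonoid R') N]
    (hR : IsLocPair R R') {A : M → Prop} {B : N → Prop} (hA : ActInvariant R A)
    (hB : ActInvariant R' B) {f : M → N} (hf : IsLocMap R R' f)
    (h : ∀ x, f x ≠ 0 → (B (f x) ↔ A x)) :
    letI := cutAction hA
    letI := cutAction hB
    IsLocMap R R' (cutMap f hf.map_zero h) := by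
  let _ := cutAction hA
  let _ := cutAction hB
  refine ⟨Subtype.ext hf.map_zero, fun a ha ha' m => Subtype.ext (hf.map_smul a ha ha' _),
    fun n => ?_, fun m m' e => ?_⟩
  · by_cases hn : n.1 = 0
    · refine ⟨0, zero_mem_inverted _ _, zero_mem _, 0, Subtype.ext ?_⟩
      change mono 0 _ • n.1 = f 0
      rw [hn, hf.map_zero, smul_zero]
    · obtain ⟨a, ha, ha', m, e⟩ := hf.surj n.1
      have h1 : mact R' a n.1 ≠ 0 := by rwa [Ne, hR.mact_eq_zero ha]
      have h2 := hB a ha' n.1 h1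
      rw [mact_of_mem ha'] at h1 h2
      rw [e] at h1 h2
      exact ⟨a, ha, ha', ⟨m, .inr ((h m h1).1 (h2.2 (n.2.resolve_left hn)))⟩, Subtype.ext e⟩
  · obtain ⟨a, ha, ha', e⟩ := hf.inj m.1 m'.1 (congrArg Subtype.val e)
    exact ⟨a, ha, ha', Subtype.ext e⟩

open Classical in
/-- The projection to the submodule cut out by a predicate. -/
noncomputable def toCut (A : M → Prop) (x : M) : Cut A := if h : A x then Cut.mk x (.inr h) else 0

theorem toCut_of {A : M → Prop} {x : M} (h : A x) : (toCut A x).1 = x := by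
  unfold toCut; rw [dif_pos h]; rfl

theorem toCut_of_not {A : M → Prop} {x : M} (h : ¬ A x) : toCut A x = 0 := by
  unfold toCut; rw [dif_neg h]

theorem toCut_zero (A : M → Prop) : toCut A (0 : M) = 0 := by
  by_cases h : A 0
  · exact Subtype.ext (toCut_of h)
  · exact toCut_of_not h

theorem toCut_map {A : M → Prop} {B : N → Prop} (f : M → N) (h0 : f 0 = 0)
    (h : ∀ x, f x ≠ 0 → (B (f x) ↔ A x)) (x : M) :
    toCut B (f x) = cutMap f h0 h (toCut A x) := by
  apply Subtype.ext
  change _ = f (toCut A x).1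
  by_cases hx : f x = 0
  · rw [hx, toCut_zero]
    by_cases hA : A x
    · rw [toCut_of hA, hx]; rfl
    · rw [toCut_of_not hA]; exact h0.symm
  · by_cases hA : A x
    · rw [toCut_of hA, toCut_of ((h x hx).2 hA)]
    · rw [toCut_of_not hA, toCut_of_not (fun hB => hA ((h x hx).1 hB))]; exact h0.symm

open Classical in
/-- A pointed set is the wedge of the parts cut out by complementary predicates. -/
noncomputable def cutEquiv {A B : M → Prop} (hAB : ∀ x, B x ↔ ¬ A x) :
    M ≃ Wedge (Cut A) (Cut B) where
  toFun x := ⟨(toCut A x, toCut B x), by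
    by_cases h : A x
    · exact .inr (toCut_of_not fun hB => (hAB x).1 hB h)
    · exact .inl (toCut_of_not h)⟩
  invFun w := if w.1.1.1 = 0 then w.1.2.1 else w.1.1.1
  left_inv x := by
    change (if (toCut A x).1 = 0 then (toCut B x).1 else (toCut A x).1) = x
    by_cases h : A x
    · rw [toCut_of h]
      split_ifs with hx
      · rw [hx, toCut_zero]; rfl
      · rfl
    · rw [toCut_of_not h, toCut_of ((hAB x).2 h)]
      exact if_pos rfl
  right_inv := by
    have key : ∀ (p : Cut A) (q : Cut B), p = 0 ∨ q = 0 →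
        toCut A (if p.1 = 0 then q.1 else p.1) = p ∧
          toCut B (if p.1 = 0 then q.1 else p.1) = q := by
      intro p q h
      have hz : ∀ {C : M → Prop}, toCut C ((0 : Cut C).1) = 0 := toCut_zero _
      split_ifs with hp
      · have hp' : p = 0 := Subtype.ext hp
        subst hp'
        by_cases hq : q.1 = 0
        · have hq' : q = 0 := Subtype.ext hq
          subst hq'
          exact ⟨toCut_zero A, toCut_zero B⟩
        · have hB := q.2.resolve_left hq
          exact ⟨toCut_of_not ((hAB _).1 hB), Subtype.ext (toCut_of hB)⟩
      · have hq : q = 0 := h.resolve_left fun e => hp (congrArg Subtype.val e)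
        subst hq
        have hA := p.2.resolve_left hp
        exact ⟨Subtype.ext (toCut_of hA), toCut_of_not fun hB => (hAB _).1 hB hA⟩
    rintro ⟨⟨p, q⟩, h⟩
    exact Subtype.ext (Prod.ext (key p q h).1 (key p q h).2)

theorem toCut_smul [MulActionWithZero (ConeMonoid R) M] {A : M → Prop} (hA : ActInvariant R A)
    (c : ConeMonoid R) (x : M) : (toCut A (c • x)).1 = c • (toCut A x).1 :=
  congrArg Subtype.val (toCut_map (c • ·) (smul_zero c) (fun _ h => actInvariant_smul hA c h) x)

end Cut

theorem ActInvariant.not {R : Finset (Fin 3)} {M : Type u} [Zero M]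
    [MulActionWithZero (ConeMonoid R) M] {A : M → Prop} (hA : ActInvariant R A) :
    ActInvariant R (fun x => ¬ A x) := fun a ha x h => not_congr (hA a ha x h)

namespace Sheaf

/-! ## Connected sheaves -/

variable {F : Sheaf.{u}}

theorem isZero_of_forall (h : ∀ i (m : F.M i), m = 0) : F.IsZero := by
  have hE : ∀ i (m : F.E i), m = 0 := fun i => (F.locL i).eq_zero_of_forall (isLocPair_out i) (h i)
  exact ⟨h, hE, (F.locG 0).eq_zero_of_forall (isLocPair_empty 0) (hE 0)⟩

/-- Predicates on the sections over the three charts that cut the sheaf into two pieces. -/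
structure IsSep (F : Sheaf.{u}) (A : ∀ i, F.M i → Prop) : Prop where
  act : ∀ i, ActInvariant (chart i) (A i)
  glue : ∀ i, ∀ a ∈ dualCone (edge i), ∀ (m : F.M i) (m' : F.M (i + 1)),
    mact (edge i) a (F.resL i m) = F.resR i m' → F.resR i m' ≠ 0 → (A i m ↔ A (i + 1) m')

/-- Predicates on all sections that cut the sheaf into two pieces. -/
structure IsClopen (F : Sheaf.{u}) (A : ∀ i, F.M i → Prop) (AE : ∀ i, F.E i → Prop)
    (AG : F.G → Prop) : Prop where
  actM : ∀ i, ActInvariant (chart i) (A i)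
  actE : ∀ i, ActInvariant (edge i) (AE i)
  actG : ActInvariant ∅ AG
  resL : ∀ i m, F.resL i m ≠ 0 → (AE i (F.resL i m) ↔ A i m)
  resR : ∀ i m, F.resR i m ≠ 0 → (AE i (F.resR i m) ↔ A (i + 1) m)
  resG : ∀ i m, F.resG i m ≠ 0 → (AG (F.resG i m) ↔ AE i m)

variable {A : ∀ i, F.M i → Prop} {AE : ∀ i, F.E i → Prop} {AG : F.G → Prop}

theorem IsClopen.not (h : F.IsClopen A AE AG) :
    F.IsClopen (fun i x => ¬ A i x) (fun i x => ¬ AE i x) (fun x => ¬ AG x) where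
  actM i := (h.actM i).not
  actE i := (h.actE i).not
  actG := h.actG.not
  resL i m h0 := not_congr (h.resL i m h0)
  resR i m h0 := not_congr (h.resR i m h0)
  resG i m h0 := not_congr (h.resG i m h0)

/-- The predicates over the charts determine the others: on each intersection by extension from the
left chart, on the triple intersection by extension from the first edge. Compatibility with the
right charts is the gluing condition of `IsSep`; compatibility with the other two edges is carried
around the triangle. -/
theorem IsSep.exists_clopen (h : F.IsSep A) : ∃ AE AG, F.IsClopen A AE AG := by
  set AE : ∀ i, F.E i → Prop := fun i => locExt (chart i) (edge i) (F.resL i) (A i) with hAE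
  set AG : F.G → Prop := locExt (edge 0) ∅ (F.resG 0) (AE 0) with hAG
  have hE : ∀ i, ActInvariant (edge i) (AE i) := fun i =>
    locExt_invariant (F.locL i) (isLocPair_out i) (h.act i)
  have hG : ActInvariant ∅ AG := locExt_invariant (F.locG 0) (isLocPair_empty 0) (hE 0)
  have hL : ∀ i m, F.resL i m ≠ 0 → (AE i (F.resL i m) ↔ A i m) := fun i m h0 =>
    locExt_map (F.locL i) (isLocPair_out i) (h.act i) h0
  have hR : ∀ i m, F.resR i m ≠ 0 → (AE i (F.resR i m) ↔ A (i + 1) m) := by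
    intro i m' h0
    obtain ⟨a, ha, m, e⟩ := (F.locL i).exists_eq (F.resR i m')
    have e1 : mact (edge i) (-a) (F.resL i m) = F.resR i m' := by
      rw [← e, (isLocPair_out i).neg_mact ha]
    rw [← h.glue i (-a) ha.2 m m' e1 h0]
    exact locExt_iff (F.locL i) (isLocPair_out i) (h.act i) ha e h0
  have step : ∀ i, (∀ n, F.resG i n ≠ 0 → (AG (F.resG i n) ↔ AE i n)) →
      ∀ n, F.resG (i + 1) n ≠ 0 → (AG (F.resG (i + 1) n) ↔ AE (i + 1) n) := by
    intro i hi n h0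
    have hp := isLocPair_out (i + 1)
    have hq := isLocPair_empty (i + 1)
    -- Up to an inverted monomial, `n` comes from the chart `i + 1`, which also restricts to the
    -- previous edge; `compat` compares the two routes to the triple intersection.
    obtain ⟨a, ha, m, e⟩ := (F.locL (i + 1)).exists_eq n
    have ha' := hp.mem ha
    have e1 : mact ∅ a (F.resG (i + 1) n) = F.resG i (F.resR i m) := by
      rw [← (F.locG (i + 1)).map_mact hq ha', e, F.compat]
    have h1 : mact ∅ a (F.resG (i + 1) n) ≠ 0 := by
      rwa [Ne, hq.mact_eq_zero ⟨ha', mem_dualCone_empty⟩]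
    have h2 : F.resG i (F.resR i m) ≠ 0 := e1 ▸ h1
    have h3 := (F.locG i).ne_zero h2
    have h4 := (F.locG (i + 1)).ne_zero h0
    have h5 : mact (edge (i + 1)) a n ≠ 0 := by rwa [Ne, hp.mact_eq_zero ha]
    rw [← hG a mem_dualCone_empty _ h1, e1, hi _ h2, hR i m h3, ← hE (i + 1) a ha' n h5, e]
    exact (hL (i + 1) m (e ▸ h5)).symm
  have h0 : ∀ n, F.resG 0 n ≠ 0 → (AG (F.resG 0 n) ↔ AE 0 n) := fun n h0 =>
    locExt_map (F.locG 0) (isLocPair_empty 0) (hE 0) h0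
  refine ⟨AE, AG, h.act, hE, hG, hL, hR, fun i => ?_⟩
  fin_cases i
  · exact h0
  · exact step 0 h0
  · exact step 1 (step 0 h0)

/-- The subsheaf cut out by a predicate. -/
def IsClopen.cut (h : F.IsClopen A AE AG) : Sheaf.{u} :=
  letI : ∀ i, MulActionWithZero (ConeMonoid (chart i)) (Cut (A i)) := fun i => cutAction (h.actM i)
  letI : ∀ i, MulActionWithZero (ConeMonoid (edge i)) (Cut (AE i)) := fun i => cutAction (h.actE i)
  letI : MulActionWithZero (ConeMonoid ∅) (Cut AG) := cutAction h.actG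
  { M := fun i => Cut (A i)
    E := fun i => Cut (AE i)
    G := Cut AG
    resL := fun i => cutMap (F.resL i) (F.locL i).map_zero (h.resL i)
    resR := fun i => cutMap (F.resR i) (F.locR i).map_zero (h.resR i)
    resG := fun i => cutMap (F.resG i) (F.locG i).map_zero (h.resG i)
    locL := fun i => cutMap_isLocMap (isLocPair_out i) (h.actM i) (h.actE i) (F.locL i) (h.resL i)
    locR := fun i =>
      cutMap_isLocMap (isLocPair_in i) (h.actM (i + 1)) (h.actE i) (F.locR i) (h.resR i)
    locG := fun i => cutMap_isLocMap (isLocPair_empty i) (h.actE i) h.actG (F.locG i) (h.resG i)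
    compat := fun i m => Subtype.ext (F.compat i m.1) }

theorem IsClopen.iso_sum {B : ∀ i, F.M i → Prop} {BE : ∀ i, F.E i → Prop} {BG : F.G → Prop}
    (h : F.IsClopen A AE AG) (h' : F.IsClopen B BE BG) (hM : ∀ i x, B i x ↔ ¬ A i x)
    (hE : ∀ i x, BE i x ↔ ¬ AE i x) (hG : ∀ x, BG x ↔ ¬ AG x) : F.Iso (h.cut.sum h'.cut) := by
  refine ⟨fun i => cutEquiv (hM i), fun i => cutEquiv (hE i), cutEquiv hG, ?_, ?_, ?_, ?_, ?_, ?_⟩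
  · exact fun i c m => Subtype.ext (Prod.ext (Subtype.ext (toCut_smul (h.actM i) c m))
      (Subtype.ext (toCut_smul (h'.actM i) c m)))
  · exact fun i c m => Subtype.ext (Prod.ext (Subtype.ext (toCut_smul (h.actE i) c m))
      (Subtype.ext (toCut_smul (h'.actE i) c m)))
  · exact fun c m => Subtype.ext (Prod.ext (Subtype.ext (toCut_smul h.actG c m))
      (Subtype.ext (toCut_smul h'.actG c m)))
  · exact fun i m => Subtype.ext (Prod.ext (toCut_map _ (F.locL i).map_zero (h.resL i) m)
      (toCut_map _ (F.locL i).map_zero (h'.resL i) m))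
  · exact fun i m => Subtype.ext (Prod.ext (toCut_map _ (F.locR i).map_zero (h.resR i) m)
      (toCut_map _ (F.locR i).map_zero (h'.resR i) m))
  · exact fun i m => Subtype.ext (Prod.ext (toCut_map _ (F.locG i).map_zero (h.resG i) m)
      (toCut_map _ (F.locG i).map_zero (h'.resG i) m))

/-- Nonzero sheaves that cannot be cut into two nonzero pieces by predicates. -/
def Connected (F : Sheaf.{u}) : Prop :=
  (∃ i, ∃ m : F.M i, m ≠ 0) ∧ ∀ A : ∀ i, F.M i → Prop, F.IsSep A →
    (∀ i m, m ≠ 0 → A i m) ∨ ∀ i m, m ≠ 0 → ¬ A i m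

theorem Indecomposable.connected (h : F.Indecomposable) : F.Connected := by
  refine ⟨?_, fun A hA => ?_⟩
  · by_contra hcon
    push Not at hcon
    exact h.1 (isZero_of_forall hcon)
  · obtain ⟨AE, AG, hA⟩ := hA.exists_clopen
    rcases h.2 _ _ (hA.iso_sum hA.not (fun _ _ => Iff.rfl) (fun _ _ => Iff.rfl) fun _ => Iff.rfl)
      with h | h
    · right
      intro i m hm hAm
      exact hm (congrArg Subtype.val (h.1 i (Cut.mk m (.inr hAm))))
    · left
      intro i m hm
      by_contra hAm
      exact hm (congrArg Subtype.val (h.1 i (Cut.mk (A := fun x => ¬ A i x) m (.inr hAm))))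

theorem map_mact_of_smul {R : Finset (Fin 3)} {M : Type u} {N : Type v} [Zero M] [Zero N]
    [MulActionWithZero (ConeMonoid R) M] [MulActionWithZero (ConeMonoid R) N] {f : M → N}
    (hf : ∀ (a : ConeMonoid R) m, f (a • m) = a • f m) {a : ℤ × ℤ} (ha : a ∈ dualCone R) (m : M) :
    f (mact R a m) = mact R a (f m) := by
  rw [mact_of_mem ha, mact_of_mem ha, hf]

theorem map_zero_of_smul {R : Finset (Fin 3)} {M : Type u} {N : Type v} [Zero M] [Zero N]
    [MulActionWithZero (ConeMonoid R) M] [MulActionWithZero (ConeMonoid R) N] {f : M → N}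
    (hf : ∀ (a : ConeMonoid R) m, f (a • m) = a • f m) : f 0 = 0 := by
  rw [← zero_smul (ConeMonoid R) (0 : M), hf, zero_smul]

theorem wedge_mact {R : Finset (Fin 3)} {M : Type u} {N : Type v} [Zero M] [Zero N]
    [MulActionWithZero (ConeMonoid R) M] [MulActionWithZero (ConeMonoid R) N] {a : ℤ × ℤ}
    (ha : a ∈ dualCone R) (w : Wedge M N) :
    (mact R a w).1 = (mact R a w.1.1, mact R a w.1.2) := by
  rw [mact_of_mem ha, mact_of_mem ha, mact_of_mem ha]; rfl

theorem wedge_ne {M : Type u} {N : Type v} [Zero M] [Zero N] {w : Wedge M N} (h : w ≠ 0) :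
    w.1.1 ≠ 0 ↔ w.1.2 = 0 := by
  constructor
  · exact w.2.resolve_left
  · intro h2 h1
    exact h (Subtype.ext (Prod.ext h1 h2))

theorem Iso.ne_zero {F' : Sheaf.{v}} (f : ∀ i, F.M i ≃ F'.M i)
    (hf : ∀ i (a : ConeMonoid (chart i)) (m : F.M i), f i (a • m) = a • f i m) {i : Fin 3}
    (m : F.M i) : f i m ≠ 0 ↔ m ≠ 0 := by
  rw [← map_zero_of_smul (hf i)]; exact (f i).injective.ne_iff

/-- A nonzero element of a wedge lies on exactly one axis, and neither the action nor the
restriction maps can move it to the other axis without making it zero. -/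
theorem isSep_of_iso_sum {X Y : Sheaf.{v}} {f : ∀ i, F.M i ≃ (X.sum Y).M i}
    {e : ∀ i, F.E i ≃ (X.sum Y).E i}
    (hf : ∀ i (a : ConeMonoid (chart i)) (m : F.M i), f i (a • m) = a • f i m)
    (he : ∀ i (a : ConeMonoid (edge i)) (m : F.E i), e i (a • m) = a • e i m)
    (hL : ∀ i (m : F.M i), e i (F.resL i m) = (X.sum Y).resL i (f i m))
    (hR : ∀ i (m : F.M (i + 1)), e i (F.resR i m) = (X.sum Y).resR i (f (i + 1) m)) :
    F.IsSep fun i m => (f i m).1.1 ≠ 0 := by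
  refine ⟨fun i a ha m h0 => ?_, fun i a ha m m' h h0 => ?_⟩
  · have h1 := (Iso.ne_zero f hf _).2 h0
    have h2 := (Iso.ne_zero f hf _).2 (ne_of_mact_ne h0)
    have h3 : (f i (mact (chart i) a m)).1 = _ :=
      (congrArg Subtype.val (map_mact_of_smul (hf i) ha m)).trans (wedge_mact ha (f i m))
    constructor
    · intro h e
      apply h
      rw [h3]
      exact (congrArg (mact (chart i) a) e).trans (mact_zero_right a)
    · intro h
      have h' := (wedge_ne h2).1 h
      refine (wedge_ne h1).2 ?_
      rw [h3]
      exact (congrArg (mact (chart i) a) h').trans (mact_zero_right a)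
  · have key := congrArg (e i) h
    rw [map_mact_of_smul (he i) ha, hL, hR] at key
    have h1 : (X.sum Y).resR i (f (i + 1) m') ≠ 0 := by
      rw [← hR, ← map_zero_of_smul (he i)]; exact (e i).injective.ne h0
    have h2 := ((X.sum Y).locR i).ne_zero h1
    have h3 := key ▸ h1
    have h4 := ((X.sum Y).locL i).ne_zero (ne_of_mact_ne h3)
    have k := (wedge_mact ha _).symm.trans (congrArg Subtype.val key)
    have k1 : mact (edge i) a (X.resL i (f i m).1.1) = X.resR i (f (i + 1) m').1.1 :=
      congrArg Prod.fst k
    have k2 : mact (edge i) a (Y.resL i (f i m).1.2) = Y.resR i (f (i + 1) m').1.2 :=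
      congrArg Prod.snd k
    constructor
    · intro h
      have h' := (wedge_ne h4).1 h
      rw [h', (Y.locL i).map_zero, mact_zero_right] at k2
      have := (wedge_ne h1).2 k2.symm
      exact (X.locR i).ne_zero this
    · intro h
      have h' := (wedge_ne h2).1 h
      rw [h', (Y.locR i).map_zero] at k2
      have h5 : X.resR i (f (i + 1) m').1.1 ≠ 0 :=
        (wedge_ne h1).2 ((congrArg (Y.resR i) h').trans (Y.locR i).map_zero)
      rw [← k1] at h5
      exact (X.locL i).ne_zero (ne_of_mact_ne h5)

theorem Connected.indecomposable (h : F.Connected) : F.Indecomposable := by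
  obtain ⟨⟨i, m, hm⟩, h⟩ := h
  refine ⟨fun h0 => hm (h0.1 i m), fun X Y hXY => ?_⟩
  obtain ⟨f, e, g, hf, he, hg, hL, hR, hG⟩ := hXY
  rcases h _ (isSep_of_iso_sum hf he hL hR) with h | h
  · right
    refine isZero_of_forall fun i y => ?_
    by_contra hy
    let w : (X.sum Y).M i := ⟨(0, y), .inl rfl⟩
    have hw : w ≠ 0 := fun e => hy (congrArg (fun z => z.1.2) e)
    have := h i ((f i).symm w) ((Iso.ne_zero f hf _).1 (by rwa [Equiv.apply_symm_apply]))
    rw [Equiv.apply_symm_apply] at this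
    exact this rfl
  · left
    refine isZero_of_forall fun i x => ?_
    by_contra hx
    let w : (X.sum Y).M i := ⟨(x, 0), .inr rfl⟩
    have hw : w ≠ 0 := fun e => hx (congrArg (fun z => z.1.1) e)
    have := h i ((f i).symm w) ((Iso.ne_zero f hf _).1 (by rwa [Equiv.apply_symm_apply]))
    rw [Equiv.apply_symm_apply] at this
    exact this hx

theorem Connected.of_iso {F' : Sheaf.{v}} (h : F.Connected) (hF : F.Iso F') : F'.Connected := by
  obtain ⟨⟨i, m, hm⟩, h⟩ := h
  obtain ⟨f, e, g, hf, he, hg, hL, hR, hG⟩ := hF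
  refine ⟨⟨i, f i m, (Iso.ne_zero f hf m).2 hm⟩, fun A hA => ?_⟩
  have : F.IsSep fun i m => A i (f i m) := by
    refine ⟨fun i a ha m h0 => ?_, fun i a ha m m' h h0 => ?_⟩
    · rw [map_mact_of_smul (hf i) ha]
      apply hA.act i a ha
      rw [← map_mact_of_smul (hf i) ha]
      exact (Iso.ne_zero f hf _).2 h0
    · refine hA.glue i a ha _ _ ?_ ?_
      · rw [← hL, ← hR, ← h, map_mact_of_smul (he i) ha]
      · rw [← hR, ← map_zero_of_smul (he i)]; exact (e i).injective.ne h0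
  refine (h _ this).imp (fun h i m hm => ?_) (fun h i m hm => ?_)
  all_goals
    have h1 := h i ((f i).symm m) ((Iso.ne_zero f hf _).1 (by rwa [Equiv.apply_symm_apply]))
    rwa [Equiv.apply_symm_apply] at h1

theorem smul_of_map_mact {R : Finset (Fin 3)} {M : Type u} {N : Type v} [Zero M] [Zero N]
    [MulActionWithZero (ConeMonoid R) M] [MulActionWithZero (ConeMonoid R) N] {f : M → N}
    (h0 : f 0 = 0) (hf : ∀ a ∈ dualCone R, ∀ m, f (mact R a m) = mact R a (f m))
    (a : ConeMonoid R) (m : M) : f (a • m) = a • f m := by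
  rcases coneMonoid_cases a with rfl | ⟨a, ha, rfl⟩
  · rw [zero_smul, zero_smul, h0]
  · rw [← mact_of_mem ha, ← mact_of_mem ha, hf a ha]

/-- A sheaf is determined by the modules over the charts and by how elements of adjacent charts
become multiples of each other on the intersection. -/
theorem iso_of_charts {F' : Sheaf.{v}} (f : ∀ i, F.M i ≃ F'.M i) (f0 : ∀ i, f i 0 = 0)
    (hf : ∀ i, ∀ a ∈ dualCone (chart i), ∀ m, f i (mact (chart i) a m) = mact (chart i) a (f i m))
    (h : ∀ i (m' : F.M (i + 1)), F.resR i m' ≠ 0 → ∃ a ∈ dualCone (edge i), ∃ m,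
      mact (edge i) a (F.resL i m) = F.resR i m' ∧
      mact (edge i) a (F'.resL i (f i m)) = F'.resR i (f (i + 1) m')) : F.Iso F' := by
  -- Over each intersection the map is forced by the left chart, and over the triple intersection by
  -- the first edge. What has to be checked is agreement with the right charts, which is hypothesis
  -- `h`, and with the remaining edges, which follows from `compat`.
  choose e he heL using fun i =>
    (F.locL i).exists_equiv (F'.locL i) (isLocPair_out i) (f i) (hf i)
  obtain ⟨g, hg, hgG⟩ := (F.locG 0).exists_equiv (F'.locG 0) (isLocPair_empty 0) (e 0) (he 0)
  have e0 : ∀ i, e i 0 = 0 := by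
    intro i
    rw [← (F.locL i).map_zero, heL, f0, (F'.locL i).map_zero]
  have g0 : g 0 = 0 := by
    rw [← (F.locG 0).map_zero, hgG, e0, (F'.locG 0).map_zero]
  have heR : ∀ i m, e i (F.resR i m) = F'.resR i (f (i + 1) m) := by
    intro i m'
    by_cases h0 : F.resR i m' = 0
    · rw [h0, e0]
      obtain ⟨a, ha, h1⟩ := ((F.locR i).eq_zero_iff (isLocPair_in i)).1 h0
      refine (((F'.locR i).eq_zero_iff (isLocPair_in i)).2 ⟨a, ha, ?_⟩).symm
      rw [← hf (i + 1) a ha.1, h1, f0]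
    · obtain ⟨a, ha, m, h1, h2⟩ := h i m' h0
      rw [← h2, ← h1, he i a ha, heL]
  have step : ∀ i, (∀ n, g (F.resG i n) = F'.resG i (e i n)) →
      ∀ n, g (F.resG (i + 1) n) = F'.resG (i + 1) (e (i + 1) n) := by
    intro i hi n
    have hp := isLocPair_out (i + 1)
    have hq := isLocPair_empty (i + 1)
    obtain ⟨a, ha, m, h1⟩ := (F.locL (i + 1)).exists_eq n
    have ha' := hp.mem ha
    have hinv : a ∈ inverted (edge (i + 1)) ∅ := ⟨ha', mem_dualCone_empty⟩
    apply hq.mact_inj hinv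
    rw [← hg a mem_dualCone_empty, ← (F.locG (i + 1)).map_mact hq ha',
      ← (F'.locG (i + 1)).map_mact hq ha', ← he (i + 1) a ha', h1, heL, ← F.compat, ← F'.compat,
      hi, heR]
  refine ⟨f, e, g, fun i => smul_of_map_mact (f0 i) (hf i), fun i => smul_of_map_mact (e0 i) (he i),
    smul_of_map_mact g0 hg, heL, heR, fun i => ?_⟩
  fin_cases i
  · exact hgG
  · exact step 0 hgG
  · exact step 1 (step 0 hgG)

/-! ## Coherence is invariant under isomorphism -/

section Transport

variable {R : Finset (Fin 3)} {M : Type u} {N : Type v} [Zero M] [Zero N]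
  [MulActionWithZero (ConeMonoid R) M] [MulActionWithZero (ConeMonoid R) N]

theorem ModFG.of_surjective (h : ModFG R M) {f : M → N} (hs : Function.Surjective f)
    (hf : ∀ (a : ConeMonoid R) m, f (a • m) = a • f m) : ModFG R N := by
  classical
  obtain ⟨g, hg⟩ := h
  refine ⟨g.image f, fun n => ?_⟩
  obtain ⟨m, rfl⟩ := hs n
  obtain ⟨a, x, hx, rfl⟩ := hg m
  exact ⟨a, f x, Finset.mem_image_of_mem f hx, hf a x⟩

theorem ModGradable.of_injective (h : ModGradable R N) {f : M → N} (hi : Function.Injective f)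
    (hf : ∀ (a : ConeMonoid R) m, f (a • m) = a • f m) : ModGradable R M := by
  obtain ⟨deg, h⟩ := h
  refine ⟨fun m => deg (f m), fun a ha x h0 => ?_⟩
  change deg (f _) = _ + deg (f x)
  rw [hf]
  apply h
  rw [← hf, ← map_zero_of_smul hf]
  exact hi.ne h0

theorem ModAlpha.of_injective (h : ModAlpha R N) {f : M → N} (hi : Function.Injective f)
    (hf : ∀ (a : ConeMonoid R) m, f (a • m) = a • f m) : ModAlpha R M := by
  intro a x y e
  have h1 := h a (f x) (f y) (by rw [← hf, ← hf, e])
  rwa [← hf, ← hf, ← map_zero_of_smul hf, hi.eq_iff, hi.eq_iff, hi.eq_iff] at h1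

end Transport

theorem IsTSheaf.of_iso {F' : Sheaf.{v}} (h : F.IsTSheaf) (hF : F.Iso F') : F'.IsTSheaf := by
  obtain ⟨h1, h2, h3, h4, h5⟩ := h
  obtain ⟨f', e', g', hf', he', hg', -⟩ := hF.symm
  obtain ⟨f, e, g, hf, he, hg, -⟩ := hF
  exact ⟨fun i => ModAlpha.of_injective (h1 i) (f' i).injective (hf' i),
    fun i => ModAlpha.of_injective (h2 i) (e' i).injective (he' i),
    ModAlpha.of_injective h3 g'.injective hg',
    fun i => ModFG.of_surjective (h4 i) (f i).surjective (hf i),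
    fun i => ModGradable.of_injective (h5 i) (f' i).injective (hf' i)⟩

end Sheaf

/-! ## Asymptotics of convex shapes -/

theorem HasAsymp.unique {T : Set (ℤ × ℤ)} {j : Fin 3} {n m : ℕ∞} (h : HasAsymp T j n)
    (h' : HasAsymp T j m) : n = m := by
  obtain ⟨N, h1, h2⟩ := (h.and h').exists
  exact h1.symm.trans h2

section Asymp

variable {i j k : Fin 3} {T : Set (ℤ × ℤ)}

theorem exists_point (hij : i ≠ j) (hik : i ≠ k) (hjk : j ≠ k) (x y : ℤ) :
    ∃ q, pairing q (ray j) = x ∧ pairing q (ray k) = y := by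
  refine ⟨x • mon i j + y • mon i k, ?_, ?_⟩
  · rw [pairing_add, pairing_zsmul, pairing_zsmul, pairing_mon_right i j hij,
      pairing_mon_other i k j hij.symm hjk]; ring
  · rw [pairing_add, pairing_zsmul, pairing_zsmul, pairing_mon_right i k hik,
      pairing_mon_other i j k hik.symm hjk.symm]; ring

theorem mem_of_between (hT : IsConvex {j, k} T) {p q r : ℤ × ℤ} (hp : p ∈ T) (hr : r ∈ T)
    (h1 : pairing p (ray j) ≤ pairing q (ray j)) (h2 : pairing p (ray k) ≤ pairing q (ray k))
    (h3 : pairing q (ray j) ≤ pairing r (ray j)) (h4 : pairing q (ray k) ≤ pairing r (ray k)) :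
    q ∈ T := by
  refine hT p q r hp hr ?_ ?_ <;> rw [mem_dualCone_pair, pairing_sub, pairing_sub] <;> omega

/-- The bottom row is followed backwards along the line; it must end because the coordinate along
the line is nonnegative on `T`. -/
theorem exists_isEdgeGen (hij : i ≠ j) (hT : T ⊆ dualCone {j, k}) {g : ℤ × ℤ}
    (hg : OnBottom i j k T g) : ∃ g', IsEdgeGen i j k T g' := by
  by_contra hcon
  unfold IsEdgeGen at hcon
  push Not at hcon
  have : ∀ t : ℕ, OnBottom i j k T (g - t • mon i j) := by
    intro t
    induction t with
    | zero => rwa [zero_smul, sub_zero]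
    | succ t ih =>
      have := hcon _ ih
      rwa [sub_sub, ← succ_nsmul] at this
  have h := hT (this ((pairing g (ray j)).toNat + 1) 0).1
  rw [SetLike.mem_coe, mem_dualCone_pair, zero_smul, add_zero, pairing_sub, pairing_nsmul,
    pairing_mon_right i j hij] at h
  omega

/-- A convex shape bounded from below has an asymptotics along each coordinate line. If this is
nonzero then the lowest row of the shape is infinite, and if it is infinite then the shape
contains a translate of the quadrant. -/
theorem exists_hasAsymp (hij : i ≠ j) (hik : i ≠ k) (hjk : j ≠ k) (hT : IsConvex {j, k} T)
    (hc : T ⊆ dualCone {j, k}) : HasAsymp T j 0 ∨ ∃ n : ℕ∞, n ≠ 0 ∧ HasAsymp T j n ∧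
      ∃ g, OnBottom i j k T g ∧ (n = ⊤ → ∀ p, pairing g (ray j) ≤ pairing p (ray j) →
        pairing g (ray k) ≤ pairing p (ray k) → p ∈ T) := by
  have djj := pairing_mon_right i j hij
  have djk := pairing_mon_other i j k hik.symm hjk.symm
  have ekk := pairing_mon_right i k hik
  have ekj := pairing_mon_other i k j hij.symm hjk
  by_cases hfreq : ∀ᶠ N : ℕ in atTop, {p | p ∈ T ∧ pairing p (ray j) = N} = ∅
  · left
    filter_upwards [hfreq] with N hN
    rw [hN, Set.encard_empty]
  right
  rw [not_eventually] at hfreq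
  have hfar : ∀ x : ℤ, ∃ p ∈ T, x ≤ pairing p (ray j) := by
    intro x
    obtain ⟨N, hN, h⟩ := (frequently_atTop.1 hfreq) x.toNat
    obtain ⟨p, hp, e⟩ := Set.nonempty_iff_ne_empty.2 h
    exact ⟨p, hp, by omega⟩
  -- an element of the lowest row
  obtain ⟨g, hgT, hmin⟩ : ∃ g ∈ T, ∀ p ∈ T, pairing g (ray k) ≤ pairing p (ray k) := by
    obtain ⟨p0, hp0, -⟩ := hfar 0
    obtain ⟨g, hg, h⟩ := exists_minimalFor_of_wellFoundedLT (· ∈ T)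
      (fun p => (pairing p (ray k)).toNat) ⟨p0, hp0⟩
    refine ⟨g, hg, fun p hp => ?_⟩
    have h1 := hc hp
    have h2 := hc hg
    rw [SetLike.mem_coe, mem_dualCone_pair] at h1 h2
    have := @h p hp
    simp only at this
    omega
  have hrow : ∀ q, pairing g (ray j) ≤ pairing q (ray j) → pairing q (ray k) = pairing g (ray k) →
      q ∈ T := by
    intro q h1 h2
    obtain ⟨r, hr, h3⟩ := hfar (pairing q (ray j))
    exact mem_of_between hT hgT hr h1 h2.ge h3 (h2.le.trans (hmin r hr))
  have hbot : OnBottom i j k T g := by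
    intro t
    constructor
    · apply hrow <;> rw [pairing_add, pairing_nsmul] <;> [rw [djj]; rw [djk]] <;> simp
    · intro h
      have := hmin _ h
      rw [pairing_sub, pairing_add, pairing_nsmul, djk, ekk] at this
      omega
  set C : ℕ → Set (ℤ × ℤ) := fun N => {p | p ∈ T ∧ pairing p (ray j) = N} with hC
  set x0 : ℕ := (pairing g (ray j)).toNat with hx0
  have hg0 : (x0 : ℤ) = pairing g (ray j) := by
    have := hc hgT
    rw [SetLike.mem_coe, mem_dualCone_pair] at this
    omega
  -- Moving a box back by one column keeps it above and to the right of the lowest box `g`, hence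
  -- between two boxes of `T`. So the columns embed backwards and their sizes decrease.
  have hdown : ∀ N, x0 ≤ N → (C (N + 1)).encard ≤ (C N).encard := by
    intro N hN
    rw [← Function.Injective.encard_image (f := (· - mon i j)) sub_left_injective (C (N + 1))]
    apply Set.encard_le_encard
    rintro _ ⟨p, ⟨hp, e⟩, rfl⟩
    beta_reduce
    have h1 : pairing (p - mon i j) (ray j) = N := by
      rw [pairing_sub, djj, e]; push_cast; ring
    have h2 : pairing (p - mon i j) (ray k) = pairing p (ray k) := by
      rw [pairing_sub, djk, sub_zero]
    exact ⟨mem_of_between hT hgT hp (by omega) (by rw [h2]; exact hmin p hp) (by omega) h2.le, h1⟩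
  -- A decreasing sequence in `ℕ∞` is eventually constant, because it attains its minimum.
  obtain ⟨N₀, hN₀⟩ : ∃ N₀, ∀ N, N₀ ≤ N → (C (x0 + N₀)).encard = (C (x0 + N)).encard := by
    have anti : Antitone fun N => (C (x0 + N)).encard :=
      antitone_nat_of_succ_le fun N => hdown (x0 + N) (by omega)
    obtain ⟨N₀, -, h⟩ := exists_minimalFor_of_wellFoundedLT (fun _ : ℕ => True)
      (fun N => (C (x0 + N)).encard) ⟨0, trivial⟩
    exact ⟨N₀, fun N hN => le_antisymm (h trivial (anti hN)) (anti hN)⟩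
  have hasymp : HasAsymp T j (C (x0 + N₀)).encard := by
    filter_upwards [eventually_ge_atTop (x0 + N₀)] with N hN
    obtain ⟨t, rfl⟩ := Nat.exists_eq_add_of_le (show x0 ≤ N by omega)
    exact (hN₀ t (by omega)).symm
  refine ⟨_, ?_, hasymp, g, hbot, fun htop p h1 h2 => ?_⟩
  · rw [Set.encard_ne_zero]
    obtain ⟨q, hq1, hq2⟩ := exists_point hij hik hjk ((x0 + N₀ : ℕ) : ℤ) (pairing g (ray k))
    exact ⟨q, hrow q (by omega) hq2, hq1⟩
  -- The column `x0 + N` lies in the stable range and not to the left of `p`. Being infinite, it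
  -- contains a box at least as high as `p`, and `p` lies between `g` and that box.
  · set N := (pairing p (ray j)).toNat + N₀ with hN
    have hinf := (hN₀ N (by omega)).symm.trans htop
    obtain ⟨q, hq, h3⟩ : ∃ q ∈ C (x0 + N), pairing p (ray k) ≤ pairing q (ray k) := by
      by_contra hcon
      push Not at hcon
      rw [Set.encard_eq_top_iff] at hinf
      apply hinf
      have hinj : Set.InjOn (fun q => pairing q (ray k)) (C (x0 + N)) := by
        intro q hq q' hq' e
        exact pairing_ext hjk (hq.2.trans hq'.2.symm) e
      refine Set.Finite.of_finite_image (Set.Finite.subset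
        (Set.finite_Icc (pairing g (ray k)) (pairing p (ray k))) ?_) hinj
      rintro _ ⟨q, hq, rfl⟩
      exact ⟨hmin q hq.1, (hcon q hq).le⟩
    have h4 := hq.2
    exact mem_of_between hT hgT hq.1 h1 h2 (by omega) h3

/-- A shape containing a quadrant has infinite asymptotics. -/
theorem hasAsymp_top (hij : i ≠ j) (hik : i ≠ k) (hjk : j ≠ k) {g : ℤ × ℤ}
    (h : ∀ p, pairing g (ray j) ≤ pairing p (ray j) →
        pairing g (ray k) ≤ pairing p (ray k) → p ∈ T) : HasAsymp T j ⊤ := by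
  filter_upwards [eventually_ge_atTop (pairing g (ray j)).toNat] with N hN
  rw [Set.encard_eq_top_iff]
  choose P hP1 hP2 using fun y : ℤ => exists_point hij hik hjk (N : ℤ) y
  have hinj : Function.Injective P := fun y y' e => by rw [← hP2 y, e, hP2]
  refine Set.infinite_of_injective_forall_mem (f := fun t : ℕ => P (pairing g (ray k) + t)) ?_ ?_
  · intro t t' e
    have := hinj e
    omega
  · intro t
    exact ⟨h _ (by rw [hP1]; omega) (by rw [hP2]; omega), hP1 _⟩

/-- The localization of a shape containing a quadrant contains a half-plane. -/
theorem mem_localize_of_quadrant (hij : i ≠ j) (hik : i ≠ k) (hjk : j ≠ k) {g : ℤ × ℤ}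
    (h : ∀ p, pairing g (ray j) ≤ pairing p (ray j) →
        pairing g (ray k) ≤ pairing p (ray k) → p ∈ T) {p : ℤ × ℤ}
    (hp : pairing g (ray k) ≤ pairing p (ray k)) : p ∈ localize {j, k} {k} T := by
  have djj := pairing_mon_right i j hij
  have djk := pairing_mon_other i j k hik.symm hjk.symm
  refine ⟨(pairing g (ray j) - pairing p (ray j)).toNat • mon i j, ?_, fun b hb => ?_⟩
  · rw [mem_inverted_pair, pairing_nsmul, pairing_nsmul, djj, djk]
    constructor <;> simp
  · rw [mem_inverted_pair] at hb
    apply h <;> rw [pairing_add, pairing_add, pairing_nsmul] <;> [rw [djj]; rw [djk, hb.2]] <;> omega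

theorem OnBottom.mem_localize (hij : i ≠ j) (hik : i ≠ k) (hjk : j ≠ k) {g : ℤ × ℤ}
    (h : OnBottom i j k T g) : g ∈ T ∧ g ∈ localize {j, k} {k} T := by
  have djj := pairing_mon_right i j hij
  have djk := pairing_mon_other i j k hik.symm hjk.symm
  refine ⟨?_, 0, zero_mem_inverted _ _, fun b hb => ?_⟩
  · have := (h 0).1
    rwa [zero_smul, add_zero] at this
  · rw [mem_inverted_pair] at hb
    have : b = (pairing b (ray j)).toNat • mon i j := by
      apply pairing_ext hjk <;> rw [pairing_nsmul] <;> [rw [djj]; rw [djk, hb.2]] <;> omega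
    rw [add_zero, this]
    exact (h _).1

end Asymp

/-! ### Types of connected skew shapes -/

theorem exists_isConnShape {i : Fin 3} {T : Set (ℤ × ℤ)} (h : IsSkewShape i T) (h' : IsConn i T) :
    ∃ a b, IsConnShape i T a b := by
  have h1 := h.1
  have h2 := h.2
  have key : ∀ {i j k : Fin 3}, i ≠ j → i ≠ k → j ≠ k → IsConvex {j, k} T →
      T ⊆ dualCone {j, k} → ∃ n, HasAsymp T j n := by
    intro i j k hij hik hjk h h'
    rcases exists_hasAsymp hij hik hjk h h' with h | ⟨n, -, h, -⟩
    exacts [⟨0, h⟩, ⟨n, h⟩]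
  have h3 := h1
  have h4 := h2
  rw [chart_eq] at h1 h2
  rw [chart_eq'] at h3 h4
  obtain ⟨a, ha⟩ := key (ne_two i) (ne_one i) (one_ne_two i).symm h4 h3
  obtain ⟨b, hb⟩ := key (ne_one i) (ne_two i) (one_ne_two i) h2 h1
  exact ⟨a, b, h, h', ha, hb⟩

namespace IsConnShape

variable {i : Fin 3} {T : Set (ℤ × ℤ)} {a b : ℕ∞}

theorem exists_bottom_out (h : IsConnShape i T a b) (hb : b ≠ 0) :
    ∃ g, OnBottom i (i + 1) (i + 2) T g ∧ (b = ⊤ → ∀ p,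
      pairing g (ray (i + 1)) ≤ pairing p (ray (i + 1)) →
      pairing g (ray (i + 2)) ≤ pairing p (ray (i + 2)) → p ∈ T) := by
  have h1 := h.skew.1
  have h2 := h.skew.2
  rw [chart_eq] at h1 h2
  rcases exists_hasAsymp (ne_one i) (ne_two i) (one_ne_two i) h2 h1 with h0 | ⟨n, hn, h3, h4⟩
  · exact absurd (h.asympOut.unique h0) hb
  · rwa [h.asympOut.unique h3]

theorem exists_bottom_in (h : IsConnShape i T a b) (ha : a ≠ 0) :
    ∃ g, OnBottom i (i + 2) (i + 1) T g ∧ (a = ⊤ → ∀ p,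
      pairing g (ray (i + 2)) ≤ pairing p (ray (i + 2)) →
      pairing g (ray (i + 1)) ≤ pairing p (ray (i + 1)) → p ∈ T) := by
  have h1 := h.skew.1
  have h2 := h.skew.2
  rw [chart_eq'] at h1 h2
  rcases exists_hasAsymp (ne_two i) (ne_one i) (one_ne_two i).symm h2 h1 with h0 | ⟨n, hn, h3, h4⟩
  · exact absurd (h.asympIn.unique h0) ha
  · rwa [h.asympIn.unique h3]

/-- Infinite asymptotics along one line forces a whole quadrant into the shape, and a quadrant is
infinite along both lines. -/
theorem top_iff (h : IsConnShape i T a b) : a = ⊤ ↔ b = ⊤ := by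
  constructor
  · intro ha
    obtain ⟨g, -, hg⟩ := h.exists_bottom_in (by rw [ha]; simp)
    exact h.asympOut.unique (hasAsymp_top (ne_one i) (ne_two i) (one_ne_two i) (g := g)
      fun p h1 h2 => hg ha p h2 h1)
  · intro hb
    obtain ⟨g, -, hg⟩ := h.exists_bottom_out (by rw [hb]; simp)
    exact h.asympIn.unique (hasAsymp_top (ne_two i) (ne_one i) (one_ne_two i).symm (g := g)
      fun p h1 h2 => hg hb p h2 h1)

theorem exists_gen_out (h : IsConnShape i T a b) (hb : b ≠ 0) :
    ∃ g, IsEdgeGen i (i + 1) (i + 2) T g := by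
  obtain ⟨g, hg, -⟩ := h.exists_bottom_out hb
  have h1 := h.skew.1
  rw [chart_eq] at h1
  exact exists_isEdgeGen (ne_one i) h1 hg

theorem exists_gen_in (h : IsConnShape i T a b) (ha : a ≠ 0) :
    ∃ g, IsEdgeGen i (i + 2) (i + 1) T g := by
  obtain ⟨g, hg, -⟩ := h.exists_bottom_in ha
  have h1 := h.skew.1
  rw [chart_eq'] at h1
  exact exists_isEdgeGen (ne_two i) h1 hg

theorem outEnd_of_top (h : IsConnShape i T a ⊤) : ∃ c, ∀ p, c ≤ pairing p (ray (i + 2)) →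
    p ∈ outEnd i T := by
  obtain ⟨g, -, hg⟩ := h.exists_bottom_out (by simp)
  rw [outEnd, chart_eq, edge_eq]
  exact ⟨_, fun p hp => mem_localize_of_quadrant (ne_one i) (ne_two i) (one_ne_two i) (hg rfl) hp⟩

theorem inEnd_of_top (h : IsConnShape i T ⊤ b) : ∃ c, ∀ p, c ≤ pairing p (ray (i + 1)) →
    p ∈ inEnd i T := by
  obtain ⟨g, -, hg⟩ := h.exists_bottom_in (by simp)
  rw [inEnd, chart_eq', edge_eq']
  exact ⟨_, fun p hp => mem_localize_of_quadrant (ne_two i) (ne_one i) (one_ne_two i).symm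
    (hg rfl) hp⟩

/-- The three possible profiles of a localization are mutually exclusive, and in the strip case the
width is the type. So the type can be recovered from the localization alone, which is what gluings
preserve. -/
theorem outEnd_cases (h : IsConnShape i T a b) : (b = 0 ∧ ∀ p, p ∉ outEnd i T) ∨
    (b = ⊤ ∧ ∃ c, ∀ p, c ≤ pairing p (ray (i + 2)) → p ∈ outEnd i T) ∨
    ∃ n : ℕ, 0 < n ∧ b = n ∧ ∃ c, ∀ p, p ∈ outEnd i T ↔
      c ≤ pairing p (ray (i + 2)) ∧ pairing p (ray (i + 2)) < c + n := by
  cases b using ENat.recTopCoe with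
  | top => exact .inr (.inl ⟨rfl, h.outEnd_of_top⟩)
  | coe n =>
    rcases Nat.eq_zero_or_pos n with rfl | hn
    · exact .inl ⟨rfl, h.not_mem_outEnd⟩
    · obtain ⟨g, hg⟩ := h.exists_gen_out (by exact_mod_cast hn.ne')
      exact .inr (.inr ⟨n, hn, rfl, _, h.mem_outEnd hg⟩)

theorem inEnd_cases (h : IsConnShape i T a b) : (a = 0 ∧ ∀ p, p ∉ inEnd i T) ∨
    (a = ⊤ ∧ ∃ c, ∀ p, c ≤ pairing p (ray (i + 1)) → p ∈ inEnd i T) ∨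
    ∃ n : ℕ, 0 < n ∧ a = n ∧ ∃ c, ∀ p, p ∈ inEnd i T ↔
      c ≤ pairing p (ray (i + 1)) ∧ pairing p (ray (i + 1)) < c + n := by
  cases a using ENat.recTopCoe with
  | top => exact .inr (.inl ⟨rfl, h.inEnd_of_top⟩)
  | coe n =>
    rcases Nat.eq_zero_or_pos n with rfl | hn
    · exact .inl ⟨rfl, h.not_mem_inEnd⟩
    · obtain ⟨g, hg⟩ := h.exists_gen_in (by exact_mod_cast hn.ne')
      exact .inr (.inr ⟨n, hn, rfl, _, h.mem_inEnd hg⟩)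

theorem ne_zero_out_iff (h : IsConnShape i T a b) : b ≠ 0 ↔ ∃ p ∈ T, p ∈ outEnd i T := by
  constructor
  · intro hb
    obtain ⟨g, hg, -⟩ := h.exists_bottom_out hb
    rw [outEnd, chart_eq, edge_eq]
    exact ⟨g, hg.mem_localize (ne_one i) (ne_two i) (one_ne_two i)⟩
  · rintro ⟨p, -, hp⟩ rfl
    exact h.not_mem_outEnd p hp

theorem ne_zero_in_iff (h : IsConnShape i T a b) : a ≠ 0 ↔ ∃ p ∈ T, p ∈ inEnd i T := by
  constructor
  · intro ha
    obtain ⟨g, hg, -⟩ := h.exists_bottom_in ha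
    rw [inEnd, chart_eq', edge_eq']
    exact ⟨g, hg.mem_localize (ne_two i) (ne_one i) (one_ne_two i).symm⟩
  · rintro ⟨p, -, hp⟩ rfl
    exact h.not_mem_inEnd p hp

/-- Shapes whose localizations along their common line are translates of each other have equal
types along that line. -/
theorem type_eq {i' : Fin 3} {T' : Set (ℤ × ℤ)} {a' b' : ℕ∞} (hi : i' = i + 1)
    (h : IsConnShape i T a b) (h' : IsConnShape i' T' a' b') {s : ℤ × ℤ}
    (hs : ∀ p, p ∈ inEnd i' T' ↔ p + s ∈ outEnd i T) : b = a' := by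
  subst hi
  have hr := one_add_one i
  obtain ⟨P, hP⟩ : ∃ P : ℤ → ℤ × ℤ, ∀ y, pairing (P y) (ray (i + 2)) = y := by
    choose P _ hP using exists_point (ne_one i) (ne_two i) (one_ne_two i) 0
    exact ⟨P, hP⟩
  have hP' : ∀ y, pairing (P y + s) (ray (i + 2)) = y + pairing s (ray (i + 2)) := fun y => by
    rw [pairing_add, hP]
  have c1 := h.outEnd_cases
  have c2 := h'.inEnd_cases
  rw [hr] at c2
  -- Of the nine combinations the six mixed ones are refuted by testing the identification at a
  -- single suitable height.
  rcases c1 with ⟨hb, h1⟩ | ⟨hb, c, h1⟩ | ⟨n, hn, hb, c, h1⟩ <;>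
    rcases c2 with ⟨ha, h2⟩ | ⟨ha, d, h2⟩ | ⟨m, hm, ha, d, h2⟩
  · rw [hb, ha]
  · exact absurd ((hs _).1 (h2 (P d) (hP d).ge)) (h1 _)
  · exact absurd ((hs _).1 ((h2 (P d)).2 (by rw [hP]; omega))) (h1 _)
  · exact absurd ((hs (P (c - pairing s (ray (i + 2))))).2 (h1 _ (by rw [hP']; omega))) (h2 _)
  · rw [hb, ha]
  · have := (h2 _).1 ((hs (P (max (c - pairing s (ray (i + 2))) (d + m)))).2
      (h1 _ (by rw [hP']; omega)))
    rw [hP] at this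
    omega
  · exact absurd ((hs (P (c - pairing s (ray (i + 2))))).2 ((h1 _).2 (by rw [hP']; omega))) (h2 _)
  · have := (h1 _).1 ((hs (P (max (c + n - pairing s (ray (i + 2))) d))).1
      (h2 _ (by rw [hP]; omega)))
    rw [hP'] at this
    omega
  · rw [hb, ha]
    have key : ∀ y, (d ≤ y ∧ y < d + m) ↔ (c ≤ y + pairing s (ray (i + 2)) ∧
        y + pairing s (ray (i + 2)) < c + n) := by
      intro y
      have := hs (P y)
      rwa [h1, h2, hP, hP'] at this
    -- Tests at the lowest and highest rows of the second strip and at the rows just outside it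
    -- determine both its position and its width.
    have k1 := key d
    have k2 := key (d - 1)
    have k3 := key (d + m - 1)
    have k4 := key (d + m)
    congr 1
    omega

end IsConnShape

/-! ## Elements with a common nonzero multiple -/

/-- `x` and `y` have a common nonzero multiple, with difference of exponents `d`. -/
def Rel (R : Finset (Fin 3)) {M : Type u} [Zero M] [MulActionWithZero (ConeMonoid R) M]
    (x y : M) (d : ℤ × ℤ) : Prop :=
  ∃ a ∈ dualCone R, ∃ b ∈ dualCone R, mact R a x = mact R b y ∧ mact R a x ≠ 0 ∧ d = a - b

section Rel

variable {R : Finset (Fin 3)} {M : Type u} [Zero M] [MulActionWithZero (ConeMonoid R) M]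
  {x y z : M} {d d' : ℤ × ℤ}

theorem Rel.symm (h : Rel R x y d) : Rel R y x (-d) := by
  obtain ⟨a, ha, b, hb, e, h0, rfl⟩ := h
  exact ⟨b, hb, a, ha, e.symm, e ▸ h0, by abel⟩

theorem Rel.ne_left (h : Rel R x y d) : x ≠ 0 := by
  obtain ⟨a, ha, b, hb, e, h0, rfl⟩ := h
  exact ne_of_mact_ne h0

theorem Rel.ne_right (h : Rel R x y d) : y ≠ 0 := h.symm.ne_left

theorem Rel.of_mact_eq {a : ℤ × ℤ} (ha : a ∈ dualCone R) (h : mact R a x = y) (h0 : y ≠ 0) :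
    Rel R x y a :=
  ⟨a, ha, 0, zero_mem _, by rw [zero_mact, h], by rwa [h], by rw [sub_zero]⟩

/-- With a single ray, of two exponents one always divides the other. So of the two nonzero
multiples of `y` involved one is a multiple of the other, and that one is a nonzero common multiple
of `x` and `z`. Over a chart, with two rays, transitivity fails. -/
theorem Rel.trans {k : Fin 3} (hk : R = {k}) (h : Rel R x y d) (h' : Rel R y z d') :
    Rel R x z (d + d') := by
  subst hk
  obtain ⟨a, ha, b, hb, e, h0, rfl⟩ := h
  obtain ⟨a', ha', b', hb', e', h0', rfl⟩ := h'
  have : a' - b ∈ dualCone {k} ∨ b - a' ∈ dualCone {k} := by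
    rw [mem_dualCone_single, mem_dualCone_single, pairing_sub, pairing_sub]; omega
  rcases this with h | h
  · have h1 : mact {k} (a' - b + a) x = mact {k} b' z := by
      rw [mact_add h ha, e, ← mact_add h hb, sub_add_cancel, e']
    exact ⟨_, add_mem h ha, b', hb', h1, by rwa [h1, ← e'], by abel⟩
  · have h1 : mact {k} a x = mact {k} (b - a' + b') z := by
      rw [e, mact_add h hb', ← e', ← mact_add h ha', sub_add_cancel]
    exact ⟨a, ha, _, add_mem h hb', h1, h0, by abel⟩

end Rel

/-! ## Graded modules over the charts -/

/-- The degree of an element of a module, as an exponent vector. -/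
structure IsDegree (i : Fin 3) {M : Type u} [Zero M] [MulActionWithZero (ConeMonoid (chart i)) M]
    (deg : M → ℤ × ℤ) : Prop where
  alpha : ModAlpha (chart i) M
  mem : ∀ x, deg x ∈ dualCone (chart i)
  deg_mact : ∀ a ∈ dualCone (chart i), ∀ x, mact (chart i) a x ≠ 0 →
    deg (mact (chart i) a x) = a + deg x

theorem mon_mem_chart : ∀ i j : Fin 3, i ≠ j → mon i j ∈ dualCone (chart i) := by
  intro i j hij l hl
  by_cases h : l = j
  · subst h; rw [pairing_mon_right i l hij]; norm_num
  · rw [pairing_mon_other i j l (by rintro rfl; simp [chart] at hl) h]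

theorem chart_eq_pair : ∀ i j k : Fin 3, i ≠ j → i ≠ k → j ≠ k → chart i = {j, k} := by decide

theorem eq_of_mem_chart {i : Fin 3} (a : ℤ × ℤ) (ha : a ∈ dualCone (chart i)) :
    a = (pairing a (ray (i + 1))).toNat • mon i (i + 1) +
      (pairing a (ray (i + 2))).toNat • mon i (i + 2) := by
  rw [chart_eq, mem_dualCone_pair] at ha
  apply pairing_ext (one_ne_two i) <;> rw [pairing_add, pairing_nsmul, pairing_nsmul]
  · rw [pairing_mon_right i _ (ne_one i),
      pairing_mon_other i (i + 2) (i + 1) (ne_one i).symm (one_ne_two i)]; omega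
  · rw [pairing_mon_right i _ (ne_two i),
      pairing_mon_other i (i + 1) (i + 2) (ne_two i).symm (one_ne_two i).symm]; omega

section Chart

variable {i : Fin 3} {M : Type u} [Zero M] [MulActionWithZero (ConeMonoid (chart i)) M]
  {deg : M → ℤ × ℤ}

/-- The two coordinates of a chart, acting on a graded module. -/
noncomputable def IsDegree.grid (h : IsDegree i deg) : Grid M where
  f := mact (chart i) (mon i (i + 1))
  g := mact (chart i) (mon i (i + 2))
  u x := pairing (deg x) (ray (i + 1))
  v x := pairing (deg x) (ray (i + 2))
  f_zero := mact_zero_right _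
  g_zero := mact_zero_right _
  comm x := mact_comm (mon_mem_chart _ _ (ne_one i)) (mon_mem_chart _ _ (ne_two i)) x
  f_inj _ _ e h0 := h.alpha.cancel e h0
  g_inj _ _ e h0 := h.alpha.cancel e h0
  u_f x h0 := by
    rw [h.deg_mact _ (mon_mem_chart _ _ (ne_one i)) x h0, pairing_add,
      pairing_mon_right i _ (ne_one i)]; ring
  v_f x h0 := by
    rw [h.deg_mact _ (mon_mem_chart _ _ (ne_one i)) x h0, pairing_add,
      pairing_mon_other _ _ _ (ne_two i).symm (one_ne_two i).symm]; ring
  u_g x h0 := by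
    rw [h.deg_mact _ (mon_mem_chart _ _ (ne_two i)) x h0, pairing_add,
      pairing_mon_other _ _ _ (ne_one i).symm (one_ne_two i)]; ring
  v_g x h0 := by
    rw [h.deg_mact _ (mon_mem_chart _ _ (ne_two i)) x h0, pairing_add,
      pairing_mon_right i _ (ne_two i)]; ring

theorem iterate_mact {R : Finset (Fin 3)} {M : Type u} [Zero M]
    [MulActionWithZero (ConeMonoid R) M] {a : ℤ × ℤ} (ha : a ∈ dualCone R) (s : ℕ) (x : M) :
    (mact R a)^[s] x = mact R (s • a) x := by
  induction s with
  | zero => rw [zero_smul, zero_mact]; rfl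
  | succ s ih =>
    rw [Function.iterate_succ_apply', ih, succ_nsmul', mact_add ha (nsmul_mem ha s)]

theorem IsDegree.grid_iterate (h : IsDegree i deg) (s t : ℕ) (x : M) :
    h.grid.f^[s] (h.grid.g^[t] x) = mact (chart i) (s • mon i (i + 1) + t • mon i (i + 2)) x := by
  have h1 := mon_mem_chart _ _ (ne_one i)
  have h2 := mon_mem_chart _ _ (ne_two i)
  rw [mact_add (nsmul_mem h1 s) (nsmul_mem h2 t), ← iterate_mact h1, ← iterate_mact h2]
  rfl

theorem IsDegree.conn_mact (h : IsDegree i deg) {a : ℤ × ℤ} (ha : a ∈ dualCone (chart i)) {x : M}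
    (h0 : mact (chart i) a x ≠ 0) : h.grid.Conn x (mact (chart i) a x) := by
  rw [eq_of_mem_chart a ha, ← h.grid_iterate] at h0 ⊢
  have key : ∀ (D : Grid M) (s : ℕ) (x : M), D.f^[s] x ≠ 0 →
      (∀ x, x ≠ 0 → D.f x ≠ 0 → h.grid.Adj x (D.f x)) → h.grid.Conn x (D.f^[s] x) := by
    intro D s x hx hD
    induction s with
    | zero => exact .refl
    | succ s ih =>
      rw [Function.iterate_succ_apply'] at hx ⊢
      exact .tail (ih (D.f_ne hx)) (hD _ (D.f_ne hx) hx)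
  have h1 : h.grid.g^[(pairing a (ray (i + 2))).toNat] x ≠ 0 := by
    intro e
    rw [e, h.grid.iterate_f_zero] at h0
    exact h0 rfl
  exact .trans (key h.grid.swap _ _ h1 fun _ k1 k2 => ⟨k1, k2, .inr (.inl rfl)⟩)
    (key h.grid _ _ h0 fun _ k1 k2 => ⟨k1, k2, .inl rfl⟩)

theorem Grid.Conn.ne_zero {D : Grid M} {x y : M} (h : D.Conn x y) (hx : x ≠ 0) : y ≠ 0 := by
  induction h with
  | refl => exact hx
  | tail _ h _ => exact h.2.1

/-- In a zigzag of a graded module one of two neighbours is a multiple of the other one. -/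
theorem IsDegree.adj_cases (h : IsDegree i deg) {x y : M} (hxy : h.grid.Adj x y) :
    ∃ a ∈ dualCone (chart i), y = mact (chart i) a x ∨ x = mact (chart i) a y := by
  have h1 := mon_mem_chart _ _ (ne_one i)
  have h2 := mon_mem_chart _ _ (ne_two i)
  obtain ⟨-, -, e | e | e | e⟩ := hxy
  exacts [⟨_, h1, .inl e⟩, ⟨_, h2, .inl e⟩, ⟨_, h1, .inr e⟩, ⟨_, h2, .inr e⟩]

/-- The straightening of zigzags in module form: inside a component, divisibility is decided by
degrees. Everything about shapes of components rests on this. -/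
theorem IsDegree.eq_mact (h : IsDegree i deg) {x y : M} (hxy : h.grid.Conn x y) (hx : x ≠ 0)
    (hd : deg y - deg x ∈ dualCone (chart i)) : y = mact (chart i) (deg y - deg x) x := by
  rw [eq_of_mem_chart _ hd, ← h.grid_iterate]
  rw [chart_eq, mem_dualCone_pair, pairing_sub, pairing_sub] at hd
  apply hxy.eq_of_degrees hx (hxy.ne_zero hx)
  · change pairing (deg y) _ = pairing (deg x) _ + _
    rw [pairing_sub]; omega
  · change pairing (deg y) _ = pairing (deg x) _ + _
    rw [pairing_sub]; omega

theorem IsDegree.conn_of_mact_eq (h : IsDegree i deg) {x y : M} {a b : ℤ × ℤ}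
    (ha : a ∈ dualCone (chart i)) (hb : b ∈ dualCone (chart i))
    (e : mact (chart i) a x = mact (chart i) b y) (h0 : mact (chart i) a x ≠ 0) :
    h.grid.Conn x y ∧ a - b = deg y - deg x := by
  refine ⟨(h.conn_mact ha h0).trans ?_, ?_⟩
  · rw [e] at h0 ⊢; exact h.grid.conn_symm (h.conn_mact hb h0)
  · have h1 := h.deg_mact a ha x h0
    rw [e] at h0 h1
    rw [h.deg_mact b hb y h0] at h1
    rw [sub_eq_sub_iff_add_eq_add, add_comm _ b, h1]

/-- The set of degrees of the elements of the component of `x`. -/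
def IsDegree.shape (h : IsDegree i deg) (x : M) : Set (ℤ × ℤ) :=
  {p | ∃ y, h.grid.Conn x y ∧ deg y = p}

/-- For convexity, the monomial that carries `y` to `z` is factored through the intermediate degree.
The intermediate element is nonzero because its multiple `z` is. -/
theorem IsDegree.isSkewShape (h : IsDegree i deg) {x : M} (hx : x ≠ 0) :
    IsSkewShape i (h.shape x) := by
  constructor
  · rintro _ ⟨y, -, rfl⟩; exact h.mem y
  · rintro _ q _ ⟨y, hy, rfl⟩ ⟨z, hz, rfl⟩ h1 h2
    have hy0 := hy.ne_zero hx
    have e : q - deg y + (deg z - q) = deg z - deg y := by abel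
    have key := h.eq_mact ((h.grid.conn_symm hy).trans hz) hy0 (by rw [← e]; exact add_mem h1 h2)
    rw [← e, add_comm, mact_add h2 h1] at key
    have h0 : mact (chart i) (q - deg y) y ≠ 0 := ne_of_mact_ne (key ▸ hz.ne_zero hx)
    refine ⟨mact (chart i) (q - deg y) y, hy.trans (h.conn_mact h1 h0), ?_⟩
    rw [h.deg_mact _ h1 _ h0, sub_add_cancel]

theorem IsDegree.isConn (h : IsDegree i deg) {x : M} (hx : x ≠ 0) : IsConn i (h.shape x) := by
  refine ⟨⟨_, x, .refl, rfl⟩, ?_⟩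
  have key : ∀ y, h.grid.Conn x y → Relation.EqvGen (fun a b => a ∈ h.shape x ∧ b ∈ h.shape x ∧
      b - a ∈ dualCone (chart i)) (deg x) (deg y) := by
    intro y hy
    induction hy with
    | refl => exact .refl _
    | @tail y z hy hyz ih =>
      replace hy : h.grid.Conn x y := hy
      refine .trans _ _ _ ih ?_
      have hz : h.grid.Conn x z := .tail hy hyz
      obtain ⟨a, ha, e | e⟩ := h.adj_cases hyz
      · refine .rel _ _ ⟨⟨y, hy, rfl⟩, ⟨z, hz, rfl⟩, ?_⟩
        rw [e, h.deg_mact a ha y (e ▸ hz.ne_zero hx), add_sub_cancel_right]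
        exact ha
      · refine .symm _ _ (.rel _ _ ⟨⟨z, hz, rfl⟩, ⟨y, hy, rfl⟩, ?_⟩)
        rw [e, h.deg_mact a ha z (e ▸ hy.ne_zero hx), add_sub_cancel_right]
        exact ha
  rintro _ ⟨y, hy, rfl⟩ _ ⟨z, hz, rfl⟩
  exact .trans _ _ _ (.symm _ _ (key y hy)) (key z hz)

variable {R' : Finset (Fin 3)} {k : Fin 3} {E : Type u} [Zero E]
  [MulActionWithZero (ConeMonoid R') E] {f : M → E}

/-- Elements of one component with nonzero images in the localization along a line have a common
nonzero multiple there. -/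
theorem IsDegree.rel_of_conn (h : IsDegree i deg) (hk : R' = {k}) {j : Fin 3} (hij : i ≠ j) (hik : i ≠ k)
    (hjk : j ≠ k) (hf : IsLocMap (chart i) R' f) {x y : M} (hxy : h.grid.Conn x y)
    (hx : f x ≠ 0) (hy : f y ≠ 0) : Rel R' (f x) (f y) (deg y - deg x) := by
  subst hk
  have hc : chart i = {j, k} := chart_eq_pair i j k hij hik hjk
  have hR : IsLocPair (chart i) {k} := hc ▸ isLocPair_pair hij hik hjk
  have hmem : ∀ {p}, 0 ≤ pairing p (ray j) → 0 ≤ pairing p (ray k) → p ∈ dualCone (chart i) := by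
    intro p h1 h2; rw [hc, mem_dualCone_pair]; exact ⟨h1, h2⟩
  have djj := pairing_mon_right i j hij
  have djk := pairing_mon_other i j k hik.symm hjk.symm
  -- The truncated differences (one of them is zero) move `x` and `y` into the same column, using
  -- only monomials that are inverted and hence do not kill the images.
  set s := (pairing (deg y) (ray j) - pairing (deg x) (ray j)).toNat • mon i j with hs
  set t := (pairing (deg x) (ray j) - pairing (deg y) (ray j)).toNat • mon i j with ht
  have inv : ∀ n : ℕ, n • mon i j ∈ inverted (chart i) {k} := by
    intro n
    rw [hc, mem_inverted_pair, pairing_nsmul, pairing_nsmul, djj, djk]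
    constructor <;> simp
  have hs' : s ∈ inverted (chart i) {k} := inv _
  have ht' : t ∈ inverted (chart i) {k} := inv _
  have hsx : f (mact (chart i) s x) ≠ 0 := by
    rwa [hf.map_mact hR hs'.1, Ne, hR.mact_eq_zero hs']
  have hty : f (mact (chart i) t y) ≠ 0 := by
    rwa [hf.map_mact hR ht'.1, Ne, hR.mact_eq_zero ht']
  have hsx0 := hf.ne_zero hsx
  have hty0 := hf.ne_zero hty
  have d1 := h.deg_mact s hs'.1 x hsx0
  have d2 := h.deg_mact t ht'.1 y hty0
  have conn : h.grid.Conn (mact (chart i) s x) (mact (chart i) t y) :=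
    ((h.grid.conn_symm (h.conn_mact hs'.1 hsx0)).trans hxy).trans (h.conn_mact ht'.1 hty0)
  have hdj : pairing (deg (mact (chart i) t y) - deg (mact (chart i) s x)) (ray j) = 0 := by
    rw [d1, d2, pairing_sub, pairing_add, pairing_add, hs, ht, pairing_nsmul, pairing_nsmul, djj]
    omega
  have key : ∀ {v w : M}, h.grid.Conn v w → f v ≠ 0 → f w ≠ 0 →
      deg w - deg v ∈ dualCone (chart i) → Rel {k} (f v) (f w) (deg w - deg v) := by
    intro v w hvw hv hw hd
    refine Rel.of_mact_eq (dualCone_mono hR.sub hd) ?_ hw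
    rw [← hf.map_mact hR hd, ← h.eq_mact hvw (hf.ne_zero hv) hd]
  have main : Rel {k} (f (mact (chart i) s x)) (f (mact (chart i) t y))
      (deg (mact (chart i) t y) - deg (mact (chart i) s x)) := by
    -- In a common column the degrees are comparable, so one of the two elements is a multiple of
    -- the other already in `M`.
    by_cases hle : 0 ≤ pairing (deg (mact (chart i) t y) - deg (mact (chart i) s x)) (ray k)
    · exact key conn hsx hty (hmem hdj.ge hle)
    · have := (key (h.grid.conn_symm conn) hty hsx (by
        rw [← neg_sub]
        apply hmem <;> rw [pairing_neg] <;> omega)).symm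
      rwa [neg_sub] at this
  have r1 : Rel {k} (f x) (f (mact (chart i) s x)) s :=
    .of_mact_eq (hR.mem hs') (hf.map_mact hR hs'.1 x).symm hsx
  have r2 : Rel {k} (f y) (f (mact (chart i) t y)) t :=
    .of_mact_eq (hR.mem ht') (hf.map_mact hR ht'.1 y).symm hty
  have := (r1.trans rfl main).trans rfl r2.symm
  rw [d1, d2] at this
  convert this using 1
  abel

/-- After clearing denominators the common multiple exists in `M`, so a relation in the localization
determines both the component and the difference of degrees. -/
theorem IsDegree.conn_of_rel (h : IsDegree i deg) (hR : IsLocPair (chart i) R')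
    (hf : IsLocMap (chart i) R' f) {x y : M} {d : ℤ × ℤ} (hd : Rel R' (f x) (f y) d) :
    h.grid.Conn x y ∧ d = deg y - deg x := by
  obtain ⟨a, ha, b, hb, e, h0, rfl⟩ := hd
  obtain ⟨t, k1, k2, k3, k4⟩ := hf.lift_eq hR ha hb e h0
  obtain ⟨c1, c2⟩ := h.conn_of_mact_eq k1 k2 k3 k4
  exact ⟨c1, by rw [← c2]; abel⟩

/-- The image of `y` vanishes exactly when some inverted monomial kills `y`, that is, when some
translate of its degree by such a monomial leaves the shape. -/
theorem IsDegree.mem_localize_self (h : IsDegree i deg) (hR : IsLocPair (chart i) R')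
    (hf : IsLocMap (chart i) R' f) {x y : M} (hxy : h.grid.Conn x y) (hx : x ≠ 0) :
    deg y ∈ localize (chart i) R' (h.shape x) ↔ f y ≠ 0 := by
  rw [mem_localize_iff (h.isSkewShape hx).2 ⟨y, hxy, rfl⟩, Ne, hf.eq_zero_iff hR]
  push Not
  refine forall₂_congr fun b hb => ?_
  constructor
  · rintro ⟨z, hz, e⟩
    have := h.eq_mact ((h.grid.conn_symm hxy).trans hz) (hxy.ne_zero hx)
      (by rw [e, add_sub_cancel_left]; exact hb.1)
    rw [e, add_sub_cancel_left] at this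
    rw [← this]
    exact hz.ne_zero hx
  · intro h0
    exact ⟨_, hxy.trans (h.conn_mact hb.1 h0), by rw [h.deg_mact b hb.1 y h0, add_comm]⟩

/-- The localization of the shape of a component describes its image in the localization of the
module. -/
theorem IsDegree.mem_localize (h : IsDegree i deg) (hk : R' = {k}) (hR : IsLocPair (chart i) R')
    (hf : IsLocMap (chart i) R' f) {x : M} (hx : x ≠ 0) (p : ℤ × ℤ) :
    p ∈ localize (chart i) R' (h.shape x) ↔
      ∃ y, h.grid.Conn x y ∧ ∃ n, Rel R' (f y) n (p - deg y) := by
  constructor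
  · rintro ⟨a, ha, hp⟩
    obtain ⟨y, hy, e⟩ := hp 0 (zero_mem_inverted _ _)
    rw [add_zero] at e
    have hl : deg y ∈ localize (chart i) R' (h.shape x) := by
      rw [mem_localize_iff (h.isSkewShape hx).2 ⟨y, hy, rfl⟩, e]; exact hp
    rw [h.mem_localize_self hR hf hy hx] at hl
    -- The lattice point `p` is realized by the fraction of `y` by the monomial `a`, whose degree is
    -- `deg y - a`.
    refine ⟨y, hy, mact R' (-a) (f y), ?_⟩
    have := (Rel.of_mact_eq (hR.mem ha) (hR.mact_neg ha (f y)) hl).symm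
    rw [e]
    convert this using 1
    abel
  · rintro ⟨y, hy, n, hn⟩
    obtain ⟨a, ha, z, e⟩ := hf.exists_eq n
    have hn0 := hn.ne_right
    have hz : f z ≠ 0 := by rwa [← e, Ne, hR.mact_eq_zero ha]
    obtain ⟨c1, c2⟩ := h.conn_of_rel hR hf (hn.trans hk (.of_mact_eq (hR.mem ha) e hz))
    have c3 := hy.trans c1
    have c4 : deg z = p + a := by
      have : deg z = p - deg y + a + deg y := by rw [c2]; abel
      rw [this]; abel
    have hl := (h.mem_localize_self hR hf c3 hx).2 hz
    rw [mem_localize_iff (h.isSkewShape hx).2 ⟨z, c3, rfl⟩, c4] at hl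
    exact ⟨a, ha, hl⟩

end Chart

/-! ### Components of a T-sheaf and the links between them -/

namespace Sheaf

variable {F : Sheaf.{u}}

/-- A coherent T-sheaf with chosen degrees on its three modules. -/
structure Degrees (F : Sheaf.{u}) where
  deg : ∀ i, F.M i → ℤ × ℤ
  isDegree : ∀ i, IsDegree i (deg i)
  fg : ∀ i, ModFG (chart i) (F.M i)

theorem IsTSheaf.nonempty_degrees (h : F.IsTSheaf) : Nonempty F.Degrees := by
  obtain ⟨h1, -, -, h4, h5⟩ := h
  choose deg hdeg using h5
  refine ⟨⟨fun i x => deg i x, fun i => ⟨h1 i, fun x => (deg i x).2, fun a ha x h0 => ?_⟩, h4⟩⟩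
  rw [mact_of_mem ha] at h0 ⊢
  exact congrArg Subtype.val (hdeg i a ha x h0)

namespace Degrees

variable (D : F.Degrees)

/-- Elements of a chart joined by a zigzag. -/
abbrev Conn {i : Fin 3} (x y : F.M i) : Prop := (D.isDegree i).grid.Conn x y

/-- The components of the modules over the three charts. -/
def Comp : Type u := Σ i, {c : Set (F.M i) // ∃ x, x ≠ 0 ∧ c = {y | D.Conn x y}}

/-- The component of a nonzero element. -/
def cls {i : Fin 3} {x : F.M i} (hx : x ≠ 0) : D.Comp := ⟨i, {y | D.Conn x y}, x, hx, rfl⟩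

theorem cls_eq_iff {i : Fin 3} {x y : F.M i} (hx : x ≠ 0) (hy : y ≠ 0) :
    D.cls hx = D.cls hy ↔ D.Conn x y := by
  constructor
  · intro h
    have h1 : {z | D.Conn x z} = {z | D.Conn y z} := congrArg Subtype.val (eq_of_heq (Sigma.mk.inj h).2)
    have : y ∈ {z | D.Conn x z} := by rw [h1]; exact .refl
    exact this
  · intro h
    have h1 : {z | D.Conn x z} = {z | D.Conn y z} := by
      ext z
      exact ⟨fun hz => ((D.isDegree i).grid.conn_symm h).trans hz, fun hz => h.trans hz⟩
    unfold cls
    congr 1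
    exact Subtype.ext h1

theorem exists_rep (v : D.Comp) : ∃ i, ∃ x : F.M i, ∃ hx : x ≠ 0, D.cls hx = v := by
  obtain ⟨i, c, x, hx, rfl⟩ := v
  exact ⟨i, x, hx, rfl⟩

/-- The chart of a component. -/
def node (v : D.Comp) : Fin 3 := v.1

/-- The skew shape of a component. -/
def shape (v : D.Comp) : Set (ℤ × ℤ) := {p | ∃ y ∈ v.2.1, D.deg v.1 y = p}

theorem cls_mact {i : Fin 3} {x : F.M i} {a : ℤ × ℤ} (ha : a ∈ dualCone (chart i))
    (h0 : mact (chart i) a x ≠ 0) : D.cls h0 = D.cls (ne_of_mact_ne h0) :=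
  (D.cls_eq_iff _ _).2 ((D.isDegree i).grid.conn_symm ((D.isDegree i).conn_mact ha h0))

theorem exists_type (v : D.Comp) : ∃ a b, IsConnShape (D.node v) (D.shape v) a b := by
  obtain ⟨i, x, hx, rfl⟩ := D.exists_rep v
  exact exists_isConnShape ((D.isDegree i).isSkewShape hx) ((D.isDegree i).isConn hx)

/-- The elements of a component are determined by their degrees. -/
theorem eq_of_deg {i : Fin 3} {x y : F.M i} (hxy : D.Conn x y) (hx : x ≠ 0)
    (h : D.deg i x = D.deg i y) : x = y := by
  have e := (D.isDegree i).eq_mact hxy hx (by rw [h, sub_self]; exact zero_mem _)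
  rw [h, sub_self, zero_mact] at e
  exact e.symm

/-- Every nonzero element is a multiple of a generator and so lies in the component of that
generator. -/
instance : Finite D.Comp := by
  choose g hg using D.fg
  have : Finite {p : Σ i, {x : F.M i // x ∈ g i} // p.2.1 ≠ 0} := inferInstance
  refine Finite.of_surjective (fun p : {p : Σ i, {x : F.M i // x ∈ g i} // p.2.1 ≠ 0} =>
    D.cls p.2) fun v => ?_
  obtain ⟨i, x, hx, rfl⟩ := D.exists_rep v
  obtain ⟨c, y, hy, rfl⟩ := hg i x
  rcases smul_eq_mact (M := F.M i) c with hc | ⟨a, ha, hc⟩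
  · exact absurd (hc y) hx
  · have hx' := hx
    rw [hc] at hx'
    refine ⟨⟨⟨i, y, hy⟩, ne_of_mact_ne hx'⟩, ?_⟩
    rw [cls_eq_iff, hc]
    exact (D.isDegree i).conn_mact ha hx'

/-- The component `w` is glued to the component `v`, a box `p` of the former corresponding to the
box `p + s` of the latter. -/
def Link (v w : D.Comp) (s : ℤ × ℤ) : Prop :=
  ∃ i, ∃ m : F.M i, ∃ hm : m ≠ 0, ∃ m' : F.M (i + 1), ∃ hm' : m' ≠ 0, ∃ d,
    D.cls hm = v ∧ D.cls hm' = w ∧ Rel (edge i) (F.resL i m) (F.resR i m') d ∧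
    s = D.deg i m + d - D.deg (i + 1) m'

variable {D}

theorem Link.of_rel {i : Fin 3} {m : F.M i} {m' : F.M (i + 1)} {d : ℤ × ℤ}
    (h : Rel (edge i) (F.resL i m) (F.resR i m') d) :
    D.Link (D.cls ((F.locL i).ne_zero h.ne_left)) (D.cls ((F.locR i).ne_zero h.ne_right))
      (D.deg i m + d - D.deg (i + 1) m') :=
  ⟨i, m, _, m', _, d, rfl, rfl, h, rfl⟩

theorem Link.node_eq {v w : D.Comp} {s : ℤ × ℤ} (h : D.Link v w s) :
    D.node w = D.node v + 1 := by
  obtain ⟨i, m, hm, m', hm', d, rfl, rfl, h, rfl⟩ := h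
  rfl

theorem rel_resL {i : Fin 3} {x y : F.M i} (h : D.Conn x y) (hx : F.resL i x ≠ 0)
    (hy : F.resL i y ≠ 0) :
    Rel (edge i) (F.resL i x) (F.resL i y) (D.deg i y - D.deg i x) :=
  (D.isDegree i).rel_of_conn (edge_eq i) (ne_one i) (ne_two i) (one_ne_two i) (F.locL i) h hx hy

theorem rel_resR {i : Fin 3} {x y : F.M (i + 1)} (h : D.Conn x y) (hx : F.resR i x ≠ 0)
    (hy : F.resR i y ≠ 0) :
    Rel (edge i) (F.resR i x) (F.resR i y) (D.deg (i + 1) y - D.deg (i + 1) x) :=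
  (D.isDegree (i + 1)).rel_of_conn (edge_eq i) (ne_one i).symm (one_ne_two i) (ne_two i)
    (F.locR i) h hx hy

/-- Relations over the intersection compose, so passing from `v` through `w` to `v'` relates
restrictions of two elements of one chart. Such a relation forces the components to be equal and its
exponent to be the difference of degrees, which gives equality of the shifts. -/
theorem Link.left_unique {v v' w : D.Comp} {s s' : ℤ × ℤ} (h : D.Link v w s)
    (h' : D.Link v' w s') : v = v' ∧ s = s' := by
  obtain ⟨i, m, hm, m', hm', d, rfl, rfl, h, rfl⟩ := h
  obtain ⟨j, n, hn, n', hn', e, rfl, hw, h', rfl⟩ := h'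
  obtain rfl : j = i := add_right_cancel (congrArg Sigma.fst hw)
  have c := (D.cls_eq_iff _ _).1 hw
  have r := (h.trans (edge_eq j) (rel_resR ((D.isDegree _).grid.conn_symm c) h.ne_right
    h'.ne_right)).trans (edge_eq j) h'.symm
  obtain ⟨c1, c2⟩ := (D.isDegree j).conn_of_rel (isLocPair_out j) (F.locL j) r
  refine ⟨(D.cls_eq_iff _ _).2 c1, ?_⟩
  have : D.deg j n = d + (D.deg (j + 1) n' - D.deg (j + 1) m') + -e + D.deg j m := by
    rw [c2]; abel
  rw [this]; abel

theorem Link.right_unique {v w w' : D.Comp} {s s' : ℤ × ℤ} (h : D.Link v w s)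
    (h' : D.Link v w' s') : w = w' := by
  obtain ⟨i, m, hm, m', hm', d, rfl, rfl, h, rfl⟩ := h
  obtain ⟨j, n, hn, n', hn', e, hv, rfl, h', rfl⟩ := h'
  obtain rfl : j = i := congrArg Sigma.fst hv
  have c := (D.cls_eq_iff _ _).1 hv
  have r := (h.symm.trans (edge_eq j) (rel_resL ((D.isDegree _).grid.conn_symm c) h.ne_left
    h'.ne_left)).trans (edge_eq j) h'
  exact (D.cls_eq_iff _ _).2
    ((D.isDegree (j + 1)).conn_of_rel (isLocPair_in j) (F.locR j) r).1

theorem mem_outEnd {i : Fin 3} {x : F.M i} (hx : x ≠ 0) (p : ℤ × ℤ) :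
    p ∈ outEnd i (D.shape (D.cls hx)) ↔
      ∃ y, D.Conn x y ∧ ∃ n, Rel (edge i) (F.resL i y) n (p - D.deg i y) :=
  (D.isDegree i).mem_localize (edge_eq i) (isLocPair_out i) (F.locL i) hx p

theorem mem_inEnd {i : Fin 3} {x : F.M (i + 1)} (hx : x ≠ 0) (p : ℤ × ℤ) :
    p ∈ inEnd (i + 1) (D.shape (D.cls hx)) ↔
      ∃ y, D.Conn x y ∧ ∃ n, Rel (edge i) (F.resR i y) n (p - D.deg (i + 1) y) := by
  rw [inEnd, one_add_two]
  exact (D.isDegree (i + 1)).mem_localize (edge_eq i) (isLocPair_in i) (F.locR i) hx p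

theorem deg_mem_outEnd {i : Fin 3} {x : F.M i} (hx : x ≠ 0) :
    D.deg i x ∈ outEnd i (D.shape (D.cls hx)) ↔ F.resL i x ≠ 0 :=
  (D.isDegree i).mem_localize_self (isLocPair_out i) (F.locL i) .refl hx

theorem deg_mem_inEnd {i : Fin 3} {x : F.M (i + 1)} (hx : x ≠ 0) :
    D.deg (i + 1) x ∈ inEnd (i + 1) (D.shape (D.cls hx)) ↔ F.resR i x ≠ 0 := by
  rw [inEnd, one_add_two]
  exact (D.isDegree (i + 1)).mem_localize_self (isLocPair_in i) (F.locR i) .refl hx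

/-- The two localizations consist of the same sections over the intersection; composing with the
relation of the link only changes the reference degree, by `s`. -/
theorem Link.mem_ends {v w : D.Comp} {s : ℤ × ℤ} (h : D.Link v w s) (p : ℤ × ℤ) :
    p ∈ inEnd (D.node w) (D.shape w) ↔ p + s ∈ outEnd (D.node v) (D.shape v) := by
  obtain ⟨i, m, hm, m', hm', d, rfl, rfl, h, rfl⟩ := h
  refine (mem_inEnd hm' p).trans (Iff.trans ?_ (mem_outEnd hm _).symm)
  constructor
  · rintro ⟨y, hy, n, hn⟩
    refine ⟨m, .refl, n, ?_⟩
    have := (h.trans (edge_eq i) (rel_resR hy h.ne_right hn.ne_left)).trans (edge_eq i) hn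
    convert this using 1
    abel
  · rintro ⟨y, hy, n, hn⟩
    refine ⟨m', .refl, n, ?_⟩
    have := (h.symm.trans (edge_eq i) (rel_resL hy h.ne_left hn.ne_left)).trans (edge_eq i) hn
    convert this using 1
    abel

theorem Link.type_eq {v w : D.Comp} {s : ℤ × ℤ} (h : D.Link v w s) {a b a' b' : ℕ∞}
    (hv : IsConnShape (D.node v) (D.shape v) a b) (hw : IsConnShape (D.node w) (D.shape w) a' b') :
    b = a' := hv.type_eq h.node_eq hw h.mem_ends

/-- Elements with nonzero restriction to the line `l_{i,i+1}` are linked. -/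
theorem exists_rel_right {i : Fin 3} {m : F.M i} (h : F.resL i m ≠ 0) :
    ∃ m' d, Rel (edge i) (F.resL i m) (F.resR i m') d := by
  obtain ⟨a, ha, m', e⟩ := (F.locR i).exists_eq (F.resL i m)
  have hR := isLocPair_in i
  exact ⟨m', a, .of_mact_eq (hR.mem ha) e (by rwa [← e, Ne, hR.mact_eq_zero ha])⟩

theorem exists_rel_left {i : Fin 3} {m' : F.M (i + 1)} (h : F.resR i m' ≠ 0) :
    ∃ m d, Rel (edge i) (F.resL i m) (F.resR i m') d := by
  obtain ⟨a, ha, m, e⟩ := (F.locL i).exists_eq (F.resR i m')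
  have hR := isLocPair_out i
  exact ⟨m, -a, Rel.symm (.of_mact_eq (hR.mem ha) e (by rwa [← e, Ne, hR.mact_eq_zero ha]))⟩

/-- A nonzero type means that some element of the component survives on the line; up to an inverted
monomial it is also the restriction of an element of the next chart. -/
theorem exists_link_out {v : D.Comp} {a b : ℕ∞} (hv : IsConnShape (D.node v) (D.shape v) a b) :
    b ≠ 0 ↔ ∃ w s, D.Link v w s := by
  constructor
  · intro hb
    obtain ⟨i, x, hx, rfl⟩ := D.exists_rep v
    obtain ⟨_, ⟨(y : F.M i), (hy : D.Conn x y), rfl⟩, hp⟩ := hv.ne_zero_out_iff.1 hb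
    have hy0 := Grid.Conn.ne_zero hy hx
    have e := (D.cls_eq_iff hx hy0).2 hy
    have h : F.resL i y ≠ 0 := (deg_mem_outEnd hy0).1 (by rw [← e]; exact hp)
    obtain ⟨m', d, h⟩ := exists_rel_right h
    exact ⟨_, _, e ▸ Link.of_rel h⟩
  · rintro ⟨w, s, i, m, hm, m', hm', d, rfl, rfl, h, rfl⟩
    exact hv.ne_zero_out_iff.2 ⟨D.deg i m, ⟨m, .refl, rfl⟩, (deg_mem_outEnd hm).2 h.ne_left⟩

theorem exists_link_in {w : D.Comp} {a b : ℕ∞} (hw : IsConnShape (D.node w) (D.shape w) a b) :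
    a ≠ 0 ↔ ∃ v s, D.Link v w s := by
  constructor
  · intro ha
    obtain ⟨i, x, hx, rfl⟩ := D.exists_rep w
    obtain ⟨i, rfl⟩ : ∃ j, i = j + 1 := ⟨i - 1, by rw [sub_add_cancel]⟩
    obtain ⟨_, ⟨(y : F.M (i + 1)), (hy : D.Conn x y), rfl⟩, hp⟩ := hw.ne_zero_in_iff.1 ha
    have hy0 := Grid.Conn.ne_zero hy hx
    have e := (D.cls_eq_iff hx hy0).2 hy
    have h : F.resR i y ≠ 0 := (deg_mem_inEnd hy0).1 (by rw [← e]; exact hp)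
    obtain ⟨m, d, h⟩ := exists_rel_left h
    exact ⟨_, _, e ▸ Link.of_rel h⟩
  · rintro ⟨v, s, i, m, hm, m', hm', d, rfl, rfl, h, rfl⟩
    exact hw.ne_zero_in_iff.2 ⟨D.deg (i + 1) m', ⟨m', .refl, rfl⟩, (deg_mem_inEnd hm').2 h.ne_right⟩

/-- In a connected sheaf, all components are connected by links. -/
theorem forall_comp (hF : F.Connected) {P : D.Comp → Prop}
    (hP : ∀ v w s, D.Link v w s → (P v ↔ P w)) : (∀ v, P v) ∨ ∀ v, ¬ P v := by
  have sep : F.IsSep fun i m => ∃ hm : m ≠ 0, P (D.cls hm) := by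
    refine ⟨fun i a ha m h0 => ?_, fun i a ha m m' e h0 => ?_⟩
    · rw [exists_prop_of_true h0, exists_prop_of_true (ne_of_mact_ne h0), D.cls_mact ha h0]
    · have h := Rel.of_mact_eq ha e h0
      rw [exists_prop_of_true ((F.locL i).ne_zero h.ne_left),
        exists_prop_of_true ((F.locR i).ne_zero h.ne_right)]
      exact hP _ _ _ (Link.of_rel h)
  refine (hF.2 _ sep).imp (fun h v => ?_) (fun h v hv => ?_)
  · obtain ⟨i, x, hx, rfl⟩ := D.exists_rep v
    exact (h i x hx).2
  · obtain ⟨i, x, hx, rfl⟩ := D.exists_rep v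
    exact h i x hx ⟨hx, hv⟩

end Degrees

end Sheaf

/-! ## Chains and cycles -/

/-- A connected finite set with a partial injection is a chain or a cycle. -/
theorem exists_chain {V : Type u} [Finite V] [Nonempty V] {L : V → V → Prop}
    (left : ∀ {v v' w}, L v w → L v' w → v = v') (right : ∀ {v w w'}, L v w → L v w' → w = w')
    (conn : ∀ P : V → Prop, (∀ v w, L v w → (P v ↔ P w)) → (∀ v, P v) ∨ ∀ v, ¬ P v) :
    ∃ N, ∃ e : Fin (N + 1) ≃ V, (∀ r : Fin N, L (e r.castSucc) (e r.succ)) ∧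
      ((∀ v, ¬ L v (e 0)) ∧ (∀ w, ¬ L (e (Fin.last N)) w) ∨ L (e (Fin.last N)) (e 0)) := by
  by_contra hcon
  -- If no enumeration as claimed existed, every injective chain could be lengthened at one of its
  -- ends, which is impossible in a finite set.
  have main : ∀ N, ∃ s : Fin (N + 1) → V, Function.Injective s ∧
      ∀ r : Fin N, L (s r.castSucc) (s r.succ) := by
    intro N
    induction N with
    | zero =>
      obtain ⟨v⟩ := ‹Nonempty V›
      exact ⟨fun _ => v, fun a b _ => Subsingleton.elim (α := Fin 1) a b, fun r => r.elim0⟩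
    | succ N ih =>
      obtain ⟨s, inj, hs⟩ := ih
      by_cases happ : ∃ w, L (s (Fin.last N)) w ∧ w ∉ Set.range s
      · obtain ⟨w, hw, hw'⟩ := happ
        refine ⟨Fin.snoc s w, Fin.snoc_injective_iff.2 ⟨inj, hw'⟩, fun r => ?_⟩
        rw [Fin.snoc_castSucc]
        cases r using Fin.lastCases with
        | last => rw [Fin.succ_last, Fin.snoc_last]; exact hw
        | cast r => rw [Fin.succ_castSucc, Fin.snoc_castSucc]; exact hs r
      by_cases hpre : ∃ v, L v (s 0) ∧ v ∉ Set.range s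
      · obtain ⟨v, hv, hv'⟩ := hpre
        refine ⟨Fin.cons v s, Fin.cons_injective_iff.2 ⟨hv', inj⟩, fun r => ?_⟩
        rw [Fin.cons_succ]
        cases r using Fin.cases with
        | zero => rw [Fin.castSucc_zero, Fin.cons_zero]; exact hv
        | succ r => rw [← Fin.succ_castSucc, Fin.cons_succ]; exact hs r
      push Not at happ hpre
      exfalso
      apply hcon
      -- The successor of the last element lies in the chain. It must be the first element, since
      -- every other one already has its predecessor within the chain.
      have next : ∀ w, L (s (Fin.last N)) w → w = s 0 := by
        intro w hw
        obtain ⟨r, rfl⟩ := happ w hw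
        cases r using Fin.cases with
        | zero => rfl
        | succ r => exact absurd (inj (left hw (hs r))) (Fin.castSucc_lt_last r).ne'
      have prev : ∀ v, L v (s 0) → v = s (Fin.last N) := by
        intro v hv
        obtain ⟨r, rfl⟩ := hpre v hv
        cases r using Fin.lastCases with
        | last => rfl
        | cast r => exact absurd (inj (right hv (hs r))) (Fin.succ_ne_zero r).symm
      -- A chain that cannot be lengthened is closed under links in both directions, hence is
      -- everything by connectedness.
      have surj : Function.Surjective s := by
        refine (conn (fun v => v ∈ Set.range s) fun v w h => ?_).resolve_right
          fun h => h (s 0) ⟨0, rfl⟩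
        constructor
        · rintro ⟨r, rfl⟩
          cases r using Fin.lastCases with
          | last => exact ⟨0, (next w h).symm⟩
          | cast r => exact ⟨r.succ, right (hs r) h⟩
        · rintro ⟨r, rfl⟩
          cases r using Fin.cases with
          | zero => exact ⟨Fin.last N, (prev v h).symm⟩
          | succ r => exact ⟨r.castSucc, left (hs r) h⟩
      refine ⟨N, Equiv.ofBijective s ⟨inj, surj⟩, hs, ?_⟩
      change (∀ v, ¬ L v (s 0)) ∧ (∀ w, ¬ L (s (Fin.last N)) w) ∨ L (s (Fin.last N)) (s 0)
      by_cases hc : L (s (Fin.last N)) (s 0)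
      · exact .inr hc
      · exact .inl ⟨fun v hv => hc (prev v hv ▸ hv), fun w hw => hc (next w hw ▸ hw)⟩
  obtain ⟨s, inj, -⟩ := main (Nat.card V)
  have := Nat.card_le_card_of_injective s inj
  rw [Nat.card_eq_fintype_card, Fintype.card_fin] at this
  omega

/-! ## Sheaves glued from their components -/

theorem ShapeFamily.mact_box {R : Finset (Fin 3)} (F : ShapeFamily R) {a : ℤ × ℤ}
    (ha : a ∈ dualCone R) {v : F.ι} {p : ℤ × ℤ} (h : p ∈ F.T v) :
    mact R a (F.box v p) = F.box v (p + a) := by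
  rw [mact_of_mem ha, F.mono_smul, F.act_box h]

namespace Sheaf.Degrees

variable {F : Sheaf.{u}} (D : F.Degrees)

/-- A sheaf whose components and links are those of gluing data is isomorphic to the glued
sheaf. -/
theorem iso_gluing (G : Gluing) (e : G.V ≃ D.Comp) (hn : ∀ v, D.node (e v) = G.node v)
    (hS : ∀ v, D.shape (e v) = G.S v)
    (hprev : ∀ v w, G.prev w = some v → D.Link (e v) (e w) (G.shift w))
    (hlink : ∀ v w s, D.Link (e v) (e w) s → G.prev w = some v) : F.Iso G.sheaf := by
  classical
  have hmem : ∀ {i} {x : F.M i} (hx : x ≠ 0), D.deg i x ∈ (G.famM i).T (e.symm (D.cls hx)) := by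
    intro i x hx
    refine ⟨?_, ?_⟩
    · rw [← hn, e.apply_symm_apply]; rfl
    · rw [← hS, e.apply_symm_apply]; exact ⟨x, .refl, rfl⟩
  -- An element is sent to the box of its component at its degree. This is injective because degrees
  -- separate the elements of a component.
  let f : ∀ i, F.M i → (G.famM i).Mod := fun i x =>
    if hx : x ≠ 0 then (G.famM i).box (e.symm (D.cls hx)) (D.deg i x) else 0
  have f0 : ∀ i, f i 0 = 0 := fun i => dif_neg (not_not.2 rfl)
  have f1 : ∀ {i} {x : F.M i} (hx : x ≠ 0),
      f i x = (G.famM i).box (e.symm (D.cls hx)) (D.deg i x) := fun hx => dif_pos hx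
  have fne : ∀ {i} {x : F.M i}, x ≠ 0 → f i x ≠ 0 := by
    intro i x hx
    rw [f1 hx]; exact ShapeFamily.box_ne_zero _ (hmem hx)
  have inj : ∀ i, Function.Injective (f i) := by
    intro i x y h
    by_cases hx : x = 0
    · by_contra hne
      exact fne (x := y) (by rintro rfl; exact hne hx) (by rw [← h, hx, f0])
    · by_cases hy : y = 0
      · exact absurd (h.trans (by rw [hy, f0])) (fne hx)
      · rw [f1 hx, f1 hy] at h
        obtain ⟨h1, h2⟩ := ShapeFamily.box_inj _ (hmem hx) h
        exact D.eq_of_deg ((D.cls_eq_iff hx hy).1 (e.symm.injective h1)) hx h2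
  have surj : ∀ i, Function.Surjective (f i) := by
    intro i z
    rcases ShapeFamily.cases_box _ z with rfl | ⟨(v : G.V), p, ⟨hi, hp⟩, rfl⟩
    · exact ⟨0, f0 i⟩
    · obtain ⟨j, x, hx, hv⟩ := D.exists_rep (e v)
      obtain rfl : j = i := by
        rw [← hi, ← hn v, ← hv]; rfl
      replace hp : p ∈ G.S v := hp
      rw [← hS, ← hv] at hp
      obtain ⟨(y : F.M j), (hy : D.Conn x y), rfl⟩ := hp
      have hy0 := Grid.Conn.ne_zero hy hx
      refine ⟨y, ?_⟩
      have hv' : e.symm (D.cls hy0) = v := by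
        rw [← (D.cls_eq_iff hx hy0).2 hy, hv, e.symm_apply_apply]
      rw [f1 hy0, hv']
      rfl
  have fact : ∀ i, ∀ a ∈ dualCone (chart i), ∀ x,
      f i (mact (chart i) a x) = mact (chart i) a (f i x) := by
    intro i a ha x
    by_cases hx : x = 0
    · rw [hx, mact_zero_right, f0, mact_zero_right]
    rw [f1 hx, ShapeFamily.mact_box _ ha (hmem hx)]
    by_cases h0 : mact (chart i) a x = 0
    · rw [h0, f0]
      refine (ShapeFamily.box_of_not_mem _ ?_).symm
      rintro ⟨-, h⟩
      rw [← hS, e.apply_symm_apply] at h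
      obtain ⟨(y : F.M i), (hy : D.Conn x y), h2⟩ := h
      have h3 : D.deg i y = D.deg i x + a := h2
      have := (D.isDegree i).eq_mact hy hx (by rw [h3, add_sub_cancel_left]; exact ha)
      rw [h3, add_sub_cancel_left, h0] at this
      exact hy.ne_zero hx this
    · rw [f1 h0, D.cls_mact ha h0, (D.isDegree i).deg_mact a ha x h0, add_comm]
  refine iso_of_charts (F' := G.sheaf) (fun i => Equiv.ofBijective (f i) ⟨inj i, surj i⟩) f0 fact
    fun i m' h0 => ?_
  obtain ⟨a, ha, m, h1⟩ := (F.locL i).exists_eq (F.resR i m')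
  have h2 : mact (edge i) (-a) (F.resL i m) = F.resR i m' := by
    rw [← h1, (isLocPair_out i).neg_mact ha]
  refine ⟨-a, ha.2, m, h2, ?_⟩
  have hr := Rel.of_mact_eq ha.2 h2 h0
  have hm := (F.locL i).ne_zero hr.ne_left
  have hm' := (F.locR i).ne_zero hr.ne_right
  have link := Link.of_rel (D := D) hr
  have hp : G.prev (e.symm (D.cls hm')) = some (e.symm (D.cls hm)) := by
    apply hlink _ _ _
    rw [e.apply_symm_apply, e.apply_symm_apply]
    exact link
  -- The translation of a link is unique, so the prescribed shift equals the one computed from the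
  -- pair `m`, `m'`.
  have hs : G.shift (e.symm (D.cls hm')) = D.deg i m + -a - D.deg (i + 1) m' := by
    have := hprev _ _ hp
    rw [e.apply_symm_apply, e.apply_symm_apply] at this
    exact (this.left_unique link).2
  have hE : D.deg i m ∈ (G.famE i).T (e.symm (D.cls hm)) := by
    refine ⟨(hmem hm).1, ?_⟩
    rw [← hn, ← hS, e.apply_symm_apply]
    exact (deg_mem_outEnd hm).2 hr.ne_left
  have eL : G.sheaf.resL i (f i m) = (G.famE i).box (e.symm (D.cls hm)) (D.deg i m) := by
    rw [f1 hm]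
    refine (ShapeFamily.mapMod_some (G.famM i) (G.famE i) some 0 (hmem hm) rfl).trans ?_
    exact congrArg _ (add_zero _)
  have eR : G.sheaf.resR i (f (i + 1) m') = (G.famE i).box (e.symm (D.cls hm))
      (D.deg (i + 1) m' + G.shift (e.symm (D.cls hm'))) := by
    rw [f1 hm']
    exact ShapeFamily.mapMod_some (G.famM (i + 1)) (G.famE i) G.prev G.shift (hmem hm') hp
  change mact (edge i) (-a) (G.sheaf.resL i (f i m)) = G.sheaf.resR i (f (i + 1) m')
  rw [eL, eR, hs, add_sub_cancel]
  exact ShapeFamily.mact_box _ ha.2 hE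

end Sheaf.Degrees

/-- Every identification of the ends of two shapes is a gluing of some degree. -/
theorem exists_glueShift {i i' : Fin 3} (hi : i' = i + 1) {T T' : Set (ℤ × ℤ)} {a : ℕ∞} {b : ℕ}
    {c : ℕ∞} (hb : 0 < b) (h : IsConnShape i T a b) (h' : IsConnShape i' T' b c) {g g' : ℤ × ℤ}
    (hg : IsEdgeGen i (i + 1) (i + 2) T g) (hg' : IsEdgeGen i' (i' + 2) (i' + 1) T' g')
    {s : ℤ × ℤ} (hs : ∀ p, p ∈ inEnd i' T' ↔ p + s ∈ outEnd i T) : ∃ n, glueShift i g g' n = s := by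
  subst hi
  have hm := h.mem_outEnd hg
  have hm' := h'.mem_inEnd hg'
  rw [one_add_one] at hm'
  -- Since the strips have positive width, their bottom rows are nonempty. Comparing them in both
  -- directions shows that `s` carries the row of `g'` to the row of `g`; only the displacement
  -- along the line is left, and that is `n`.
  have k1 := (hm _).1 ((hs g').1 ((hm' g').2 (by omega)))
  have k2 := (hm' (g - s)).1 ((hs _).2 (by rw [sub_add_cancel, hm]; omega))
  rw [pairing_add] at k1
  rw [pairing_sub] at k2
  refine ⟨pairing (s - g + g') (ray (i + 1)), ?_⟩
  unfold glueShift
  apply pairing_ext (one_ne_two i) <;>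
    rw [pairing_add, pairing_sub, pairing_zsmul]
  · rw [pairing_mon_right i _ (ne_one i), pairing_add, pairing_sub]; ring
  · rw [pairing_mon_other _ _ _ (ne_two i).symm (one_ne_two i).symm]; omega

/-! ### Sheaves all of whose shapes have finite types -/

namespace Sheaf.Degrees

variable {F : Sheaf.{u}} {D : F.Degrees}

/-- A connected T-sheaf all of whose shapes have finite types is a point sheaf, a helix or a
cycle. -/
theorem listed_of_finite (hF : F.Connected) {tIn tOut : D.Comp → ℕ}
    (ht : ∀ v, IsConnShape (D.node v) (D.shape v) (tIn v) (tOut v)) : F.IsListed := by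
  have : Nonempty D.Comp := by
    obtain ⟨i, m, hm⟩ := hF.1
    exact ⟨D.cls hm⟩
  obtain ⟨N, e, hL, hends⟩ := exists_chain (L := fun v w => ∃ s, D.Link v w s)
    (fun ⟨s, h⟩ ⟨s', h'⟩ => (h.left_unique h').1) (fun ⟨s, h⟩ ⟨s', h'⟩ => h.right_unique h')
    (fun P hP => forall_comp hF fun v w s h => hP v w ⟨s, h⟩)
  set i := D.node (e 0) with hi
  have hn : ∀ r : Fin (N + 1), D.node (e r) = nodeAt i r := by
    intro r
    induction r using Fin.induction with
    | zero => rw [← hi]; unfold nodeAt; simp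
    | succ r ih =>
      obtain ⟨s, h⟩ := hL r
      rw [h.node_eq, ih, Fin.val_succ, nodeAt_succ]; rfl
  have hsh : ∀ r : Fin (N + 1), IsConnShape (nodeAt i r) (D.shape (e r)) (tIn (e r)) (tOut (e r)) :=
    fun r => by rw [← hn]; exact ht (e r)
  have hpos : ∀ v, 0 < tOut v ↔ ∃ w s, D.Link v w s := by
    intro v
    rw [← exists_link_out (ht v), Nat.pos_iff_ne_zero]
    exact_mod_cast Iff.rfl
  have hpos' : ∀ v, 0 < tIn v ↔ ∃ w s, D.Link w v s := by
    intro v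
    rw [← exists_link_in (ht v), Nat.pos_iff_ne_zero]
    exact_mod_cast Iff.rfl
  have hmatch : ∀ {v w s}, D.Link v w s → tOut v = tIn w := by
    intro v w s h
    exact_mod_cast h.type_eq (ht v) (ht w)
  have gen : ∀ r, 0 < tOut (e r) →
      ∃ g, IsEdgeGen (nodeAt i r) (nodeAt i r + 1) (nodeAt i r + 2) (D.shape (e r)) g :=
    fun r h => (hsh r).exists_gen_out (by exact_mod_cast h.ne')
  have gen' : ∀ r, 0 < tIn (e r) →
      ∃ g, IsEdgeGen (nodeAt i r) (nodeAt i r + 2) (nodeAt i r + 1) (D.shape (e r)) g :=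
    fun r h => (hsh r).exists_gen_in (by exact_mod_cast h.ne')
  have ends : ∀ {v w : Fin (N + 1)} {s}, D.Link (e v) (e w) s → ∀ p,
      p ∈ inEnd (nodeAt i w) (D.shape (e w)) ↔ p + s ∈ outEnd (nodeAt i v) (D.shape (e v)) := by
    intro v w s h
    rw [← hn, ← hn]; exact h.mem_ends
  have nodes : ∀ {v w : Fin (N + 1)} {s}, D.Link (e v) (e w) s →
      nodeAt i w = nodeAt i v + 1 := by
    intro v w s h
    rw [← hn, ← hn]; exact h.node_eq
  have shifts : ∀ {v w : Fin (N + 1)} {s g h}, D.Link (e v) (e w) s →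
      IsEdgeGen (nodeAt i v) (nodeAt i v + 1) (nodeAt i v + 2) (D.shape (e v)) g →
      IsEdgeGen (nodeAt i w) (nodeAt i w + 2) (nodeAt i w + 1) (D.shape (e w)) h →
      ∃ n, glueShift (nodeAt i v) g h n = s := by
    intro v w s g h l hg hh
    refine exists_glueShift (c := tOut (e w)) (nodes l) ((hpos _).2 ⟨_, _, l⟩) (hsh v) ?_ hg hh (ends l)
    rw [hmatch l]; exact hsh w
  choose s hs using hL
  rcases hends with ⟨h0, h1⟩ | ⟨s0, hs0⟩
  · have first : tIn (e 0) = 0 := by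
      by_contra h
      obtain ⟨w, s, h⟩ := (hpos' _).1 (Nat.pos_of_ne_zero h)
      exact h0 w ⟨s, h⟩
    have last : tOut (e (Fin.last N)) = 0 := by
      by_contra h
      obtain ⟨w, s, h⟩ := (hpos _).1 (Nat.pos_of_ne_zero h)
      exact h1 w ⟨s, h⟩
    -- An open chain with a single shape has no links, so both of its types vanish; longer open
    -- chains are helices.
    rcases Nat.eq_zero_or_pos N with rfl | hN
    · left
      refine ⟨⟨i, D.shape (e 0), ?_⟩, ?_⟩
      · have := ht (e 0)
        rwa [first, show tOut (e 0) = 0 from last] at this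
      · refine D.iso_gluing _ ((Equiv.ofUnique Unit (Fin 1)).trans e) (fun v => ?_) (fun v => ?_)
          (fun v w h => ?_) (fun v w s h => ?_)
        · rfl
        · rfl
        · cases h
        · exact (h0 _ ⟨s, h⟩).elim
    · right; left
      have pos : ∀ r : Fin N, 0 < tOut (e r.castSucc) := fun r => (hpos _).2 ⟨_, _, hs r⟩
      have pos' : ∀ r : Fin N, 0 < tIn (e r.succ) := fun r => (hpos' _).2 ⟨_, _, hs r⟩
      choose g hg using fun r : Fin N => gen r.castSucc (pos r)
      choose h hh using fun r : Fin N => gen' r.succ (pos' r)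
      choose n hsn using fun r : Fin N => shifts (hs r) (hg r) (hh r)
      refine ⟨⟨i, N, fun r => D.shape (e r), fun r => tIn (e r), fun r => tOut (e r), n, hN, hsh,
        first, last, pos, fun r => hmatch (hs r), g, h, hg, hh⟩, ?_⟩
      refine D.iso_gluing _ e hn (fun _ => rfl) (fun v w hw => ?_) (fun v w t hw => ?_)
      · cases w using Fin.cases with
        | zero => cases hw
        | succ r =>
          change some r.castSucc = some v at hw
          obtain rfl := Option.some.inj hw
          change D.Link _ _ (glueShift _ _ _ _)
          rw [hsn]
          exact hs r
      · cases w using Fin.cases with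
        | zero => exact (h0 _ ⟨t, hw⟩).elim
        | succ r =>
          change some r.castSucc = some v
          rw [e.injective ((hs r).left_unique hw).1]
  · right; right; left
    have hlink : ∀ w, ∃ t, D.Link (e (w - 1)) (e w) t := by
      intro w
      cases w using Fin.cases with
      | zero =>
        refine ⟨s0, ?_⟩
        rwa [show (0 : Fin (N + 1)) - 1 = Fin.last N by
          rw [sub_eq_iff_eq_add, Fin.last_add_one]]
      | succ r =>
        refine ⟨s r, ?_⟩
        rw [show r.succ - 1 = r.castSucc by rw [sub_eq_iff_eq_add, Fin.coeSucc_eq_succ]]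
        exact hs r
    choose t ht' using hlink
    have hlink' : ∀ r, D.Link (e r) (e (r + 1)) (t (r + 1)) := by
      intro r
      have := ht' (r + 1)
      rwa [add_sub_cancel_right] at this
    -- Each link advances the chart by one and the closing link returns to the initial chart. In
    -- particular a component is never linked to itself.
    have dvd : 3 ∣ N + 1 := by
      have h1 : nodeAt i 0 = nodeAt i (N + 1) := by
        have := nodes hs0
        rw [Fin.val_zero, Fin.val_last] at this
        rw [this, nodeAt_succ]
      have h2 : Fin.ofNat 3 0 = Fin.ofNat 3 (N + 1) := add_left_cancel h1
      have h3 := congrArg Fin.val h2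
      simp only [Fin.ofNat] at h3
      omega
    have pos : ∀ r, 0 < tOut (e r) := fun r => (hpos _).2 ⟨_, _, hlink' r⟩
    have pos' : ∀ r, 0 < tIn (e r) := fun r => (hpos' _).2 ⟨_, _, ht' r⟩
    choose g hg using fun r => gen r (pos r)
    choose h hh using fun r => gen' r (pos' r)
    choose n hsn using fun r => shifts (hlink' r) (hg r) (hh (r + 1))
    refine ⟨⟨i, N, dvd, fun r => D.shape (e r), fun r => tIn (e r), fun r => tOut (e r), n, hsh,
      pos, fun r => hmatch (hlink' r), g, h, hg, hh⟩, ?_⟩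
    refine D.iso_gluing _ e hn (fun _ => rfl) (fun v w hw => ?_) (fun v w t hw => ?_)
    · obtain rfl := Option.some.inj hw
      change D.Link _ _ (glueShift _ _ _ _)
      have := hsn (w - 1)
      rw [sub_add_cancel] at this
      change D.Link _ _ (glueShift (nodeAt i (w - 1 : Fin (N + 1))) (g (w - 1)) (h w) (n (w - 1)))
      rw [this]
      exact ht' w
    · change some (w - 1) = some v
      rw [e.injective ((ht' w).left_unique hw).1]

end Sheaf.Degrees

/-! ## Torsion-free sheaves -/

/-- A shape of infinite type contains a quadrant, hence a box beyond `p + q` in both coordinates;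
convexity between `p` and that box gives the claim. -/
theorem IsConnShape.add_mem {i : Fin 3} {T : Set (ℤ × ℤ)} {a : ℕ∞} (h : IsConnShape i T a ⊤)
    {p q : ℤ × ℤ} (hp : p ∈ T) (hq : q ∈ dualCone (chart i)) : p + q ∈ T := by
  obtain ⟨g, -, hg⟩ := h.exists_bottom_out (by simp)
  obtain ⟨r, hr1, hr2⟩ := exists_point (ne_one i) (ne_two i) (one_ne_two i)
    (max (pairing g (ray (i + 1))) (pairing (p + q) (ray (i + 1))))
    (max (pairing g (ray (i + 2))) (pairing (p + q) (ray (i + 2))))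
  have hc := h.skew.2
  rw [chart_eq, mem_dualCone_pair] at hq
  rw [chart_eq] at hc
  refine mem_of_between hc hp (hg rfl r (by omega) (by omega)) ?_ ?_ (by omega) (by omega) <;>
    rw [pairing_add] <;> omega

theorem exists_isCorner {i : Fin 3} {T : Set (ℤ × ℤ)} (hT : T ⊆ dualCone (chart i))
    (hne : T.Nonempty) : ∃ g, IsCorner i T g := by
  have key : ∀ j ∈ chart i, ∃ p ∈ T, ∀ q ∈ T, pairing p (ray j) ≤ pairing q (ray j) := by
    intro j hj
    obtain ⟨p, hp, h⟩ := exists_minimalFor_of_wellFoundedLT (· ∈ T)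
      (fun p => (pairing p (ray j)).toNat) hne
    refine ⟨p, hp, fun q hq => ?_⟩
    have h1 := hT hq j hj
    have h2 := hT hp j hj
    have := @h q hq
    simp only at this
    omega
  rw [chart_eq] at key
  obtain ⟨p, hp, h1⟩ := key (i + 1) (by simp)
  obtain ⟨q, hq, h2⟩ := key (i + 2) (by simp)
  obtain ⟨g, hg1, hg2⟩ := exists_point (ne_one i) (ne_two i) (one_ne_two i)
    (pairing p (ray (i + 1))) (pairing q (ray (i + 2)))
  refine ⟨g, fun r hr => ?_, fun j hj => ?_⟩
  · rw [chart_eq, mem_dualCone_pair, pairing_sub, pairing_sub]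
    have := h1 r hr
    have := h2 r hr
    omega
  · rw [chart_eq, Finset.mem_insert, Finset.mem_singleton] at hj
    rcases hj with rfl | rfl
    · exact ⟨p, hp, hg1.symm⟩
    · exact ⟨q, hq, hg2.symm⟩

/-- Three vectors whose consecutive differences are parallel to the lines of the triangle form a
translate of a multiple of the standard triangle. -/
theorem exists_smul_coordVec {h : Fin 3 → ℤ × ℤ}
    (hh : ∀ i, pairing (h i) (ray (i + 2)) = pairing (h (i + 1)) (ray (i + 2))) :
    ∃ (m : ℤ) (t : ℤ × ℤ), ∀ i, h i + t = m • coordVec i := by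
  have h0 : (h 0).2 = (h 1).2 := by simpa [pairing, ray] using hh 0
  have h1 : -(h 1).1 + -(h 1).2 = -(h 2).1 + -(h 2).2 := by
    simpa [pairing, ray] using hh 1
  have h2 : (h 2).1 = (h 0).1 := by simpa [pairing, ray] using hh 2
  -- As `coordVec 0` is the origin, the translation has to move `h 0` there; `m` is then the signed
  -- length of the side from `h 0` to `h 1`.
  refine ⟨(h 1).1 - (h 0).1, -h 0, fun i => ?_⟩
  fin_cases i <;> ext <;> simp [coordVec] <;> omega

namespace Sheaf.Degrees

variable {F : Sheaf.{u}} {D : F.Degrees}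

/-- Shapes of infinite type are closed under multiplication, so no product leaves the shape: the
sheaf has no torsion. -/
theorem mact_ne_zero (ht : ∀ v, IsConnShape (D.node v) (D.shape v) ⊤ ⊤) {i : Fin 3} {x : F.M i}
    (hx : x ≠ 0) {a : ℤ × ℤ} (ha : a ∈ dualCone (chart i)) : mact (chart i) a x ≠ 0 := by
  have hs : IsConnShape i (D.shape (D.cls hx)) ⊤ ⊤ := ht (D.cls hx)
  obtain ⟨y, hy, e⟩ : ∃ y, D.Conn x y ∧ D.deg i y = D.deg i x + a :=
    hs.add_mem (p := D.deg i x) ⟨x, .refl, rfl⟩ ha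
  have := (D.isDegree i).eq_mact hy hx (by rw [e, add_sub_cancel_left]; exact ha)
  rw [e, add_sub_cancel_left] at this
  rw [← this]
  exact hy.ne_zero hx

/-- The image of a section over a chart in the sections over the triple intersection. -/
def toG (F : Sheaf.{u}) (i : Fin 3) (x : F.M i) : F.G := F.resG i (F.resL i x)

theorem toG_mact {i : Fin 3} {a : ℤ × ℤ} (ha : a ∈ dualCone (chart i)) (x : F.M i) :
    toG F i (mact (chart i) a x) = mact ∅ a (toG F i x) := by
  unfold toG
  rw [(F.locL i).map_mact (isLocPair_out i) ha,
    (F.locG i).map_mact (isLocPair_empty i) (dualCone_mono (isLocPair_out i).sub ha)]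

theorem toG_ne_zero (ht : ∀ v, IsConnShape (D.node v) (D.shape v) ⊤ ⊤) {i : Fin 3} {x : F.M i}
    (hx : x ≠ 0) : toG F i x ≠ 0 := by
  have hp := isLocPair_out i
  have hL : ∀ {y : F.M i}, y ≠ 0 → F.resL i y ≠ 0 := by
    intro y hy h
    obtain ⟨a, ha, e⟩ := ((F.locL i).eq_zero_iff hp).1 h
    exact mact_ne_zero ht hy ha.1 e
  intro h
  obtain ⟨a, ha, e⟩ := ((F.locG i).eq_zero_iff (isLocPair_empty i)).1 h
  -- The monomial `a` belongs only to the monoid of the edge; multiplied by `t` it belongs to that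
  -- of the chart, where it cannot kill `x`.
  obtain ⟨t, ht', h1⟩ := hp.clear a ha.1
  refine hL (mact_ne_zero ht hx h1) ?_
  rw [(F.locL i).map_mact hp h1, add_comm, mact_add (hp.mem ht') ha.1, e, mact_zero_right]

theorem rel_of_toG {i : Fin 3} {x y : F.E i} {c : ℤ × ℤ}
    (h : mact ∅ c (F.resG i x) = F.resG i y) (h0 : F.resG i y ≠ 0) : Rel (edge i) x y c := by
  have h' : mact ∅ c (F.resG i x) = mact ∅ 0 (F.resG i y) := by rw [h, zero_mact]
  obtain ⟨t, h1, h2, h3, h4⟩ := (F.locG i).lift_eq (isLocPair_empty i) mem_dualCone_empty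
    (zero_mem _) h' (by rwa [h])
  exact ⟨_, h1, _, h2, h3, h4, by abel⟩

/-- Proportionality over the triple intersection descends through the edge to a common multiple in
the chart. Hence proportional sections share a component and the factor is their degree difference,
so the lattice acts freely. -/
theorem conn_of_toG {i : Fin 3} {x y : F.M i} {c : ℤ × ℤ}
    (h : mact ∅ c (toG F i x) = toG F i y) (h0 : toG F i y ≠ 0) :
    D.Conn x y ∧ c = D.deg i y - D.deg i x :=
  (D.isDegree i).conn_of_rel (isLocPair_out i) (F.locL i) (rel_of_toG h h0)

/-- A connected T-sheaf all of whose shapes have infinite types is torsion-free of rank one. -/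
theorem listed_of_top (hF : F.Connected) (ht : ∀ v, IsConnShape (D.node v) (D.shape v) ⊤ ⊤) :
    ∃ D' : TFData, F.Iso D'.sheaf := by
  classical
  obtain ⟨⟨i0, b, hb⟩, hF⟩ := hF
  have hb0 := toG_ne_zero ht hb
  -- Lying in the lattice orbit of the fixed section `b` is a separating predicate, so by
  -- connectedness every nonzero section lies in that orbit and acquires a position.
  have sep : F.IsSep fun i x => ∃ c, mact ∅ c (toG F i0 b) = toG F i x := by
    refine ⟨fun i a ha x _ => ?_, fun i a ha x y e _ => ?_⟩
    · rw [toG_mact ha]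
      constructor
      · rintro ⟨c, h⟩
        refine ⟨-a + c, ?_⟩
        rw [mact_add mem_dualCone_empty mem_dualCone_empty, h,
          ← mact_add mem_dualCone_empty mem_dualCone_empty, neg_add_cancel, zero_mact]
      · rintro ⟨c, h⟩
        exact ⟨a + c, by rw [mact_add mem_dualCone_empty mem_dualCone_empty, h]⟩
    · have h1 : mact ∅ a (toG F i x) = toG F (i + 1) y := by
        unfold toG
        rw [← F.compat, ← e, (F.locG i).map_mact (isLocPair_empty i) ha]
      rw [← h1]
      constructor
      · rintro ⟨c, h⟩
        exact ⟨a + c, by rw [mact_add mem_dualCone_empty mem_dualCone_empty, h]⟩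
      · rintro ⟨c, h⟩
        refine ⟨-a + c, ?_⟩
        rw [mact_add mem_dualCone_empty mem_dualCone_empty, h,
          ← mact_add mem_dualCone_empty mem_dualCone_empty, neg_add_cancel, zero_mact]
  have all : ∀ i (x : F.M i), x ≠ 0 → ∃ c, mact ∅ c (toG F i0 b) = toG F i x :=
    (hF _ sep).resolve_right fun h => h i0 b hb ⟨0, zero_mact _⟩
  choose! pos hpos using all
  -- positions in the triple intersection
  have uniq : ∀ {c c' : ℤ × ℤ}, mact ∅ c (toG F i0 b) = mact ∅ c' (toG F i0 b) → c = c' := by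
    intro c c' h
    have h1 : mact ∅ (-c' + c) (toG F i0 b) = toG F i0 b := by
      rw [mact_add mem_dualCone_empty mem_dualCone_empty, h,
        ← mact_add mem_dualCone_empty mem_dualCone_empty, neg_add_cancel, zero_mact]
    have h2 := (conn_of_toG (D := D) h1 hb0).2
    rw [sub_self, neg_add_eq_zero] at h2
    exact h2.symm
  have pos_eq : ∀ {i j} {x : F.M i} {y : F.M j} {a : ℤ × ℤ}, x ≠ 0 → y ≠ 0 →
      mact ∅ a (toG F i x) = toG F j y → pos j y = a + pos i x := by
    intro i j x y a hx hy h
    apply uniq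
    rw [hpos j y hy, mact_add mem_dualCone_empty mem_dualCone_empty, hpos i x hx, h]
  have to_eq : ∀ {i j} {x : F.M i} {y : F.M j}, x ≠ 0 → y ≠ 0 →
      mact ∅ (pos j y - pos i x) (toG F i x) = toG F j y := by
    intro i j x y hx hy
    rw [← hpos i x hx, ← mact_add mem_dualCone_empty mem_dualCone_empty, sub_add_cancel, hpos j y hy]
  have hconn : ∀ {i} {x y : F.M i}, x ≠ 0 → y ≠ 0 →
      D.Conn x y ∧ pos i y - pos i x = D.deg i y - D.deg i x :=
    fun hx hy => conn_of_toG (to_eq hx hy) (toG_ne_zero ht hy)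
  have hne : ∀ i, ∃ x : F.M i, x ≠ 0 := by
    intro i
    by_contra hcon
    push Not at hcon
    exact hb0 ((F.locG i).eq_zero_of_forall (isLocPair_empty i)
      ((F.locL i).eq_zero_of_forall (isLocPair_out i) hcon) _)
  choose x0 hx0 using hne
  -- On each chart degree and position have the same differences, so they differ by a constant.
  set C : Fin 3 → ℤ × ℤ := fun i => D.deg i (x0 i) - pos i (x0 i) with hC
  have hdeg : ∀ {i} {x : F.M i}, x ≠ 0 → D.deg i x = pos i x + C i := by
    intro i x hx
    have := (hconn (hx0 i) hx).2
    rw [hC, ← sub_eq_iff_eq_add', ← sub_add_sub_cancel _ (D.deg i (x0 i)), ← this]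
    abel_nf
  set S : Fin 3 → Set (ℤ × ℤ) := fun i => D.shape (D.cls (hx0 i)) with hS
  have hmemS : ∀ {i} {x : F.M i}, x ≠ 0 → D.deg i x ∈ S i :=
    fun {i x} hx => ⟨x, (hconn (hx0 i) hx).1, rfl⟩
  have hofS : ∀ {i p}, p ∈ S i → ∃ x : F.M i, x ≠ 0 ∧ D.deg i x = p := by
    rintro i p ⟨(x : F.M i), (hx : D.Conn (x0 i) x), rfl⟩
    exact ⟨x, hx.ne_zero (hx0 i), rfl⟩
  have hshape : ∀ i, IsConnShape i (S i) ⊤ ⊤ := fun i => ht (D.cls (hx0 i))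
  choose g hg using fun i => exists_isCorner (hshape i).skew.1 (hshape i).conn.1
  -- the corners are aligned
  have hcorner : ∀ i, pairing (g i - C i) (ray (i + 2)) =
      pairing (g (i + 1) - C (i + 1)) (ray (i + 2)) := by
    have low : ∀ {i j} {x : F.M i}, x ≠ 0 → j ∈ chart i →
        pairing (g i - C i) (ray j) ≤ pairing (pos i x) (ray j) := by
      intro i j x hx hj
      have := (hg i).le _ (hmemS hx) j hj
      rw [hdeg hx, pairing_sub, pairing_add] at this
      rw [pairing_sub]
      omega
    have touch : ∀ {i j}, j ∈ chart i → ∃ x : F.M i, x ≠ 0 ∧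
        pairing (pos i x) (ray j) = pairing (g i - C i) (ray j) := by
      intro i j hj
      obtain ⟨p, hp, h⟩ := (hg i).touch j hj
      obtain ⟨x, hx, rfl⟩ := hofS hp
      refine ⟨x, hx, ?_⟩
      rw [hdeg hx, pairing_add] at h
      rw [pairing_sub]
      omega
    have inv : ∀ {i j k} {a : ℤ × ℤ}, a ∈ inverted (chart i) (edge j) → k ∈ chart i →
        k ∈ edge j → pairing a (ray k) = 0 := by
      intro i j k a ha h1 h2
      have k1 := ha.1 k h1
      have k2 := ha.2 k h2
      rw [pairing_neg] at k2
      omega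
    intro i
    have m1 : i + 2 ∈ chart i := by rw [chart_eq]; simp
    have m2 : i + 2 ∈ chart (i + 1) := by rw [chart_eq, one_add_one]; simp
    have m3 : i + 2 ∈ edge i := by rw [edge_eq]; simp
    -- A section attaining the lowest height over one chart is carried to the other chart by a
    -- monomial inverted on their intersection. This does not change the height, so it bounds the
    -- corner of the other chart.
    apply le_antisymm
    · obtain ⟨y, hy, h⟩ := touch m2
      obtain ⟨a, ha, x, e⟩ := (F.locL i).exists_eq (F.resR i y)
      have h1 : mact ∅ a (toG F (i + 1) y) = toG F i x := by
        unfold toG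
        rw [← F.compat, ← e,
          (F.locG i).map_mact (isLocPair_empty i) ((isLocPair_out i).mem ha)]
      have hx : x ≠ 0 := by
        rintro rfl
        rw [(F.locL i).map_zero, (isLocPair_out i).mact_eq_zero ha] at e
        apply toG_ne_zero ht hy
        unfold toG
        rw [← F.compat, e, (F.locG i).map_zero]
      have h2 := low hx m1
      rw [pos_eq hy hx h1, pairing_add, inv ha m1 m3] at h2
      omega
    · obtain ⟨x, hx, h⟩ := touch m1
      obtain ⟨a, ha, y, e⟩ := (F.locR i).exists_eq (F.resL i x)
      have h1 : mact ∅ a (toG F i x) = toG F (i + 1) y := by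
        unfold toG
        rw [← F.compat, ← e,
          (F.locG i).map_mact (isLocPair_empty i) ((isLocPair_in i).mem ha)]
      have hy : y ≠ 0 := by
        rintro rfl
        rw [(F.locR i).map_zero, (isLocPair_in i).mact_eq_zero ha] at e
        apply toG_ne_zero ht hx
        unfold toG
        rw [e, (F.locG i).map_zero]
      have h2 := low hy m2
      rw [pos_eq hx hy h1, pairing_add, inv ha m2 m3] at h2
      omega
  -- Positions depend on the choice of `b`; the common translation `t` brings the three corners to
  -- `m • coordVec i`, where `placed` expects them.
  obtain ⟨m, t, hmt⟩ := exists_smul_coordVec hcorner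
  let D' : TFData := ⟨S, m, hshape, g, hg⟩
  have hplaced : ∀ {i} {x : F.M i}, x ≠ 0 → pos i x + t ∈ D'.placed i := by
    intro i x hx
    change pos i x + t - m • coordVec i + g i ∈ S i
    rw [← hmt]
    convert hmemS hx using 1
    rw [hdeg hx]; abel
  have hofplaced : ∀ {i p}, p ∈ D'.placed i → ∃ x : F.M i, x ≠ 0 ∧ pos i x + t = p := by
    intro i p hp
    obtain ⟨x, hx, e⟩ := hofS (show p - m • coordVec i + g i ∈ S i from hp)
    refine ⟨x, hx, ?_⟩
    rw [hdeg hx, ← hmt] at e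
    have : pos i x = p - (g i - C i + t) + g i - C i := by rw [← e]; abel
    rw [this]; abel
  let fam (i : Fin 3) := TFData.single (D'.placed i) (D'.placed_convex i)
  let f : ∀ i, F.M i → (fam i).Mod := fun i x => if x ≠ 0 then (fam i).box () (pos i x + t) else 0
  have f0 : ∀ i, f i 0 = 0 := fun i => if_neg (not_not.2 rfl)
  have f1 : ∀ {i} {x : F.M i}, x ≠ 0 → f i x = (fam i).box () (pos i x + t) := fun hx => if_pos hx
  have fne : ∀ {i} {x : F.M i}, x ≠ 0 → f i x ≠ 0 := by
    intro i x hx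
    rw [f1 hx]; exact ShapeFamily.box_ne_zero _ (hplaced hx)
  have inj : ∀ i, Function.Injective (f i) := by
    intro i x y h
    by_cases hx : x = 0
    · by_contra hne
      exact fne (x := y) (by rintro rfl; exact hne hx) (by rw [← h, hx, f0])
    · by_cases hy : y = 0
      · exact absurd (h.trans (by rw [hy, f0])) (fne hx)
      · rw [f1 hx, f1 hy] at h
        have h1 := add_right_cancel (ShapeFamily.box_inj _ (hplaced hx) h).2
        exact D.eq_of_deg (hconn hx hy).1 hx (by rw [hdeg hx, hdeg hy, h1])
  have surj : ∀ i, Function.Surjective (f i) := by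
    intro i z
    rcases ShapeFamily.cases_box _ z with rfl | ⟨⟨⟩, p, hp, rfl⟩
    · exact ⟨0, f0 i⟩
    · obtain ⟨x, hx, rfl⟩ := hofplaced hp
      exact ⟨x, f1 hx⟩
  have fact : ∀ i, ∀ a ∈ dualCone (chart i), ∀ x,
      f i (mact (chart i) a x) = mact (chart i) a (f i x) := by
    intro i a ha x
    by_cases hx : x = 0
    · rw [hx, mact_zero_right, f0, mact_zero_right]
    have h0 := mact_ne_zero ht hx ha
    rw [f1 hx, ShapeFamily.mact_box _ ha (hplaced hx), f1 h0, pos_eq hx h0 (toG_mact ha x).symm]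
    congr 1
    abel
  refine ⟨D', iso_of_charts (F' := D'.sheaf)
    (fun i => Equiv.ofBijective (f i) ⟨inj i, surj i⟩) f0 fact fun i y h0 => ?_⟩
  obtain ⟨a, ha, x, e⟩ := (F.locL i).exists_eq (F.resR i y)
  have e' : mact (edge i) (-a) (F.resL i x) = F.resR i y := by
    rw [← e, (isLocPair_out i).neg_mact ha]
  refine ⟨-a, ha.2, x, e', ?_⟩
  have hr := Rel.of_mact_eq ha.2 e' h0
  have hx := (F.locL i).ne_zero hr.ne_left
  have hy := (F.locR i).ne_zero hr.ne_right
  have h1 : mact ∅ (-a) (toG F i x) = toG F (i + 1) y := by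
    unfold toG
    rw [← F.compat, ← e', (F.locG i).map_mact (isLocPair_empty i) ha.2]
  have hhalf : pos i x + t ∈ D'.halfPlane i := by
    have := (hg i).le _ (hplaced hx) (i + 2) (by rw [chart_eq]; simp)
    rw [add_sub_cancel_right, pairing_sub] at this
    change pairing (D'.m • coordVec i) _ ≤ _
    omega
  have eL : D'.sheaf.resL i (f i x) =
      (TFData.single (D'.halfPlane i) (D'.halfPlane_convex i)).box () (pos i x + t) := by
    rw [f1 hx]
    exact TFData.incl_box _ _ (hplaced hx)
  have eR : D'.sheaf.resR i (f (i + 1) y) =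
      (TFData.single (D'.halfPlane i) (D'.halfPlane_convex i)).box () (pos (i + 1) y + t) := by
    rw [f1 hy]
    exact TFData.incl_box _ _ (hplaced hy)
  change mact (edge i) (-a) (D'.sheaf.resL i (f i x)) = D'.sheaf.resR i (f (i + 1) y)
  rw [eL, eR, pos_eq hx hy h1]
  refine (ShapeFamily.mact_box _ ha.2 hhalf).trans ?_
  congr 1
  abel

end Sheaf.Degrees

/-- Connected coherent T-sheaves are listed. -/
theorem Sheaf.Connected.isListed {F : Sheaf.{u}} (h : F.Connected) (hF : F.IsTSheaf) :
    F.IsListed := by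
  obtain ⟨D⟩ := hF.nonempty_degrees
  choose tIn tOut ht using D.exists_type
  -- Infinite type passes across a link by equality of types and through a shape by `top_iff`, so in
  -- a connected sheaf it holds everywhere or nowhere.
  have hP : ∀ v w s, D.Link v w s → (tOut v = ⊤ ↔ tOut w = ⊤) := by
    intro v w s hvw
    rw [hvw.type_eq (ht v) (ht w), (ht w).top_iff]
  rcases D.forall_comp h hP with htop | hfin
  · refine .inr (.inr (.inr (Sheaf.Degrees.listed_of_top (D := D) h fun v => ?_)))
    have := ht v
    rwa [(this.top_iff).2 (htop v), htop v] at this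
  · refine Sheaf.Degrees.listed_of_finite (D := D) h (tIn := fun v => (tIn v).toNat)
      (tOut := fun v => (tOut v).toNat) fun v => ?_
    rw [ENat.natCast_toNat (mt (ht v).top_iff.1 (hfin v)), ENat.natCast_toNat (hfin v)]
    exact ht v

/-! ## Coherence of shape modules -/

namespace ShapeFamily

variable {R : Finset (Fin 3)} (F : ShapeFamily R)

theorem modAlpha : ModAlpha R F.Mod := by
  refine modAlpha_of_mact fun a ha x y e h0 => ?_
  rcases F.cases_box x with rfl | ⟨v, p, hp, rfl⟩
  · exact absurd (mact_zero_right a) h0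
  rcases F.cases_box y with rfl | ⟨w, q, hq, rfl⟩
  · exact absurd (e.trans (mact_zero_right a)) h0
  rw [F.mact_box ha hp] at h0
  rw [F.mact_box ha hp, F.mact_box ha hq] at e
  have hpa : p + a ∈ F.T v := by
    by_contra hcon
    exact h0 (F.box_of_not_mem hcon)
  obtain ⟨rfl, h⟩ := F.box_inj hpa e
  rw [add_right_cancel h]

/-- The translations `c` are needed for torsion-free sheaves, whose placed shapes have been moved
out of the cone. -/
theorem modGradable (c : F.ι → ℤ × ℤ) (h : ∀ v, ∀ p ∈ F.T v, p + c v ∈ dualCone R) :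
    ModGradable R F.Mod := by
  have key : ∀ x : F.Mod, ∃ d : dualCone R, ∀ v p, p ∈ F.T v → x = F.box v p → d.1 = p + c v := by
    intro x
    rcases F.cases_box x with rfl | ⟨v, p, hp, rfl⟩
    · exact ⟨0, fun v p hp e => absurd e.symm (F.box_ne_zero hp)⟩
    · refine ⟨⟨p + c v, h v p hp⟩, fun w q hq e => ?_⟩
      obtain ⟨rfl, rfl⟩ := F.box_inj hp e
      rfl
  choose deg hdeg using key
  refine ⟨deg, fun a ha x h0 => Subtype.ext ?_⟩
  rw [← mact_of_mem ha] at h0 ⊢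
  rcases F.cases_box x with rfl | ⟨v, p, hp, rfl⟩
  · exact absurd (mact_zero_right a) h0
  rw [F.mact_box ha hp] at h0
  have hpa : p + a ∈ F.T v := by
    by_contra hcon
    exact h0 (F.box_of_not_mem hcon)
  rw [F.mact_box ha hp, hdeg _ v _ hpa rfl, AddSubmonoid.coe_add, hdeg _ v _ hp rfl]
  change p + a + c v = a + (p + c v)
  abel

end ShapeFamily

/-- Subsets of a translate of a maximal cone have finitely many minimal elements. -/
theorem exists_finite_minimal {j k : Fin 3} {T : Set (ℤ × ℤ)} (c : ℤ × ℤ)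
    (h : ∀ p ∈ T, p + c ∈ dualCone {j, k}) :
    ∃ B : Set (ℤ × ℤ), B.Finite ∧ B ⊆ T ∧ ∀ p ∈ T, ∃ g ∈ B, p - g ∈ dualCone {j, k} := by
  set e : ℤ × ℤ → ℕ × ℕ := fun p =>
    ((pairing (p + c) (ray j)).toNat, (pairing (p + c) (ray k)).toNat) with he
  -- Dickson's lemma: antichains in `ℕ × ℕ` are finite.
  have hfin : {m | Minimal (· ∈ e '' T) m}.Finite :=
    WellQuasiOrderedLE.finite_of_isAntichain (setOfPred_minimal_antichain _)
  have hpre : ∀ m ∈ {m | Minimal (· ∈ e '' T) m}, ∃ p ∈ T, e p = m := fun m hm => hm.prop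
  choose! s hs1 hs2 using hpre
  refine ⟨s '' {m | Minimal (· ∈ e '' T) m}, hfin.image s, ?_, fun p hp => ?_⟩
  · rintro _ ⟨m, hm, rfl⟩; exact hs1 m hm
  · obtain ⟨m, hle, hm⟩ := exists_minimal_le_of_wellFoundedLT (· ∈ e '' T) (e p) ⟨p, hp, rfl⟩
    refine ⟨s m, ⟨m, hm, rfl⟩, ?_⟩
    rw [← hs2 m hm, he, Prod.le_def] at hle
    have h1 := mem_dualCone_pair.1 (h p hp)
    have h2 := mem_dualCone_pair.1 (h _ (hs1 m hm))
    simp only [pairing_add] at hle h1 h2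
    rw [mem_dualCone_pair, pairing_sub, pairing_sub]
    omega

theorem ShapeFamily.modFG {j k : Fin 3} (F : ShapeFamily {j, k}) [Finite F.ι] (c : F.ι → ℤ × ℤ)
    (h : ∀ v, ∀ p ∈ F.T v, p + c v ∈ dualCone {j, k}) : ModFG {j, k} F.Mod := by
  choose B hB1 hB2 hB3 using fun v => exists_finite_minimal (c v) (h v)
  have hfin : (insert 0 (⋃ v, F.box v '' B v)).Finite :=
    (Set.finite_iUnion fun v => (hB1 v).image _).insert 0
  refine ⟨hfin.toFinset, fun x => ?_⟩
  rcases F.cases_box x with rfl | ⟨v, p, hp, rfl⟩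
  · exact ⟨0, 0, hfin.mem_toFinset.2 (Set.mem_insert _ _), (zero_smul _ _).symm⟩
  · obtain ⟨g, hg, hpg⟩ := hB3 v p hp
    refine ⟨mono _ hpg, F.box v g, hfin.mem_toFinset.2 (.inr (Set.mem_iUnion.2 ⟨v, g, hg, rfl⟩)), ?_⟩
    rw [← mact_of_mem hpg, F.mact_box hpg (hB2 v hg), add_sub_cancel]

/-! ## The listed sheaves are coherent and connected -/

theorem ActInvariant.box {R : Finset (Fin 3)} {F : ShapeFamily R} {A : F.Mod → Prop}
    (hA : ActInvariant R A) {v : F.ι} {p q : ℤ × ℤ} (hp : p ∈ F.T v) (hq : q ∈ F.T v)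
    (h : q - p ∈ dualCone R) : A (F.box v p) ↔ A (F.box v q) := by
  have h1 := F.mact_box h hp
  rw [add_sub_cancel] at h1
  have h2 := hA (q - p) h (F.box v p)
  rw [h1] at h2
  exact (h2 (F.box_ne_zero hq)).symm

namespace Gluing

variable (D : Gluing)

theorem isTSheaf (hV : Finite D.V) (h : ∀ v, D.S v ⊆ dualCone (chart (D.node v))) :
    D.sheaf.IsTSheaf := by
  have hc : ∀ i (v : D.V), ∀ p ∈ (D.famM i).T v, p + 0 ∈ dualCone (chart i) := by
    rintro i v p ⟨rfl, hp⟩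
    rw [add_zero]; exact h v hp
  refine ⟨fun i => (D.famM i).modAlpha, fun i => (D.famE i).modAlpha, famG.modAlpha,
    fun i => ?_, fun i => (D.famM i).modGradable (fun _ => 0) (hc i)⟩
  change ModFG (chart i) (D.famM i).Mod
  have hfin : Finite (D.famM i).ι := hV
  have key : ∀ (R : Finset (Fin 3)) (F : ShapeFamily R), R = {i + 1, i + 2} → Finite F.ι →
      (∀ v, ∀ p ∈ F.T v, p + 0 ∈ dualCone R) → ModFG R F.Mod := by
    rintro _ F rfl _ hF
    exact F.modFG (fun _ => 0) hF
  exact key _ _ (chart_eq i) hfin (hc i)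

/-- A separating predicate is constant on each shape, since chains of comparable boxes join its
boxes. By `hE` each gluing identifies at least one actual box of `S w`, which transfers the value to
the preceding shape, and `hV` says that the gluings join all shapes. -/
theorem connected (hS : ∀ v, IsConn (D.node v) (D.S v)) (v0 : D.V)
    (hV : ∀ P : D.V → Prop, (∀ v w, D.prev w = some v → (P w ↔ P v)) → ∀ v, P v ↔ P v0)
    (hE : ∀ v w, D.prev w = some v → ∃ p ∈ D.S w, p ∈ inEnd (D.node w) (D.S w)) :
    D.sheaf.Connected := by
  refine ⟨?_, fun A hA => ?_⟩
  · obtain ⟨p, hp⟩ := (hS v0).1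
    exact ⟨D.node v0, (D.famM (D.node v0)).box v0 p, (D.famM (D.node v0)).box_ne_zero ⟨rfl, hp⟩⟩
  have hbox : ∀ i v, D.node v = i → ∀ p ∈ D.S v, ∀ q ∈ D.S v,
      (A i ((D.famM i).box v p) ↔ A i ((D.famM i).box v q)) := by
    rintro _ v rfl p hp q hq
    have h := (hS v).2 p hp q hq
    clear hp hq
    induction h with
    | rel a b h =>
      exact (hA.act (D.node v)).box (F := D.famM (D.node v)) (v := v) ⟨rfl, h.1⟩ ⟨rfl, h.2.1⟩ h.2.2
    | refl a => exact Iff.rfl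
    | symm a b _ ih => exact ih.symm
    | trans a b c _ _ ih1 ih2 => exact ih1.trans ih2
  have hP : ∀ i v, D.node v = i → ∀ p ∈ D.S v,
      ((∃ p ∈ D.S v, A (D.node v) ((D.famM (D.node v)).box v p)) ↔ A i ((D.famM i).box v p)) := by
    rintro _ v rfl p hp
    exact ⟨fun ⟨q, hq, h⟩ => (hbox _ v rfl q hq p hp).1 h, fun h => ⟨p, hp, h⟩⟩
  have key := hV (fun v => ∃ p ∈ D.S v, A (D.node v) ((D.famM (D.node v)).box v p)) ?_
  · have hall : ∀ i (m : D.sheaf.M i), m ≠ 0 → (A i m ↔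
        ∃ p ∈ D.S v0, A (D.node v0) ((D.famM (D.node v0)).box v0 p)) := by
      intro i m hm
      rcases (D.famM i).cases_box m with rfl | ⟨v, p, ⟨hv, hp⟩, rfl⟩
      · exact absurd rfl hm
      · exact (hP i v hv p hp).symm.trans (key v)
    by_cases h0 : ∃ p ∈ D.S v0, A (D.node v0) ((D.famM (D.node v0)).box v0 p)
    · exact .inl fun i m hm => (hall i m hm).2 h0
    · exact .inr fun i m hm => mt (hall i m hm).1 h0
  · intro v w h
    obtain ⟨p, hp, hp'⟩ := hE v w h
    have hw := D.prev_node v w h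
    have hpo := (D.glue v w h p).1 hp'
    -- The translated box belongs to the localization but perhaps not to `S v`. Multiplication by
    -- `a` moves it into `S v`, and over the intersection `a` can be divided out again.
    obtain ⟨a, ha, hab⟩ := id hpo
    have hq : p + D.shift w + a ∈ D.S v := by
      simpa only [add_zero] using hab 0 (zero_mem_inverted _ _)
    have hq' : p + D.shift w + a ∈ outEnd (D.node v) (D.S v) :=
      ⟨0, zero_mem_inverted _ _, fun b hb => by rw [add_zero]; exact hab b hb⟩
    have eL : D.sheaf.resL (D.node v) ((D.famM (D.node v)).box v (p + D.shift w + a)) =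
        (D.famE (D.node v)).box v (p + D.shift w + a) := by
      exact (ShapeFamily.mapMod_some (D.famM (D.node v)) (D.famE (D.node v)) some 0
        (v := v) (w := v) ⟨rfl, hq⟩ rfl).trans
          (congrArg ((D.famE (D.node v)).box v) (add_zero _))
    have eR : D.sheaf.resR (D.node v) ((D.famM (D.node v + 1)).box w p) =
        (D.famE (D.node v)).box v (p + D.shift w) :=
      ShapeFamily.mapMod_some (D.famM (D.node v + 1)) (D.famE (D.node v)) D.prev D.shift
        (v := w) ⟨hw, hp⟩ h
    have e : mact (edge (D.node v)) (-a) (D.sheaf.resL (D.node v)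
        ((D.famM (D.node v)).box v (p + D.shift w + a))) =
        D.sheaf.resR (D.node v) ((D.famM (D.node v + 1)).box w p) := by
      rw [eL, eR]
      refine ((D.famE (D.node v)).mact_box ha.2 (v := v) ⟨rfl, hq'⟩).trans ?_
      rw [add_neg_cancel_right]
    have hg := hA.glue (D.node v) (-a) ha.2 _ _ e (by
      rw [eR]; exact (D.famE (D.node v)).box_ne_zero ⟨rfl, hpo⟩)
    exact ((hP _ w hw p hp).trans hg.symm).trans (hP _ v rfl _ hq).symm

end Gluing

theorem PointData.isTSheaf (D : PointData) : D.sheaf.IsTSheaf := by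
  refine Gluing.isTSheaf _ ?_ fun _ => D.isShape.skew.1
  exact inferInstanceAs (Finite Unit)

theorem PointData.connected (D : PointData) : D.sheaf.Connected :=
  Gluing.connected _ (fun _ => D.isShape.conn) () (fun _ _ _ => Iff.rfl) nofun

theorem HelixData.isTSheaf (D : HelixData) : D.sheaf.IsTSheaf := by
  refine Gluing.isTSheaf _ ?_ fun r => (D.isShape r).skew.1
  exact inferInstanceAs (Finite (Fin (D.N + 1)))

theorem HelixData.connected (D : HelixData) : D.sheaf.Connected := by
  refine Gluing.connected _ (fun r => (D.isShape r).conn) (0 : Fin (D.N + 1)) ?_ ?_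
  · intro P hP (r : Fin (D.N + 1))
    induction r using Fin.induction with
    | zero => exact Iff.rfl
    | succ r ih => exact (hP r.castSucc r.succ rfl).trans ih
  · intro v (w : Fin (D.N + 1)) h
    cases w using Fin.cases with
    | zero => cases h
    | succ r =>
      refine (D.isShape r.succ).ne_zero_in_iff.1 ?_
      have := D.nonzero r
      rw [D.matching r] at this
      exact_mod_cast this.ne'

theorem CycleData.isTSheaf (D : CycleData) : D.sheaf.IsTSheaf := by
  refine Gluing.isTSheaf _ ?_ fun r => (D.isShape r).skew.1
  exact inferInstanceAs (Finite (Fin (D.N + 1)))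

theorem CycleData.connected (D : CycleData) : D.sheaf.Connected := by
  refine Gluing.connected _ (fun r => (D.isShape r).conn) (0 : Fin (D.N + 1)) ?_ ?_
  · intro P hP (r : Fin (D.N + 1))
    induction r using Fin.induction with
    | zero => exact Iff.rfl
    | succ r ih =>
      refine (hP r.castSucc r.succ ?_).trans ih
      change some (r.succ - 1) = some r.castSucc
      rw [← Fin.coeSucc_eq_succ, add_sub_cancel_right]
  · intro v (w : Fin (D.N + 1)) _
    refine (D.isShape w).ne_zero_in_iff.1 ?_
    have := D.nonzero (w - 1)
    rw [D.matching, sub_add_cancel] at this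
    exact_mod_cast this.ne'

namespace TFData

variable (D : TFData)

theorem le_of_mem_placed {i k : Fin 3} (hk : k ∈ chart i) {p : ℤ × ℤ} (hp : p ∈ D.placed i) :
    pairing (D.m • coordVec i) (ray k) ≤ pairing p (ray k) := by
  have := (D.isCorner i).le _ hp k hk
  rw [add_sub_cancel_right, pairing_sub] at this
  omega

theorem isTSheaf : D.sheaf.IsTSheaf := by
  have hc : ∀ i (v : Unit), ∀ p ∈ D.placed i, p + (D.g i - D.m • coordVec i) ∈ dualCone (chart i) := by
    intro i _ p hp
    have : p + (D.g i - D.m • coordVec i) = p - D.m • coordVec i + D.g i := by abel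
    rw [this]
    exact (D.isShape i).skew.1 hp
  have key : ∀ (R : Finset (Fin 3)) (T : Set (ℤ × ℤ)) (hT : IsConvex R T) (i : Fin 3) (c : ℤ × ℤ),
      R = {i + 1, i + 2} → (∀ p ∈ T, p + c ∈ dualCone R) → ModFG R (single T hT).Mod := by
    rintro _ T hT i c rfl h
    have : Finite (single T hT).ι := inferInstanceAs (Finite Unit)
    exact (single T hT).modFG (fun _ => c) fun _ => h
  exact ⟨fun i => ShapeFamily.modAlpha _, fun i => ShapeFamily.modAlpha _, ShapeFamily.modAlpha _,
    fun i => key _ _ (D.placed_convex i) i _ (chart_eq i) (hc i ()),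
    fun i => ShapeFamily.modGradable _ _ (hc i)⟩

theorem connected : D.sheaf.Connected := by
  let fam (i : Fin 3) := single (D.placed i) (D.placed_convex i)
  have hne : ∀ i, ∃ p, p ∈ D.placed i := by
    intro i
    obtain ⟨p, hp⟩ := (D.isShape i).conn.1
    refine ⟨p - D.g i + D.m • coordVec i, ?_⟩
    change p - D.g i + D.m • coordVec i - D.m • coordVec i + D.g i ∈ D.S i
    rwa [add_sub_cancel_right, sub_add_cancel]
  choose x hx using hne
  refine ⟨⟨0, (fam 0).box () (x 0), (fam 0).box_ne_zero (hx 0)⟩, fun A hA => ?_⟩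
  have hup : ∀ {i p q}, p ∈ D.placed i → q - p ∈ dualCone (chart i) →
      (q ∈ D.placed i ∧ (A i ((fam i).box () p) ↔ A i ((fam i).box () q))) := by
    intro i p q hp h
    have hq := D.placed_upper i hp h
    rw [add_sub_cancel] at hq
    exact ⟨hq, (hA.act i).box (F := fam i) (v := ()) hp hq h⟩
  have hsame : ∀ {i p q}, p ∈ D.placed i → q ∈ D.placed i →
      (A i ((fam i).box () p) ↔ A i ((fam i).box () q)) := by
    intro i p q hp hq
    -- The least common multiple of two boxes stays in the shape, which is closed under
    -- multiplication.
    obtain ⟨r, h1, h2⟩ := exists_point (ne_one i) (ne_two i) (one_ne_two i)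
      (max (pairing p (ray (i + 1))) (pairing q (ray (i + 1))))
      (max (pairing p (ray (i + 2))) (pairing q (ray (i + 2))))
    refine (hup (q := r) hp ?_).2.trans (hup (q := r) hq ?_).2.symm <;>
      rw [chart_eq, mem_dualCone_pair, pairing_sub, pairing_sub] <;> omega
  have hnext : ∀ i, (A i ((fam i).box () (x i)) ↔ A (i + 1) ((fam (i + 1)).box () (x (i + 1)))) := by
    intro i
    have hmem : i + 2 ∈ chart (i + 1) := by rw [chart_eq, one_add_one]; simp
    have h1 : x (i + 1) ∈ D.halfPlane i := by
      have := D.le_of_mem_placed hmem (hx (i + 1))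
      rwa [pairing_zsmul, coordVec_edge, ← pairing_zsmul] at this
    -- After placement the gluings are identities, so a box of the next chart becomes a box of this
    -- one after multiplication by a monomial inverted on the intersection.
    obtain ⟨a, ha, hab⟩ := (D.localize_placed (ne_one i) (ne_two i) (one_ne_two i) _).2 h1
    have hq : x (i + 1) + a ∈ D.placed i := by
      simpa only [add_zero] using hab 0 (zero_mem_inverted _ _)
    rw [← edge_eq] at ha
    have hq' : x (i + 1) + a ∈ D.halfPlane i := by
      apply D.le_of_mem_placed _ hq
      rw [chart_eq]; simp
    have eL : D.sheaf.resL i ((fam i).box () (x (i + 1) + a)) =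
        (single (D.halfPlane i) (D.halfPlane_convex i)).box () (x (i + 1) + a) :=
      incl_box _ _ hq
    have eR : D.sheaf.resR i ((fam (i + 1)).box () (x (i + 1))) =
        (single (D.halfPlane i) (D.halfPlane_convex i)).box () (x (i + 1)) :=
      incl_box _ _ (hx (i + 1))
    refine (hsame (hx i) hq).trans (hA.glue i (-a) ha.2 _ _ ?_ ?_)
    · rw [eL, eR]
      refine (ShapeFamily.mact_box (single (D.halfPlane i) (D.halfPlane_convex i)) ha.2 (v := ()) hq').trans ?_
      rw [add_neg_cancel_right]
    · rw [eR]; exact ShapeFamily.box_ne_zero _ h1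
  have hall : ∀ i (m : D.sheaf.M i), m ≠ 0 → (A i m ↔ A 0 ((fam 0).box () (x 0))) := by
    intro i m hm
    rcases (fam i).cases_box m with rfl | ⟨⟨⟩, p, hp, rfl⟩
    · exact absurd rfl hm
    · refine (hsame hp (hx i)).trans ?_
      have h1 := hnext 0
      have h2 := hnext 1
      fin_cases i
      · exact Iff.rfl
      · exact h1.symm
      · exact h2.symm.trans h1.symm
  by_cases h0 : A 0 ((fam 0).box () (x 0))
  · exact .inl fun i m hm => (hall i m hm).2 h0
  · exact .inr fun i m hm => mt (hall i m hm).1 h0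

end TFData

theorem Sheaf.IsListed.isTSheaf_and_connected {F : Sheaf.{u}} (h : F.IsListed) :
    F.IsTSheaf ∧ F.Connected := by
  rcases h with ⟨D, h⟩ | ⟨D, h⟩ | ⟨D, h⟩ | ⟨D, h⟩ <;>
    exact ⟨D.isTSheaf.of_iso h.symm, D.connected.of_iso h.symm⟩

theorem Sheaf.isListed_iff {F : Sheaf.{u}} : F.IsListed ↔ F.IsTSheaf ∧ F.Indecomposable :=
  ⟨fun h => h.isTSheaf_and_connected.imp_right Connected.indecomposable,
    fun h => h.2.connected.isListed h.1⟩

/-! ## Direct sums of coherent T-sheaves -/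

section Wedge

variable {M : Type u} {N : Type v} [Zero M] [Zero N]

/-- The inclusion of the first axis. -/
def Wedge.inl (x : M) : Wedge M N := ⟨(x, 0), .inr rfl⟩

/-- The inclusion of the second axis. -/
def Wedge.inr (y : N) : Wedge M N := ⟨(0, y), .inl rfl⟩

/-- The wedge with a zero module on the right. -/
def Wedge.equivLeft (h : ∀ y : N, y = 0) : Wedge M N ≃ M where
  toFun w := w.1.1
  invFun := Wedge.inl
  left_inv _ := Subtype.ext (Prod.ext rfl (h _).symm)
  right_inv _ := rfl

/-- The wedge with a zero module on the left. -/
def Wedge.equivRight (h : ∀ x : M, x = 0) : Wedge M N ≃ N where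
  toFun w := w.1.2
  invFun := Wedge.inr
  left_inv _ := Subtype.ext (Prod.ext (h _).symm rfl)
  right_inv _ := rfl

variable {R : Finset (Fin 3)} [MulActionWithZero (ConeMonoid R) M] [MulActionWithZero (ConeMonoid R) N]

theorem Wedge.inl_smul (a : ConeMonoid R) (x : M) : (inl (a • x) : Wedge M N) = a • inl x :=
  Subtype.ext (Prod.ext rfl (smul_zero a).symm)

theorem Wedge.inr_smul (a : ConeMonoid R) (y : N) : (inr (a • y) : Wedge M N) = a • inr y :=
  Subtype.ext (Prod.ext (smul_zero a).symm rfl)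

theorem Wedge.inl_injective : Function.Injective (inl : M → Wedge M N) :=
  fun _ _ h => congrArg (fun w => w.1.1) h

theorem Wedge.inr_injective : Function.Injective (inr : N → Wedge M N) :=
  fun _ _ h => congrArg (fun w => w.1.2) h

end Wedge

namespace Sheaf

theorem sum_iso_left {A B : Sheaf.{u}} (h : B.IsZero) : (A.sum B).Iso A :=
  ⟨fun i => Wedge.equivLeft (h.1 i), fun i => Wedge.equivLeft (h.2.1 i), Wedge.equivLeft h.2.2,
    fun _ _ _ => rfl, fun _ _ _ => rfl, fun _ _ => rfl, fun _ _ => rfl, fun _ _ => rfl,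
    fun _ _ => rfl⟩

theorem sum_iso_right {A B : Sheaf.{u}} (h : A.IsZero) : (A.sum B).Iso B :=
  ⟨fun i => Wedge.equivRight (h.1 i), fun i => Wedge.equivRight (h.2.1 i), Wedge.equivRight h.2.2,
    fun _ _ _ => rfl, fun _ _ _ => rfl, fun _ _ => rfl, fun _ _ => rfl, fun _ _ => rfl,
    fun _ _ => rfl⟩

theorem IsTSheaf.left {A B : Sheaf.{u}} (h : (A.sum B).IsTSheaf) : A.IsTSheaf :=
  ⟨fun i => ModAlpha.of_injective (h.1 i) Wedge.inl_injective Wedge.inl_smul,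
    fun i => ModAlpha.of_injective (h.2.1 i) Wedge.inl_injective Wedge.inl_smul,
    ModAlpha.of_injective h.2.2.1 Wedge.inl_injective Wedge.inl_smul,
    fun i => ModFG.of_surjective (h.2.2.2.1 i) (f := fun w => w.1.1) (fun x => ⟨Wedge.inl x, rfl⟩)
      fun _ _ => rfl,
    fun i => ModGradable.of_injective (h.2.2.2.2 i) Wedge.inl_injective Wedge.inl_smul⟩

theorem IsTSheaf.right {A B : Sheaf.{u}} (h : (A.sum B).IsTSheaf) : B.IsTSheaf :=
  ⟨fun i => ModAlpha.of_injective (h.1 i) Wedge.inr_injective Wedge.inr_smul,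
    fun i => ModAlpha.of_injective (h.2.1 i) Wedge.inr_injective Wedge.inr_smul,
    ModAlpha.of_injective h.2.2.1 Wedge.inr_injective Wedge.inr_smul,
    fun i => ModFG.of_surjective (h.2.2.2.1 i) (f := fun w => w.1.2) (fun x => ⟨Wedge.inr x, rfl⟩)
      fun _ _ => rfl,
    fun i => ModGradable.of_injective (h.2.2.2.2 i) Wedge.inr_injective Wedge.inr_smul⟩

end Sheaf

/-! ## The Hall Lie algebra -/

theorem TSheaf.cls_eq_iff {F F' : TSheaf} : F.cls = F'.cls ↔ F.1.Iso F'.1 :=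
  ⟨fun h => Quotient.exact h, fun h => Quotient.sound h⟩

theorem cls_mem_listed {F : TSheaf} : F.cls ∈ listed ↔ F.1.Indecomposable := by
  constructor
  · rintro ⟨F', h', e⟩
    have h := (h'.isTSheaf_and_connected.2.of_iso (TSheaf.cls_eq_iff.1 e).symm)
    exact h.indecomposable
  · exact fun h => ⟨F, Sheaf.isListed_iff.2 ⟨F.2, h⟩, rfl⟩

theorem hallOne_of_isZero (k : Type v) [Field k] {F : TSheaf} (h : F.1.IsZero) : hallOne k F = 1 :=
  if_pos h

theorem hallOne_of_not_isZero (k : Type v) [Field k] {F : TSheaf} (h : ¬ F.1.IsZero) :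
    hallOne k F = 0 := if_neg h

/-- A finitely supported function is primitive if and only if it vanishes on decomposable sheaves. -/
theorem mem_hallLie_iff {k : Type v} [Field k] {f : IsoClass →₀ k} :
    f ∈ hallLie k ↔ ∀ c ∉ listed, f c = 0 := by
  constructor
  · intro hf c hc
    obtain ⟨Z, rfl⟩ : ∃ Z : TSheaf, c = Z.cls := by
      induction c using Quotient.inductionOn with
      | h Z => exact ⟨Z, rfl⟩
    rw [cls_mem_listed] at hc
    by_cases h0 : Z.1.IsZero
    -- A zero sheaf is the sum of two copies of itself, so primitivity says that the value there
    -- equals twice itself.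
    · have := hf Z Z Z (Sheaf.sum_iso_left h0).symm
      rw [hallOne_of_isZero k h0, mul_one, one_mul] at this
      exact left_eq_add.1 this
    · unfold Sheaf.Indecomposable at hc
      push Not at hc
      obtain ⟨A, B, h, hA, hB⟩ := hc h0
      have hT := Z.2.of_iso h
      rw [hf ⟨A, hT.left⟩ ⟨B, hT.right⟩ Z h, hallOne_of_not_isZero k (F := ⟨A, hT.left⟩) hA,
        hallOne_of_not_isZero k (F := ⟨B, hT.right⟩) hB, mul_zero,
        zero_mul, add_zero]
  · intro hf X Y Z h
    -- The zero class is not listed. So if one summand is zero, primitivity reduces to the value at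
    -- the other; if neither is, the sum is decomposable and both sides vanish.
    have hz : ∀ {W : TSheaf}, W.1.IsZero → f W.cls = 0 := fun hW =>
      hf _ fun hl => (cls_mem_listed.1 hl).1 hW
    by_cases hX : X.1.IsZero
    · rw [TSheaf.cls_eq_iff.2 (h.trans (Sheaf.sum_iso_right hX)), hz hX, hallOne_of_isZero k hX, zero_mul, one_mul, zero_add]
    · by_cases hY : Y.1.IsZero
      · rw [TSheaf.cls_eq_iff.2 (h.trans (Sheaf.sum_iso_left hY)), hz hY, hallOne_of_isZero k hY, mul_zero, mul_one, add_zero]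
      · rw [hallOne_of_not_isZero k hX, hallOne_of_not_isZero k hY, mul_zero, zero_mul, add_zero]
        exact hf _ fun hl => ((cls_mem_listed.1 hl).2 _ _ h).elim hX hY

end MonoidP2

/-- Indecomposable coherent T-sheaves on `P^2` are exactly the sheaves isomorphic to a point sheaf, a
helix, a cycle, or a rank-one torsion-free sheaf `𝔗𝔉[S_i, m]`; the delta functions of their
isomorphism classes form a basis of the Hall Lie algebra. -/
theorem proposition6p6 :
    (∀ F : MonoidP2.Sheaf.{u}, F.IsTSheaf ∧ F.Indecomposable ↔
      (∃ D : MonoidP2.PointData, F.Iso D.sheaf) ∨ (∃ D : MonoidP2.HelixData, F.Iso D.sheaf) ∨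
        (∃ D : MonoidP2.CycleData, F.Iso D.sheaf) ∨ ∃ D : MonoidP2.TFData, F.Iso D.sheaf) ∧
    ∀ (k : Type v) [Field k] [CharZero k],
      LinearIndepOn k (fun c => Finsupp.single c (1 : k)) MonoidP2.listed ∧
      Submodule.span k ((fun c => Finsupp.single c (1 : k)) '' MonoidP2.listed) =
        MonoidP2.hallLie k := by
  refine ⟨fun F => MonoidP2.Sheaf.isListed_iff.symm, fun k _ _ => ⟨?_, ?_⟩⟩
  · exact (Finsupp.linearIndependent_single_one k MonoidP2.IsoClass).linearIndepOn _
  -- The span of the delta functions consists of the functions supported on the listed classes,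
  -- which is the description of primitive elements.
  · rw [← Finsupp.supported_eq_span_single]
    ext f
    rw [MonoidP2.mem_hallLie_iff, Finsupp.mem_supported']
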